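/- Let $P\subset\mathbb E^d$ be a $d$-dimensional parallelohedron, i.e. a full-dimensional convex polytope, and let $\mathcal T_P\ni P$ be a face-to-face tiling of $\mathbb E^d$ by translates of $P$ (any two cells have disjoint interiors and meet in the empty set or in a common face). Let $s$ be a canonical scaling of $\mathcal T_P$: a positive function on the $(d-1)$-faces such that for every $(d-2)$-face $G$ and each direction of going round $G$, $\sum_{F\supset G}s(F)\,\mathbf n_F=0$, where $F$ runs over all $(d-1)$-faces of $\mathcal T_P$ containing $G$ and $\mathbf n_F$ is the unit normal to $F$ chosen in agreement with the direction of going round. Assume that $s$ is translation invariant, i.e. preserved by all translations that preserve $\mathcal T_P$. Let $\mathcal G_P\subset\mathbb E^{d+1}=\mathbb E^d\times\mathbb R$ be the union of all lifts $L[P_0,\dots,P_k]$ along chains of cells with $P_0=P$ and $P_{i-1},P_i$ adjacent by a $(d-1)$-face, where $L[P_0]=P\times\{0\}$ with normal $(0,-1)$, and $L[P_0,\dots,P_i]$ is the lift of $P_i$ that meets $L[P_0,\dots,P_{i-1}]$ in a lift of $P_{i-1}\cap P_i$ and whose normal is obtained by adding $s(P_{i-1}\cap P_i)\,\mathbf n_{i-1,i}$,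 with $\mathbf n_{i-1,i}$ the unit normal to $P_{i-1}\cap P_i$ directed from $P_{i-1}$ to $P_i$. Then $P$ has a centre of symmetry $c$. There is exactly one symmetric nondegenerate $d\times d$ matrix $Q$ with $Q\,\mathbf p=s\bigl(P\cap(P+\mathbf p)\bigr)\,\mathbf n$ for every vector $\mathbf p$ such that $P+\mathbf p$ is a cell adjacent to $P$ by a $(d-1)$-face, $\mathbf n$ being the unit normal to that face directed from $P$ to $P+\mathbf p$; this $Q$ is positive definite. There are linear isomorphisms $\mathcal A_d$ of $\mathbb E^d$ that take the form $Q(x)=\tfrac12x^TQx$ to the standard form, $\tfrac12x^TQx=\sum_i(\mathcal A_dx)_i^2$. For each such $\mathcal A_d$, take the origin of $\mathbb E^d$ at $c$; that is, let $\mathcal T_{\mathcal A_dP}$ be the image of $\mathcal T_P$ under $x\mapsto\mathcal A_d(x-c)$ and let $\mathcal G_{\mathcal A_dP}$ be the image of $\mathcal G_P$ under $(x,h)\mapsto(\mathcal A_d(x-c),h)$. Then: (a) The centres of the cells of $\mathcal T_{\mathcal A_dP}$ form a $d$-dimensional lattice $\Lambda$ (the integer span of a basis of $\mathbb E^d$),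 every cell has a centre, and the cell with centre $\mathbf p$ is the Dirichlet (Voronoi) cell $\{x:\|x-\mathbf p\|\le\|x-\mathbf q\|\ \ \forall\,\mathbf q\in\Lambda\}$. Thus $\mathcal T_{\mathcal A_dP}$ is a tiling by Voronoi parallelohedra. (b) $\mathcal G_{\mathcal A_dP}$ is a generatrix of $\mathcal T_{\mathcal A_dP}$: it is the graph of a continuous function $\mathbb E^d\to\mathbb R$ that is affine on every cell and is not given by a single affine function on the union of any two distinct cells. (c) $\mathcal G_{\mathcal A_dP}$ is circumscribed about the standard paraboloid $y^{d+1}=\sum_{i=1}^d(y^i)^2$: it lies nowhere above the paraboloid, meets it exactly over the centres of the cells, and its part over each cell lies in the tangent hyperplane to the paraboloid at the point above the centre of that cell. -/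

import Mathlib

open scoped Pointwise RealInnerProductSpace

/-- Euclidean `d`-space. The space `𝔼^{d+1} = 𝔼^d × ℝ` is written `Euc d × ℝ`; only its points and
graphs over `Euc d` are used, never the norm of the product. -/
abbrev Euc (d : ℕ) : Type := EuclideanSpace ℝ (Fin d)

/-- A `d`-dimensional convex polytope in `𝔼^d`. -/
def IsPolytope {d : ℕ} (P : Set (Euc d)) : Prop :=
  (∃ S : Set (Euc d), S.Finite ∧ P = convexHull ℝ S) ∧ (interior P).Nonempty

/-- `F` is a (nonempty) face of codimension `k` of the polytope `C ⊆ 𝔼^d`. -/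
def IsFaceOfCodim {d : ℕ} (k : ℕ) (C F : Set (Euc d)) : Prop :=
  IsExposed ℝ C F ∧ F.Nonempty ∧ Module.finrank ℝ (vectorSpan ℝ F) + k = d

/-- `T` is a normal (face-to-face) tiling of `𝔼^d` by parallel copies of the polytope `P`, one of
the cells being `P` itself; so `P` is a parallelohedron and `T` is its tiling.  The empty set is
exposed in Mathlib's sense, so `face_to_face` says: empty or a common face. -/
structure IsParallelohedralTiling {d : ℕ} (P : Set (Euc d)) (T : Set (Set (Euc d))) : Prop where
  polytope : IsPolytope P
  self_mem : P ∈ T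
  translate : ∀ C ∈ T, ∃ t : Euc d, C = t +ᵥ P
  cover : ∀ x : Euc d, ∃ C ∈ T, x ∈ C
  disjoint : ∀ C ∈ T, ∀ C' ∈ T, C ≠ C' → Disjoint (interior C) (interior C')
  face_to_face : ∀ C ∈ T, ∀ C' ∈ T, IsExposed ℝ C (C ∩ C') ∧ IsExposed ℝ C' (C ∩ C')

/-- The faces of codimension `k` of the cells of `T`. -/
def tilingFaces {d : ℕ} (k : ℕ) (T : Set (Set (Euc d))) : Set (Set (Euc d)) :=
  {F | ∃ C ∈ T, IsFaceOfCodim k C F}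

/-- Two cells are adjacent if they meet in a common facet. -/
def AdjacentCells {d : ℕ} (C C' : Set (Euc d)) : Prop :=
  IsFaceOfCodim 1 C (C ∩ C') ∧ IsFaceOfCodim 1 C' (C ∩ C')

/-- `n` is the unit normal to the common facet `C ∩ C'` directed from `C` to `C'`. -/
def IsNormalFromTo {d : ℕ} (C C' : Set (Euc d)) (n : Euc d) : Prop :=
  ‖n‖ = 1 ∧ n ∈ (vectorSpan ℝ (C ∩ C'))ᗮ ∧ ∀ x ∈ C, ∀ y ∈ C', ⟪n, x⟫ ≤ ⟪n, y⟫

/-! ### Canonical scalings -/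

/-- `J` acts on the (two-dimensional) subspace `W` as a rotation by a right angle.  The two
possible rotations are the two directions of going round. -/
structure IsQuarterTurn {d : ℕ} (W : Submodule ℝ (Euc d)) (J : Euc d →ₗ[ℝ] Euc d) : Prop where
  map_mem : ∀ x ∈ W, J x ∈ W
  norm_map : ∀ x ∈ W, ‖J x‖ = ‖x‖
  inner_map : ∀ x ∈ W, ⟪J x, x⟫ = 0

/-- `e` is the unit vector orthogonal to the ridge `G` that points from `G` into the facet `F`:
the projection of `F` along `G` to the plane orthogonal to `G` lies on the ray spanned by `e`. -/
def IsInwardDirection {d : ℕ} (G F : Set (Euc d)) (e : Euc d) : Prop :=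
  ‖e‖ = 1 ∧ e ∈ (vectorSpan ℝ G)ᗮ ∧ e ∈ vectorSpan ℝ F ∧ ∀ g ∈ G, ∀ x ∈ F, 0 ≤ ⟪e, x - g⟫

/-- `Δ` is the torsion of the scaling `s` round the `(d-2)`-face `G` of `T`: the sum of
`s F • n F` over all facets `F ⊇ G` of `T`, where `n F = J e` is the unit normal to `F` pointing in
the direction of going round `G` given by the quarter turn `J` of the plane orthogonal to `G`. -/
def HasTorsion {d : ℕ} (T : Set (Set (Euc d))) (s : Set (Euc d) → ℝ) (G : Set (Euc d))
    (J : Euc d →ₗ[ℝ] Euc d) (Δ : Euc d) : Prop :=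
  ∃ (S : Finset (Set (Euc d))) (n : Set (Euc d) → Euc d),
    (∀ F, F ∈ S ↔ F ∈ tilingFaces 1 T ∧ G ⊆ F) ∧
    (∀ F ∈ S, ∃ e, IsInwardDirection G F e ∧ n F = J e) ∧
    Δ = ∑ F ∈ S, s F • n F

/-- `s` is a canonical scaling of the facets of `T`: it is positive and has zero torsion round
every `(d-2)`-face.  (Values of `s` on sets which are not facets play no role.) -/
def IsCanonicalScaling {d : ℕ} (T : Set (Set (Euc d))) (s : Set (Euc d) → ℝ) : Prop :=
  (∀ F ∈ tilingFaces 1 T, 0 < s F) ∧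
  ∀ G ∈ tilingFaces 2 T, ∀ J : Euc d →ₗ[ℝ] Euc d, IsQuarterTurn (vectorSpan ℝ G)ᗮ J →
    HasTorsion T s G J 0

/-- `s` is preserved by all translations that preserve the tiling `T`. -/
def IsTranslationInvariant {d : ℕ} (T : Set (Set (Euc d))) (s : Set (Euc d) → ℝ) : Prop :=
  ∀ v : Euc d, (∀ C, v +ᵥ C ∈ T ↔ C ∈ T) → ∀ F ∈ tilingFaces 1 T, s (v +ᵥ F) = s F

/-! ### The generatrix -/

/-- The lift of a cell `C` to the hyperplane `h = ⟪g, x⟫ + a` of `𝔼^{d+1}`, whose normal with last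
coordinate `-1` is `(g, -1)`. -/
def liftedCell {d : ℕ} (C : Set (Euc d)) (g : Euc d) (a : ℝ) : Set (Euc d × ℝ) :=
  {z | z.1 ∈ C ∧ z.2 = ⟪g, z.1⟫ + a}

/-- `IsChainLift T s P₀ C g a`: the lift of `C` with normal `(g, -1)` and height `a` is
`L[P₀, …, C]` for some chain of successively adjacent cells.  `P₀` is lifted by the identity, with
normal `(0, -1)`; each next cell `C'` is lifted up to the lift of the preceding cell `C` (the two
lifts meet exactly in a lift of `C ∩ C'`) with normal increment `s (C ∩ C') • n`, where `n` is the
unit normal from `C` to `C'`. -/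
inductive IsChainLift {d : ℕ} (T : Set (Set (Euc d))) (s : Set (Euc d) → ℝ) (P₀ : Set (Euc d)) :
    Set (Euc d) → Euc d → ℝ → Prop
  | start : IsChainLift T s P₀ P₀ 0 0
  | step (C C' : Set (Euc d)) (g n : Euc d) (a a' : ℝ) :
      IsChainLift T s P₀ C g a → C' ∈ T → AdjacentCells C C' → IsNormalFromTo C C' n →
      Prod.fst '' (liftedCell C g a ∩ liftedCell C' (g + s (C ∩ C') • n) a') = C ∩ C' →
      IsChainLift T s P₀ C' (g + s (C ∩ C') • n) a'

/-- The polyhedral surface `𝒢(T, s)`: the union of all chain lifts. -/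
def generatrixSurface {d : ℕ} (T : Set (Set (Euc d))) (s : Set (Euc d) → ℝ) (P₀ : Set (Euc d)) :
    Set (Euc d × ℝ) :=
  {z | ∃ C g a, IsChainLift T s P₀ C g a ∧ z ∈ liftedCell C g a}

/-- `S ⊆ 𝔼^{d+1}` is a generatrix of the tiling `T`: it projects bijectively to `𝔼^d`, and its
facets project to the cells of `T`. -/
def IsGeneratrix {d : ℕ} (T : Set (Set (Euc d))) (S : Set (Euc d × ℝ)) : Prop :=
  ∃ f : Euc d → ℝ, Continuous f ∧ S = {z | z.2 = f z.1} ∧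
    (∀ C ∈ T, ∃ l : Euc d →ᵃ[ℝ] ℝ, Set.EqOn f l C) ∧
    ∀ C ∈ T, ∀ C' ∈ T, C ≠ C' → ¬ ∃ l : Euc d →ᵃ[ℝ] ℝ, Set.EqOn f l (C ∪ C')

/-! ### Centres, the quadratic form, Voronoi tilings -/

/-- `p` is a centre of symmetry of `C`. -/
def IsCentre {d : ℕ} (p : Euc d) (C : Set (Euc d)) : Prop :=
  ∀ x ∈ C, (2 : ℝ) • p - x ∈ C

/-- The linear operator of a matrix, and the quadratic form `Q(x) = ½ xᵀ Q x`. -/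
noncomputable def matAct {d : ℕ} (Q : Matrix (Fin d) (Fin d) ℝ) (x : Euc d) : Euc d :=
  WithLp.toLp 2 (Q.mulVec x.ofLp)

noncomputable def halfForm {d : ℕ} (Q : Matrix (Fin d) (Fin d) ℝ) (x : Euc d) : ℝ :=
  (1 / 2) * ⟪x, matAct Q x⟫

/-- `Q` is a symmetric nondegenerate matrix which takes every facet vector `p` of `P`
(the vector with `p + P` adjacent to `P`) to `m = s (P ∩ (p + P)) n`, where `n` is the unit normal
directed from `P` to `p + P`. -/
def IsFormMatrix {d : ℕ} (P : Set (Euc d)) (T : Set (Set (Euc d))) (s : Set (Euc d) → ℝ)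
    (Q : Matrix (Fin d) (Fin d) ℝ) : Prop :=
  Q.IsSymm ∧ IsUnit Q.det ∧
  ∀ p n : Euc d, p +ᵥ P ∈ T → AdjacentCells P (p +ᵥ P) → IsNormalFromTo P (p +ᵥ P) n →
    matAct Q p = s (P ∩ (p +ᵥ P)) • n

/-- The Dirichlet (Voronoi) cell of `p` with respect to `L`. -/
def dirichletCell {d : ℕ} (L : Set (Euc d)) (p : Euc d) : Set (Euc d) :=
  {x | ∀ q ∈ L, ‖x - p‖ ≤ ‖x - q‖}

/-- The set of the centres of the cells of `T`. -/
def cellCentres {d : ℕ} (T : Set (Set (Euc d))) : Set (Euc d) :=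
  {p | ∃ C ∈ T, IsCentre p C}

/-- The centres of the cells form a `d`-dimensional lattice, and each cell has a centre and is the
Dirichlet cell of its centre. -/
def IsVoronoiTiling {d : ℕ} (T : Set (Set (Euc d))) : Prop :=
  (∃ b : Module.Basis (Fin d) ℝ (Euc d),
    cellCentres T = (Submodule.span ℤ (Set.range b) : Set (Euc d))) ∧
  ∀ C ∈ T, (∃ p, IsCentre p C) ∧ ∀ p, IsCentre p C → C = dirichletCell (cellCentres T) p

/-- The surface `S` over the tiling `T` is circumscribed about the standard paraboloid
`y^{d+1} = ∑ (y^i)²`: it lies below the paraboloid, meets it exactly over the centres of the cells,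
and the facet over each cell lies in the tangent hyperplane to the paraboloid at the point above
the centre of the cell. -/
def CircumscribesStdParaboloid {d : ℕ} (T : Set (Set (Euc d))) (S : Set (Euc d × ℝ)) : Prop :=
  (∀ z ∈ S, z.2 ≤ ∑ i, (z.1 i) ^ 2) ∧
  (∀ z ∈ S, z.2 = ∑ i, (z.1 i) ^ 2 ↔ z.1 ∈ cellCentres T) ∧
  ∀ C ∈ T, ∀ p, IsCentre p C → ∀ y ∈ C, (y, ∑ i, (p i) ^ 2 + ∑ i, 2 * p i * (y i - p i)) ∈ S

/-- The images of a tiling and of a surface in `𝔼^{d+1}` under `x ↦ A (x - c)`, respectively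
`(x, h) ↦ (A (x - c), h)`: the maps `A_d` and `A_{d+1}` in coordinates with the origin at `c`. -/
def imageTiling {d : ℕ} (A : Euc d ≃ₗ[ℝ] Euc d) (c : Euc d) (T : Set (Set (Euc d))) :
    Set (Set (Euc d)) :=
  (fun C => (fun x => A (x - c)) '' C) '' T

def imageSurface {d : ℕ} (A : Euc d ≃ₗ[ℝ] Euc d) (c : Euc d) (S : Set (Euc d × ℝ)) :
    Set (Euc d × ℝ) :=
  (fun z => (A (z.1 - c), z.2)) '' S

/-! Along a chain of cells the affine functions whose graphs are the lifts `L[P₀, …, Pᵢ]` change at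
a facet `F` by `s F` times the normal of `F`. The scaling condition at a `(d-2)`-face says that
these jumps add up to zero around it, so a lift of the cells with the right jumps exists near every
point that lies on no face of codimension three. The faces of codimension at least three are too
small for a chain to wind around them, hence the local lifts combine to a lift of all cells. The
positive jumps make the lifted surface convex: its function is the maximum of the functions of all
cells, and a cell is the set where its own function attains the maximum.

A translation of the tiling preserves the jumps, so the gradient of the lift of `v + P` is additive
in the lattice vector `v`, that is `L v` for a linear map `L`. The heights reached at `p + q + P`
through `p + P` and through `q + P` agree, which makes `L` symmetric and the function of `v + P`
equal to `⟪L v, x - c⟫ - ⟪L v, v⟫ / 2` for a point `c`. The description of `P` by the inequalities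
between the functions of the cells is then symmetric about `c`, and `c ∈ P` gives `0 ≤ ⟪L v, v⟫`.
If finally `‖A x‖² = ⟪L x, x⟫ / 2`, the identity `⟪L v, x⟫ - ⟪L v, v⟫ / 2 = ‖A x‖² - ‖A x - A v‖²`
turns maximality of the function of a cell into minimality of the distance to its centre, and shows
that this function is tangent to the paraboloid over the centre. -/

section
open Topology Filter Set

/-! ### Primitives of local cocycles -/

section Monodromy
variable {X A : Type*} [TopologicalSpace X] [AddCommGroup A] {c : X → X → A}

/-- A two-point function which is additive near each point: the data of the increments
`h q - h p` of an unknown function `h` that is determined locally up to a constant. -/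
def IsLocalCocycle (c : X → X → A) : Prop :=
  ∀ p, ∀ᶠ q in 𝓝 p, ∀ᶠ r in 𝓝 q, c p r = c p q + c q r

namespace IsLocalCocycle

theorem self_eq_zero (hc : IsLocalCocycle c) (p : X) : c p p = 0 := by
  simpa using (hc p).self_of_nhds.self_of_nhds

/-- The covering space of `X` whose sheets over a small neighbourhood of `p` are the local
primitives `a + c p ·` with `a : A`; a section of it is a primitive of `c`. -/
@[reducible]
def primitiveBundle [TopologicalSpace A] [DiscreteTopology A] (hc : IsLocalCocycle c) :
    FiberBundleCore X X A where
  baseSet p := interior {q | ∀ᶠ r in 𝓝 q, c p r = c p q + c q r}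
  isOpen_baseSet _ := isOpen_interior
  indexAt := id
  mem_baseSet_at p := mem_interior_iff_mem_nhds.2 (hc p)
  coordChange i j x v := v + c i x - c j x
  coordChange_self i x _ v := add_sub_cancel_right v _
  coordChange_comp i j k x _ v := by abel
  continuousOn_coordChange i j := by
    rintro ⟨q, v⟩ ⟨hq, -⟩
    obtain ⟨hi, hj⟩ := inter_subset_inter interior_subset interior_subset hq
    refine ContinuousAt.continuousWithinAt (continuousAt_const (y := v + c i q - c j q)
      |>.congr ?_)
    rw [nhds_prod_eq, nhds_discrete A]
    filter_upwards [(hi.and hj).prod_mk (eventually_pure.2 (rfl : v = v))]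
      with ⟨r, w⟩ ⟨⟨hir, hjr⟩, hw⟩
    dsimp only at hir hjr hw ⊢
    rw [hir, hjr, hw]
    abel

theorem exists_primitive [SimplyConnectedSpace X] [LocallyPathConnectedSpace X]
    (hc : IsLocalCocycle c) : ∃ h : X → A, ∀ p, ∀ᶠ q in 𝓝 p, h q = h p + c p q := by
  let _ : TopologicalSpace A := ⊥
  have : DiscreteTopology A := ⟨rfl⟩
  let Z := hc.primitiveBundle
  obtain ⟨p₀⟩ : Nonempty X := inferInstance
  obtain ⟨F, ⟨-, hF⟩, -⟩ :=
    (FiberBundle.isCoveringMap (F := A) (E := Z.Fiber)).existsUnique_continuousMap_lifts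
      (ContinuousMap.id X) p₀ ⟨p₀, (0 : A)⟩ rfl
  have hF : ∀ q, (F q).1 = q := congrFun hF
  let h : X → A := fun q => (F q).2
  have hloc : ∀ p q, (Z.localTrivAt p (F q)).2 = h q - c p q := by
    intro p q
    change h q + c (F q).1 (F q).1 - c p (F q).1 = _
    rw [hF, hc.self_eq_zero, add_zero]
  refine ⟨h, fun p => ?_⟩
  have hcont : Tendsto (fun q => (Z.localTrivAt p (F q)).2) (𝓝 p) (𝓝 (Z.localTrivAt p (F p)).2) :=
    continuous_snd.continuousAt.comp (((Z.localTrivAt p).continuousAt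
      ((Z.mem_localTrivAt_source _ _).2 (by rw [hF]; exact Z.mem_localTrivAt_baseSet p))).comp
      F.continuous.continuousAt)
  rw [nhds_discrete A, tendsto_pure] at hcont
  filter_upwards [hcont] with q hq
  rwa [hloc, hloc, hc.self_eq_zero, sub_zero, sub_eq_iff_eq_add] at hq

end IsLocalCocycle
end Monodromy

/-! ### Points in general position -/

section GeneralPosition
variable {E : Type*} [NormedAddCommGroup E] [NormedSpace ℝ E]

theorem exists_pos_add_smul {p : E → Prop} {x : E} (h : ∀ᶠ y in 𝓝 x, p y) (v : E) :
    ∃ ε : ℝ, 0 < ε ∧ p (x + ε • v) := by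
  have hlim : Tendsto (fun ε : ℝ => x + ε • v) (𝓝[>] 0) (𝓝 x) := by
    have hcont : Continuous fun ε : ℝ => x + ε • v := by fun_prop
    simpa using (hcont.tendsto 0).mono_left nhdsWithin_le_nhds
  obtain ⟨ε, hp, hε⟩ := ((hlim.eventually h).and self_mem_nhdsWithin).exists
  exact ⟨ε, hε, hp⟩

theorem eq_zero_of_lineMap_mem {x y : E} {S : Set E} (hy : y ∉ affineSpan ℝ (insert x S)) {t : ℝ}
    (ht : AffineMap.lineMap x y t ∈ S) : t = 0 := by
  by_contra h0
  apply hy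
  have h1 := AffineMap.lineMap_mem t⁻¹ (mem_affineSpan ℝ (mem_insert x S))
    (mem_affineSpan ℝ (mem_insert_of_mem x ht))
  rwa [AffineMap.lineMap_apply_module', AffineMap.lineMap_apply_module', add_sub_cancel_right,
    smul_smul, inv_mul_cancel₀ h0, one_smul, sub_add_cancel] at h1

theorem subsingleton_setOf_lineMap_mem {p q : E} {A : AffineSubspace ℝ E} (h : p ∉ A ∨ q ∉ A) :
    {t : ℝ | AffineMap.lineMap p q t ∈ A}.Subsingleton := by
  intro t ht t' ht'
  by_contra hne
  have hall (r : ℝ) : AffineMap.lineMap p q r ∈ A := by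
    have h1 := AffineMap.lineMap_mem ((r - t) / (t' - t)) ht ht'
    rwa [← AffineMap.apply_lineMap, AffineMap.lineMap_apply (k := ℝ) t, smul_eq_mul,
      vsub_eq_sub, vadd_eq_add, div_mul_cancel₀ _ (sub_ne_zero.2 (Ne.symm hne)),
      sub_add_cancel] at h1
  exact h.elim (fun hp => hp (by simpa using hall 0)) fun hq => hq (by simpa using hall 1)

theorem exists_mem_forall_notMem_affineSubspace {K : Set E} (hK : Convex ℝ K) (hne : K.Nonempty)
    {𝒜 : Set (AffineSubspace ℝ E)} (hfin : 𝒜.Finite) (h𝒜 : ∀ A ∈ 𝒜, ¬K ⊆ A) :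
    ∃ x ∈ K, ∀ A ∈ 𝒜, x ∉ A := by
  induction 𝒜, hfin using Set.Finite.induction_on with
  | empty => exact ⟨hne.some, hne.some_mem, by simp⟩
  | @insert B ℬ _ hℬ ih =>
    obtain ⟨p, hpK, hp⟩ := ih fun A hA => h𝒜 A (mem_insert_of_mem _ hA)
    obtain ⟨q, hqK, hq⟩ := not_subset.1 (h𝒜 B (mem_insert _ _))
    have hbad : (⋃ A ∈ insert B ℬ, {t : ℝ | AffineMap.lineMap p q t ∈ A}).Finite := by
      refine (hℬ.insert B).biUnion fun A hA => (subsingleton_setOf_lineMap_mem ?_).finite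
      rcases hA with rfl | hA
      · exact Or.inr hq
      · exact Or.inl (hp A hA)
    obtain ⟨t, ht, ht'⟩ := ((Icc_infinite (zero_lt_one (α := ℝ))).sdiff hbad).nonempty
    exact ⟨_, hK.lineMap_mem hpK hqK ht, fun A hA hmem => ht' (mem_biUnion hA hmem)⟩

variable [FiniteDimensional ℝ E]

theorem exists_mem_forall_notMem_affineSpan {V : Set E} (hV : IsOpen V) (hne : V.Nonempty)
    {𝒮 : Set (Set E)} (h𝒮 : 𝒮.Countable)
    (hdim : ∀ S ∈ 𝒮, Module.finrank ℝ (vectorSpan ℝ S) < Module.finrank ℝ E) :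
    ∃ x ∈ V, ∀ S ∈ 𝒮, x ∉ affineSpan ℝ S := by
  borelize E
  by_contra! hcover
  have hnull : MeasureTheory.Measure.addHaar (⋃ S ∈ 𝒮, (affineSpan ℝ S : Set E)) = 0 := by
    refine (MeasureTheory.measure_biUnion_null_iff h𝒮).2 fun S hS =>
      MeasureTheory.Measure.addHaar_affineSubspace _ _ fun htop => (hdim S hS).ne ?_
    rw [← direction_affineSpan, htop, AffineSubspace.direction_top, finrank_top]
  refine (hV.measure_pos MeasureTheory.Measure.addHaar hne).ne'
    (MeasureTheory.measure_mono_null (fun x hx => ?_) hnull)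
  obtain ⟨S, hS, hxS⟩ := hcover x hx
  exact mem_biUnion hS hxS

theorem exists_mem_forall_notMem_affineSpan_insert {V : Set E} (hV : IsOpen V) (hne : V.Nonempty)
    {𝒮 : Set (Set E)} (h𝒮 : 𝒮.Countable)
    (hdim : ∀ S ∈ 𝒮, Module.finrank ℝ (vectorSpan ℝ S) + 1 < Module.finrank ℝ E) (x : E) :
    ∃ y ∈ V, ∀ S ∈ 𝒮, y ∉ affineSpan ℝ (insert x S) := by
  obtain ⟨y, hy, hyS⟩ := exists_mem_forall_notMem_affineSpan hV hne (h𝒮.image (insert x))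
    (forall_mem_image.2 fun S hS => (finrank_vectorSpan_insert_le_set ℝ S x).trans_lt (hdim S hS))
  exact ⟨y, hy, fun S hS => hyS _ (mem_image_of_mem _ hS)⟩

end GeneralPosition

/-! ### Exposed faces of convex bodies -/

section ExposedFaces
variable {E : Type*} [NormedAddCommGroup E] [NormedSpace ℝ E] {C F : Set E}

theorem mem_openSegment_add_smul_sub (x y : E) {ε : ℝ} (hε : 0 < ε) :
    x ∈ openSegment ℝ y (x + ε • (x - y)) := by
  refine ⟨ε / (1 + ε), 1 / (1 + ε), by positivity, by positivity, by field_simp; ring, ?_⟩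
  match_scalars <;> field_simp
  ring

theorem exists_mem_segment_notMem_interior (hC : IsClosed C) {x y : E} (hx : x ∉ C)
    (hy : y ∈ interior C) : ∃ z ∈ segment ℝ x y, z ∈ C ∧ z ∉ interior C := by
  by_contra! h
  obtain ⟨w, -, hw, hwC⟩ := (convex_segment x y).isPreconnected _ _ isOpen_interior hC.isOpen_compl
    (fun z hz => (em (z ∈ C)).imp (h z hz) id) ⟨y, right_mem_segment ℝ x y, hy⟩
    ⟨x, left_mem_segment ℝ x y, hx⟩
  exact hwC (interior_subset hw)

theorem disjoint_interior_of_isExposed (hF : IsExposed ℝ C F) (hne : F ≠ C) :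
    Disjoint F (interior C) := by
  rw [Set.disjoint_left]
  intro x hx hxi
  refine hne (hF.subset.antisymm fun y hy => ?_)
  obtain ⟨ε, hε, hmem⟩ := exists_pos_add_smul (mem_interior_iff_mem_nhds.1 hxi) (x - y)
  exact hF.isExtreme.left_mem_of_mem_openSegment hy hmem hx (mem_openSegment_add_smul_sub x y hε)

theorem exists_isExposed_of_notMem_interior (hC : Convex ℝ C) (hi : (interior C).Nonempty) {x : E}
    (hx : x ∈ C) (hxi : x ∉ interior C) :
    ∃ F, IsExposed ℝ C F ∧ x ∈ F ∧ Disjoint F (interior C) := by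
  obtain ⟨f, hf⟩ := geometric_hahn_banach_open_point hC.interior isOpen_interior hxi
  have hle : ∀ y ∈ C, f y ≤ f x := by
    intro y hy
    have hyc : y ∈ closure (interior C) := by
      rw [hC.closure_interior_eq_closure_of_nonempty_interior hi]
      exact subset_closure hy
    exact closure_minimal (fun a ha => (hf a ha).le)
      (isClosed_le f.continuous continuous_const) hyc
  refine ⟨{y ∈ C | ∀ z ∈ C, f z ≤ f y}, fun _ => ⟨f, rfl⟩, ⟨hx, hle⟩, Set.disjoint_left.2 ?_⟩
  rintro y ⟨-, hy⟩ hyi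
  exact (hf y hyi).not_ge (hy x hx)

theorem affineSpan_eq_top_of_interior_nonempty (hi : (interior C).Nonempty) :
    affineSpan ℝ C = ⊤ :=
  top_le_iff.1 (isOpen_interior.affineSpan_eq_top hi ▸ affineSpan_mono ℝ interior_subset)

theorem finrank_vectorSpan_of_interior_nonempty (hi : (interior C).Nonempty) :
    Module.finrank ℝ (vectorSpan ℝ C) = Module.finrank ℝ E := by
  rw [← direction_affineSpan, affineSpan_eq_top_of_interior_nonempty hi,
    AffineSubspace.direction_top, finrank_top]

theorem finrank_vectorSpan_lt_of_disjoint_interior [FiniteDimensional ℝ E] (hF : Convex ℝ F)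
    (hne : F.Nonempty) (hFC : F ⊆ C) (hd : Disjoint F (interior C)) :
    Module.finrank ℝ (vectorSpan ℝ F) < Module.finrank ℝ E := by
  refine Submodule.finrank_lt fun htop => ?_
  have hspan := (AffineSubspace.affineSpan_eq_top_iff_vectorSpan_eq_top_of_nonempty ℝ _ _ hne).2
    htop
  obtain ⟨x, hx⟩ := hF.interior_nonempty_iff_affineSpan_eq_top.2 hspan
  exact Set.disjoint_left.1 hd (interior_subset hx) (interior_mono hFC hx)

end ExposedFaces

section Orthogonal
variable {E : Type*} [NormedAddCommGroup E] [InnerProductSpace ℝ E]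

theorem mem_orthogonal_vectorSpan {F : Set E} {n : E} :
    n ∈ (vectorSpan ℝ F)ᗮ ↔ ∀ x ∈ F, ∀ y ∈ F, ⟪n, x⟫ = ⟪n, y⟫ := by
  have hker : n ∈ (vectorSpan ℝ F)ᗮ ↔ vectorSpan ℝ F ≤ LinearMap.ker (innerₛₗ ℝ n) :=
    Submodule.mem_orthogonal' _ _
  rw [hker, vectorSpan_def, Submodule.span_le]
  constructor
  · intro h x hx y hy
    simpa [inner_sub_right, sub_eq_zero] using h ⟨x, hx, y, hy, rfl⟩
  · rintro h _ ⟨x, hx, y, hy, rfl⟩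
    simpa [inner_sub_right, sub_eq_zero] using h x hx y hy

theorem inner_lt_of_mem_interior {C : Set E} {n y : E} {b : ℝ} (hn : n ≠ 0)
    (h : ∀ z ∈ C, ⟪n, z⟫ ≤ b) (hy : y ∈ interior C) : ⟪n, y⟫ < b := by
  obtain ⟨ε, hε, hmem⟩ := exists_pos_add_smul (mem_interior_iff_mem_nhds.1 hy) n
  have hle := h _ hmem
  rw [inner_add_right, inner_smul_right, real_inner_self_eq_norm_sq] at hle
  have : 0 < ε * ‖n‖ ^ 2 := by positivity
  linarith

theorem eq_or_eq_neg_of_mem_orthogonal [FiniteDimensional ℝ E] {V : Submodule ℝ E} {n n' : E}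
    (hV : Module.finrank ℝ V + 1 = Module.finrank ℝ E) (hn : ‖n‖ = 1) (hn' : ‖n'‖ = 1)
    (h : n ∈ Vᗮ) (h' : n' ∈ Vᗮ) : n' = n ∨ n' = -n := by
  have hline : Module.finrank ℝ Vᗮ = 1 := by
    have := Submodule.finrank_add_finrank_orthogonal V
    omega
  have hne : (⟨n, h⟩ : Vᗮ) ≠ 0 := fun h0 => by
    obtain rfl : n = 0 := congrArg Subtype.val h0
    exact zero_ne_one (norm_zero.symm.trans hn)
  obtain ⟨c, hc⟩ := (finrank_eq_one_iff_of_nonzero' _ hne).1 hline ⟨n', h'⟩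
  obtain rfl : c • n = n' := congrArg Subtype.val hc
  rw [norm_smul, hn, mul_one, Real.norm_eq_abs] at hn'
  rcases eq_or_eq_neg_of_abs_eq hn' with rfl | rfl
  · exact Or.inl (one_smul _ _)
  · exact Or.inr (neg_one_smul _ _)

end Orthogonal

/-! ### Polytopes and their facets -/

/-- `n` is the outward unit normal of the convex body `C` along its face `F`. -/
structure IsFacetNormal {d : ℕ} (C F : Set (Euc d)) (n : Euc d) : Prop where
  norm_eq : ‖n‖ = 1
  orth : n ∈ (vectorSpan ℝ F)ᗮ
  le : ∀ f ∈ F, ∀ y ∈ C, ⟪n, y⟫ ≤ ⟪n, f⟫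

section Polytope
variable {d : ℕ} {C F F' : Set (Euc d)} {n n' f x y : Euc d}

namespace IsFacetNormal

theorem ne_zero (h : IsFacetNormal C F n) : n ≠ 0 :=
  norm_ne_zero_iff.1 (h.norm_eq.trans_ne one_ne_zero)

theorem inner_eq (h : IsFacetNormal C F n) (hx : x ∈ F) (hy : y ∈ F) : ⟪n, x⟫ = ⟪n, y⟫ :=
  mem_orthogonal_vectorSpan.1 h.orth x hx y hy

theorem lt (h : IsFacetNormal C F n) (hf : f ∈ F) (hy : y ∈ interior C) : ⟪n, y⟫ < ⟪n, f⟫ :=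
  inner_lt_of_mem_interior h.ne_zero (h.le f hf) hy

theorem eq (hi : (interior C).Nonempty) (hF : IsFaceOfCodim 1 C F) (h : IsFacetNormal C F n)
    (h' : IsFacetNormal C F n') : n' = n := by
  rcases eq_or_eq_neg_of_mem_orthogonal (hF.2.2.trans finrank_euclideanSpace_fin.symm) h.norm_eq
    h'.norm_eq h.orth h'.orth with heq | hneg
  · exact heq
  · obtain ⟨y, hy⟩ := hi
    obtain ⟨f, hf⟩ := hF.2.1
    have hlt := h'.lt hf hy
    rw [hneg, inner_neg_left, inner_neg_left] at hlt
    linarith [h.lt hf hy]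

end IsFacetNormal

namespace IsFaceOfCodim

theorem exists_isFacetNormal_forall_mem (hi : (interior C).Nonempty) (hF : IsFaceOfCodim 1 C F) :
    ∃ n, IsFacetNormal C F n ∧ ∀ f ∈ F, ∀ y ∈ C, ⟪n, y⟫ = ⟪n, f⟫ → y ∈ F := by
  obtain ⟨hexp, hne, hdim⟩ := hF
  obtain ⟨l, hl⟩ := hexp hne
  obtain ⟨v, rfl⟩ := (InnerProductSpace.toDual ℝ (Euc d)).surjective l
  simp only [InnerProductSpace.toDual_apply_apply] at hl
  have hv : v ≠ 0 := by
    rintro rfl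
    obtain rfl : F = C := by simpa using hl
    rw [finrank_vectorSpan_of_interior_nonempty hi, finrank_euclideanSpace_fin] at hdim
    omega
  have hv' : 0 < ‖v‖⁻¹ := inv_pos.2 (norm_pos_iff.2 hv)
  have hle : ∀ f ∈ F, ∀ y ∈ C, ⟪v, y⟫ ≤ ⟪v, f⟫ := fun f hf => by
    rw [hl] at hf
    exact hf.2
  refine ⟨‖v‖⁻¹ • v, ⟨norm_smul_inv_norm hv, ?_, fun f hf y hy => ?_⟩, fun f hf y hy h => ?_⟩
  · exact Submodule.smul_mem _ _ (mem_orthogonal_vectorSpan.2 fun x hx y hy =>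
      le_antisymm (hle y hy x (hexp.subset hx)) (hle x hx y (hexp.subset hy)))
  · rw [real_inner_smul_left, real_inner_smul_left]
    exact mul_le_mul_of_nonneg_left (hle f hf y hy) hv'.le
  · rw [real_inner_smul_left, real_inner_smul_left, mul_right_inj' hv'.ne'] at h
    rw [hl]
    exact ⟨hy, fun z hz => h ▸ hle f hf z hz⟩

theorem exists_isFacetNormal (hi : (interior C).Nonempty) (hF : IsFaceOfCodim 1 C F) :
    ∃ n, IsFacetNormal C F n :=
  (hF.exists_isFacetNormal_forall_mem hi).imp fun _ => And.left

end IsFaceOfCodim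

theorem IsFacetNormal.mem_iff (hi : (interior C).Nonempty) (hF : IsFaceOfCodim 1 C F)
    (h : IsFacetNormal C F n) (hf : f ∈ F) (hy : y ∈ C) : y ∈ F ↔ ⟪n, y⟫ = ⟪n, f⟫ := by
  obtain ⟨n', hn', hmem⟩ := hF.exists_isFacetNormal_forall_mem hi
  obtain rfl := h.eq hi hF hn'
  exact ⟨fun hyF => h.inner_eq hyF hf, hmem f hf y hy⟩

theorem IsFaceOfCodim.eq_of_subset (hi : (interior C).Nonempty) (hF : IsFaceOfCodim 1 C F)
    (hF' : IsFaceOfCodim 1 C F') (h : F ⊆ F') : F = F' := by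
  obtain ⟨n, hn⟩ := hF'.exists_isFacetNormal hi
  obtain ⟨f, hf⟩ := hF.2.1
  have hnF : IsFacetNormal C F n := ⟨hn.norm_eq, mem_orthogonal_vectorSpan.2 fun x hx y hy =>
    hn.inner_eq (h hx) (h hy), fun f hf => hn.le f (h hf)⟩
  exact h.antisymm fun y hy =>
    (hnF.mem_iff hi hF hf (hF'.1.subset hy)).2 (hn.inner_eq hy (h hf))

namespace IsPolytope

theorem isCompact (h : IsPolytope C) : IsCompact C := by
  obtain ⟨⟨S, hS, rfl⟩, -⟩ := h
  exact hS.isCompact_convexHull ℝ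

theorem convex (h : IsPolytope C) : Convex ℝ C := by
  obtain ⟨⟨S, -, rfl⟩, -⟩ := h
  exact convex_convexHull ℝ S

theorem isClosed (h : IsPolytope C) : IsClosed C :=
  h.isCompact.isClosed

theorem closure_interior (h : IsPolytope C) : closure (interior C) = C := by
  rw [h.convex.closure_interior_eq_closure_of_nonempty_interior h.2, h.isClosed.closure_eq]

theorem vadd (h : IsPolytope C) (t : Euc d) : IsPolytope (t +ᵥ C) := by
  obtain ⟨⟨S, hS, rfl⟩, hi⟩ := h
  refine ⟨⟨t +ᵥ S, hS.vadd_set, (convexHull_vadd t S).symm⟩, ?_⟩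
  rw [interior_vadd]
  exact hi.vadd_set

theorem finite_isExposed (h : IsPolytope C) : {F | IsExposed ℝ C F}.Finite := by
  obtain ⟨⟨S, hS, hCS⟩, -⟩ := id h
  refine Set.Finite.of_finite_image (f := fun F => F.extremePoints ℝ)
    (hS.finite_subsets.subset ?_) fun F hF F' hF' heq => ?_
  · rintro _ ⟨F, hF, rfl⟩
    refine (hF.isExtreme.extremePoints_subset_extremePoints).trans ?_
    rw [hCS]
    exact extremePoints_convexHull_subset
  · rw [← closure_convexHull_extremePoints (IsExposed.isCompact hF h.isCompact)
        (IsExposed.convex hF h.convex),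
      ← closure_convexHull_extremePoints (IsExposed.isCompact hF' h.isCompact)
        (IsExposed.convex hF' h.convex)]
    exact congrArg (fun S => closure (convexHull ℝ S)) heq

theorem finite_facets (h : IsPolytope C) : {F | IsFaceOfCodim 1 C F}.Finite :=
  h.finite_isExposed.subset fun _ hF => hF.1

theorem exists_facet_of_notMem (hC : IsPolytope C) (hx : x ∉ C) :
    ∃ F n, IsFaceOfCodim 1 C F ∧ IsFacetNormal C F n ∧ ∀ f ∈ F, ⟪n, f⟫ < ⟪n, x⟫ := by
  -- The segment from `x` to a generic interior point enters `C` through no face of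
  -- codimension `2`.
  obtain ⟨o, ho, hgen⟩ := exists_mem_forall_notMem_affineSpan_insert isOpen_interior hC.2
    (𝒮 := {F | IsExposed ℝ C F ∧ Module.finrank ℝ (vectorSpan ℝ F) + 1 < d})
    (hC.finite_isExposed.subset fun F hF => hF.1).countable
    (fun F hF => hF.2.trans_eq finrank_euclideanSpace_fin.symm) x
  obtain ⟨z, hz, hzC, hzi⟩ := exists_mem_segment_notMem_interior hC.isClosed hx ho
  rw [segment_eq_image_lineMap] at hz
  obtain ⟨t, ⟨ht0, ht1⟩, rfl⟩ := hz
  have ht : t ≠ 0 := by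
    rintro rfl
    exact hx (by simpa using hzC)
  obtain ⟨F, hexp, hzF, hdisj⟩ := exists_isExposed_of_notMem_interior hC.convex hC.2 hzC hzi
  have hlt := finrank_vectorSpan_lt_of_disjoint_interior (hexp.convex hC.convex) ⟨_, hzF⟩
    hexp.subset hdisj
  rw [finrank_euclideanSpace_fin] at hlt
  have hcod : ¬Module.finrank ℝ (vectorSpan ℝ F) + 1 < d := fun hd =>
    ht (eq_zero_of_lineMap_mem (hgen F ⟨hexp, hd⟩) hzF)
  have hF : IsFaceOfCodim 1 C F := ⟨hexp, ⟨_, hzF⟩, by omega⟩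
  obtain ⟨n, hn⟩ := hF.exists_isFacetNormal hC.2
  refine ⟨F, n, hF, hn, fun f hf => ?_⟩
  have ho' := hn.lt hzF ho
  rw [hn.inner_eq hf hzF]
  rw [AffineMap.lineMap_apply_module, inner_add_right, inner_smul_right, inner_smul_right] at ho' ⊢
  nlinarith [lt_of_le_of_ne ht0 ht.symm]

theorem eventually_inner_le_of_notMem_facet (hC : IsPolytope C) (hF : IsFaceOfCodim 1 C F)
    (hx : x ∈ C) (hxF : x ∉ F) :
    ∀ᶠ y in 𝓝 x, ∀ n, IsFacetNormal C F n → ∀ f ∈ F, ⟪n, y⟫ ≤ ⟪n, f⟫ := by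
  obtain ⟨n, hn⟩ := hF.exists_isFacetNormal hC.2
  obtain ⟨f, hf⟩ := hF.2.1
  have hlt : ⟪n, x⟫ < ⟪n, f⟫ := (hn.le f hf x hx).lt_of_ne
    fun h => hxF ((hn.mem_iff hC.2 hF hf hx).2 h)
  have hcont : Continuous fun y : Euc d => ⟪n, y⟫ := by fun_prop
  filter_upwards [hcont.continuousAt.eventually (gt_mem_nhds hlt)] with y hy n' hn' f' hf'
  obtain rfl := hn.eq hC.2 hF hn'
  rw [hn.inner_eq hf' hf]
  exact hy.le

theorem eventually_mem_of_forall_facet (hC : IsPolytope C) (hx : x ∈ C) :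
    ∀ᶠ y in 𝓝 x, (∀ F n, IsFaceOfCodim 1 C F → IsFacetNormal C F n →
      x ∈ F → ⟪n, y⟫ ≤ ⟪n, x⟫) → y ∈ C := by
  have hoff : ∀ F ∈ {F | IsFaceOfCodim 1 C F}, ∀ᶠ y in 𝓝 x, x ∉ F →
      ∀ n, IsFacetNormal C F n → ∀ f ∈ F, ⟪n, y⟫ ≤ ⟪n, f⟫ := fun F hF =>
    eventually_imp_distrib_left.2 fun hxF => hC.eventually_inner_le_of_notMem_facet hF hx hxF
  filter_upwards [(eventually_all_finite hC.finite_facets).2 hoff] with y hy hle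
  by_contra hyC
  obtain ⟨F, n, hF, hn, hlt⟩ := hC.exists_facet_of_notMem hyC
  by_cases hxF : x ∈ F
  · exact (hlt x hxF).not_ge (hle F n hF hn hxF)
  · obtain ⟨f, hf⟩ := hF.2.1
    exact (hlt f hf).not_ge (hy F hF hxF n hn f hf)

theorem eventually_mem_of_inner_le (hC : IsPolytope C) (hx : x ∈ C)
    (hxF : ∀ F', IsFaceOfCodim 1 C F' → x ∈ F' → F' = F) (hF : IsFaceOfCodim 1 C F)
    (hn : IsFacetNormal C F n) : ∀ᶠ y in 𝓝 x, ⟪n, y⟫ ≤ ⟪n, x⟫ → y ∈ C := by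
  filter_upwards [hC.eventually_mem_of_forall_facet hx] with y hy hle
  refine hy fun F' n' hF' hn' hxF' => ?_
  obtain rfl := hxF F' hF' hxF'
  obtain rfl := hn.eq hC.2 hF hn'
  exact hle

theorem exists_facet_on_segment (hC : IsPolytope C) (hy : y ∈ C) (hx : x ∉ C) :
    ∃ z ∈ segment ℝ y x, ∃ F n, z ∈ F ∧ IsFaceOfCodim 1 C F ∧ IsFacetNormal C F n ∧
      ⟪n, z⟫ < ⟪n, x⟫ := by
  -- `z` is the last point of the segment which lies in `C`.
  have hK : IsCompact (Icc (0 : ℝ) 1 ∩ AffineMap.lineMap y x ⁻¹' C) :=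
    isCompact_Icc.inter_right (hC.isClosed.preimage AffineMap.lineMap_continuous)
  obtain ⟨t, ⟨⟨ht0, ht1⟩, htC⟩, hmax⟩ := hK.exists_isGreatest ⟨0, by simpa using hy⟩
  have ht1 : t < 1 := ht1.lt_of_ne (by rintro rfl; exact hx (by simpa using htC))
  refine ⟨AffineMap.lineMap y x t, ?_, ?_⟩
  · rw [segment_eq_image_lineMap]
    exact mem_image_of_mem _ ⟨ht0, ht1.le⟩
  by_contra! hle
  have hnear : ∀ᶠ r in 𝓝[>] t, AffineMap.lineMap y x r ∈ C := by
    have hcont : ContinuousAt (fun r : ℝ => AffineMap.lineMap y x r) t :=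
      AffineMap.lineMap_continuous.continuousAt
    filter_upwards [nhdsWithin_le_nhds (hcont.eventually (hC.eventually_mem_of_forall_facet htC)),
      self_mem_nhdsWithin] with r hr htr
    refine hr fun F n hF hn hzF => ?_
    have hxz := hle F n hzF hF hn
    have hyz := hn.le _ hzF y hy
    simp only [AffineMap.lineMap_apply_module, inner_add_right, inner_smul_right] at hxz hyz ⊢
    nlinarith [mem_Ioi.1 htr]
  obtain ⟨r, ⟨hrC, htr⟩, hr1⟩ :=
    ((hnear.and self_mem_nhdsWithin).and (nhdsWithin_le_nhds (gt_mem_nhds ht1))).exists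
  exact (mem_Ioi.1 htr).not_ge (hmax ⟨⟨ht0.trans (mem_Ioi.1 htr).le, hr1.le⟩, hrC⟩)

theorem exists_minimal_isExposed (hC : IsPolytope C) (hx : x ∈ C) :
    ∃ G, IsExposed ℝ C G ∧ x ∈ G ∧ ∀ E, IsExposed ℝ C E → x ∈ E → G ⊆ E := by
  have hfin : {E | IsExposed ℝ C E ∧ x ∈ E}.Finite :=
    hC.finite_isExposed.subset fun E hE => hE.1
  have hne : hfin.toFinset.Nonempty := ⟨C, hfin.mem_toFinset.2 ⟨IsExposed.refl C, hx⟩⟩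
  have hexp := IsExposed.sInter hne fun E hE => (hfin.mem_toFinset.1 hE).1
  rw [hfin.coe_toFinset] at hexp
  exact ⟨_, hexp, fun E hE => hE.2, fun E hE hxE => sInter_subset_of_mem ⟨hE, hxE⟩⟩

end IsPolytope
end Polytope

/-! ### Local structure of a tiling -/

/-- The faces of codimension at least `k` of the cells of `T`. -/
def codimFaces {d : ℕ} (T : Set (Set (Euc d))) (k : ℕ) : Set (Set (Euc d)) :=
  {E | ∃ C ∈ T, IsExposed ℝ C E ∧ Module.finrank ℝ (vectorSpan ℝ E) + k ≤ d}

/-- `x` is in general position with respect to the faces of codimension at least `k` of `T`: it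
lies on none of them. -/
def AvoidsCodim {d : ℕ} (T : Set (Set (Euc d))) (k : ℕ) (x : Euc d) : Prop :=
  ∀ E ∈ codimFaces T k, x ∉ E

/-- `C` and `C'` are adjacent cells of `T` whose common facet meets `B`. -/
def AdjacentIn {d : ℕ} (T : Set (Set (Euc d))) (B C C' : Set (Euc d)) : Prop :=
  C ∈ T ∧ C' ∈ T ∧ AdjacentCells C C' ∧ (C ∩ C' ∩ B).Nonempty

section Separation
variable {E : Type*} [NormedAddCommGroup E] [InnerProductSpace ℝ E] [CompleteSpace E]

theorem exists_norm_eq_one_forall_inner_le {C C' : Set E} (hC : Convex ℝ C) (hC' : Convex ℝ C')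
    (hi : (interior C).Nonempty) (hi' : (interior C').Nonempty)
    (hd : Disjoint (interior C) (interior C')) :
    ∃ n : E, ‖n‖ = 1 ∧ ∀ x ∈ C, ∀ y ∈ C', ⟪n, x⟫ ≤ ⟪n, y⟫ := by
  obtain ⟨l, u, hlt, hgt⟩ := geometric_hahn_banach_open_open hC.interior isOpen_interior
    hC'.interior isOpen_interior hd
  obtain ⟨v, rfl⟩ := (InnerProductSpace.toDual ℝ E).surjective l
  simp only [InnerProductSpace.toDual_apply_apply] at hlt hgt
  have hcont : Continuous fun y : E => ⟪v, y⟫ := by fun_prop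
  have hle : ∀ x ∈ C, ⟪v, x⟫ ≤ u := fun x hx => by
    refine closure_minimal (fun a ha => (hlt a ha).le) (isClosed_le hcont continuous_const) ?_
    rw [hC.closure_interior_eq_closure_of_nonempty_interior hi]
    exact subset_closure hx
  have hge : ∀ y ∈ C', u ≤ ⟪v, y⟫ := fun y hy => by
    refine closure_minimal (fun a ha => (hgt a ha).le) (isClosed_le continuous_const hcont) ?_
    rw [hC'.closure_interior_eq_closure_of_nonempty_interior hi']
    exact subset_closure hy
  have hv : v ≠ 0 := by
    rintro rfl
    obtain ⟨x, hx⟩ := hi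
    obtain ⟨y, hy⟩ := hi'
    simpa using (hlt x hx).trans (hgt y hy)
  refine ⟨‖v‖⁻¹ • v, norm_smul_inv_norm hv, fun x hx y hy => ?_⟩
  rw [real_inner_smul_left, real_inner_smul_left]
  exact mul_le_mul_of_nonneg_left ((hle x hx).trans (hge y hy)) (by positivity)

end Separation

section LocalStructure
variable {d : ℕ} {P : Set (Euc d)} {T : Set (Set (Euc d))} {C C' D F F' : Set (Euc d)}
  {n x y m : Euc d}

theorem AdjacentCells.symm (h : AdjacentCells C C') : AdjacentCells C' C := by
  rw [AdjacentCells, inter_comm]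
  exact ⟨h.2, h.1⟩

theorem AdjacentIn.symm {B : Set (Euc d)} (h : AdjacentIn T B C C') : AdjacentIn T B C' C :=
  ⟨h.2.1, h.1, h.2.2.1.symm, inter_comm C C' ▸ h.2.2.2⟩

theorem AvoidsCodim.lineMap {k : ℕ} (hx : AvoidsCodim T k x)
    (hy : ∀ E ∈ codimFaces T k, y ∉ affineSpan ℝ (insert x E)) (t : ℝ) :
    AvoidsCodim T k (AffineMap.lineMap x y t) := by
  intro E hE hmem
  obtain rfl := eq_zero_of_lineMap_mem (hy E hE) hmem
  exact hx E hE (by simpa using hmem)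

namespace IsParallelohedralTiling

theorem isPolytope (hT : IsParallelohedralTiling P T) (hC : C ∈ T) : IsPolytope C := by
  obtain ⟨t, rfl⟩ := hT.translate C hC
  exact hT.polytope.vadd t

theorem eq_of_mem_interior (hT : IsParallelohedralTiling P T) (hC : C ∈ T) (hC' : C' ∈ T)
    (hx : x ∈ interior C) (hx' : x ∈ C') : C = C' := by
  by_contra hne
  rw [← (hT.isPolytope hC').closure_interior] at hx'
  obtain ⟨y, hy, hy'⟩ := mem_closure_iff.1 hx' _ isOpen_interior hx
  exact Set.disjoint_left.1 (hT.disjoint C hC C' hC' hne) hy hy'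

theorem exists_closedBall_of_meeting (hT : IsParallelohedralTiling P T) {R : Set (Euc d)}
    (hR : Bornology.IsBounded R) :
    ∃ ρ, ∀ C ∈ T, (C ∩ R).Nonempty → C ⊆ Metric.closedBall 0 ρ := by
  obtain ⟨r, hr⟩ := hR.subset_closedBall 0
  refine ⟨Metric.diam P + r, fun C hC ⟨y, hyC, hyR⟩ z hz => ?_⟩
  have hdiam : Metric.diam C = Metric.diam P := by
    obtain ⟨t, rfl⟩ := hT.translate C hC
    exact (isometry_vadd (Euc d) t).diam_image P
  calc dist z 0 ≤ dist z y + dist y 0 := dist_triangle _ _ _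
    _ ≤ Metric.diam P + r := add_le_add
      (hdiam ▸ Metric.dist_le_diam_of_mem (hT.isPolytope hC).isCompact.isBounded hz hyC) (hr hyR)

theorem finite_meeting (hT : IsParallelohedralTiling P T) {R : Set (Euc d)}
    (hR : Bornology.IsBounded R) : {C | C ∈ T ∧ (C ∩ R).Nonempty}.Finite := by
  obtain ⟨ρ, hρ⟩ := hT.exists_closedBall_of_meeting hR
  have hvol : ∀ C ∈ T, MeasureTheory.volume (interior P) ≤ MeasureTheory.volume (interior C) := by
    intro C hC
    obtain ⟨t, rfl⟩ := hT.translate C hC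
    rw [interior_vadd]
    exact (MeasureTheory.measure_vadd _ _ _).ge
  have hbound (C : {C | C ∈ T ∧ (C ∩ R).Nonempty}) : interior C.1 ⊆ Metric.closedBall 0 ρ :=
    interior_subset.trans (hρ C.1 C.2.1 C.2.2)
  have hfin := MeasureTheory.Measure.finite_const_le_meas_of_disjoint_iUnion
    (MeasureTheory.volume : MeasureTheory.Measure (Euc d))
    (isOpen_interior.measure_pos MeasureTheory.volume hT.polytope.2)
    (As := fun C : {C | C ∈ T ∧ (C ∩ R).Nonempty} => interior C.1)
    (fun C => isOpen_interior.measurableSet)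
    (fun C C' hne => hT.disjoint C.1 C.2.1 C'.1 C'.2.1 fun h => hne (Subtype.ext h))
    ((MeasureTheory.measure_mono (iUnion_subset hbound)).trans_lt
      (isCompact_closedBall _ _).measure_lt_top).ne
  exact Set.finite_univ_iff.1 (hfin.subset fun C _ => hvol C.1 C.2.1)

theorem countable_cells (hT : IsParallelohedralTiling P T) : T.Countable := by
  refine (countable_iUnion fun n : ℕ =>
    (hT.finite_meeting (Metric.isBounded_closedBall (x := 0) (r := n))).countable).mono
    fun C hC => ?_
  obtain ⟨x, hx⟩ := (hT.isPolytope hC).2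
  obtain ⟨n, hn⟩ := exists_nat_ge ‖x‖
  exact mem_iUnion.2 ⟨n, hC, x, interior_subset hx, by simpa using hn⟩

theorem eventually_mem_of_mem (hT : IsParallelohedralTiling P T) (x : Euc d) :
    ∀ᶠ y in 𝓝 x, ∀ C ∈ T, y ∈ C → x ∈ C := by
  have hcell : ∀ C ∈ {C | C ∈ T ∧ (C ∩ Metric.closedBall x 1).Nonempty},
      ∀ᶠ y in 𝓝 x, y ∈ C → x ∈ C := by
    rintro C ⟨hC, -⟩
    by_cases hx : x ∈ C
    · exact Eventually.of_forall fun _ _ => hx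
    · filter_upwards [(hT.isPolytope hC).isClosed.isOpen_compl.mem_nhds hx] with y hy hyC
      exact absurd hyC hy
  filter_upwards [(eventually_all_finite (hT.finite_meeting Metric.isBounded_closedBall)).2 hcell,
    Metric.closedBall_mem_nhds x one_pos] with y hy hyB C hC hyC
  exact hy C ⟨hC, y, hyC, hyB⟩ hyC

theorem countable_codimFaces (hT : IsParallelohedralTiling P T) (k : ℕ) :
    (codimFaces T k).Countable :=
  (hT.countable_cells.biUnion fun _ hC => (hT.isPolytope hC).finite_isExposed.countable).mono
    fun _ ⟨_, hC, hE, _⟩ => mem_biUnion hC hE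

theorem avoidsCodim_of_mem_interior (hT : IsParallelohedralTiling P T) (hC : C ∈ T)
    (hx : x ∈ interior C) {k : ℕ} (hk : 1 ≤ k) : AvoidsCodim T k x := by
  rintro E ⟨C', hC', hE, hd⟩ hxE
  obtain rfl := hT.eq_of_mem_interior hC hC' hx (hE.subset hxE)
  refine Set.disjoint_left.1 (disjoint_interior_of_isExposed hE ?_) hxE hx
  rintro rfl
  rw [finrank_vectorSpan_of_interior_nonempty ⟨x, hx⟩, finrank_euclideanSpace_fin] at hd
  omega

theorem isFaceOfCodim_one_inter (hT : IsParallelohedralTiling P T) (hC : C ∈ T) (hC' : C' ∈ T)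
    (hne : C ≠ C') (hx : AvoidsCodim T 2 x) (hxC : x ∈ C) (hxC' : x ∈ C') :
    IsFaceOfCodim 1 C (C ∩ C') := by
  have hexp := (hT.face_to_face C hC C' hC').1
  have hdisj : Disjoint (C ∩ C') (interior C) := Set.disjoint_left.2 fun y hy hyi =>
    hne (hT.eq_of_mem_interior hC hC' hyi hy.2)
  have hlt := finrank_vectorSpan_lt_of_disjoint_interior (hexp.convex (hT.isPolytope hC).convex)
    ⟨x, hxC, hxC'⟩ hexp.subset hdisj
  have hcod : ¬Module.finrank ℝ (vectorSpan ℝ (C ∩ C')) + 2 ≤ d := fun h =>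
    hx _ ⟨C, hC, hexp, h⟩ ⟨hxC, hxC'⟩
  rw [finrank_euclideanSpace_fin] at hlt
  exact ⟨hexp, ⟨x, hxC, hxC'⟩, by omega⟩

theorem adjacentCells_of_avoidsCodim (hT : IsParallelohedralTiling P T) (hC : C ∈ T)
    (hC' : C' ∈ T) (hne : C ≠ C') (hx : AvoidsCodim T 2 x) (hxC : x ∈ C) (hxC' : x ∈ C') :
    AdjacentCells C C' :=
  ⟨hT.isFaceOfCodim_one_inter hC hC' hne hx hxC hxC',
    inter_comm C C' ▸ hT.isFaceOfCodim_one_inter hC' hC hne.symm hx hxC' hxC⟩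

theorem facet_unique_of_avoidsCodim (hT : IsParallelohedralTiling P T) (hC : C ∈ T)
    (hx : AvoidsCodim T 2 x) (hF : IsFaceOfCodim 1 C F) (hF' : IsFaceOfCodim 1 C F')
    (hxF : x ∈ F) (hxF' : x ∈ F') : F = F' := by
  have hi := (hT.isPolytope hC).2
  have hexp : IsExposed ℝ C (F ∩ F') := hF.1.inter hF'.1
  have hfacet : IsFaceOfCodim 1 C (F ∩ F') := by
    refine ⟨hexp, ⟨x, hxF, hxF'⟩, ?_⟩
    have hcod : ¬Module.finrank ℝ (vectorSpan ℝ (F ∩ F')) + 2 ≤ d := fun h =>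
      hx _ ⟨C, hC, hexp, h⟩ ⟨hxF, hxF'⟩
    have hmono := Submodule.finrank_mono (vectorSpan_mono ℝ (inter_subset_left : F ∩ F' ⊆ F))
    have := hF.2.2
    omega
  rw [← hfacet.eq_of_subset hi hF inter_subset_left]
  exact hfacet.eq_of_subset hi hF' inter_subset_right

theorem exists_avoidsCodim_of_facet (hT : IsParallelohedralTiling P T) (hC : C ∈ T)
    (hF : IsFaceOfCodim 1 C F) : ∃ m ∈ F, AvoidsCodim T 2 m := by
  have hCp := hT.isPolytope hC
  have hfin : (⋃ D ∈ {D | D ∈ T ∧ (D ∩ C).Nonempty}, {E | IsExposed ℝ D E ∧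
      Module.finrank ℝ (vectorSpan ℝ E) + 2 ≤ d}).Finite :=
    (hT.finite_meeting hCp.isCompact.isBounded).biUnion fun D hD =>
      (hT.isPolytope hD.1).finite_isExposed.subset fun E hE => hE.1
  obtain ⟨m, hmF, hm⟩ := exists_mem_forall_notMem_affineSubspace (hF.1.convex hCp.convex) hF.2.1
    (hfin.image fun E => affineSpan ℝ E) <| by
      rintro _ ⟨E, hE, rfl⟩ hsub
      simp only [mem_iUnion] at hE
      obtain ⟨D, -, -, hdim⟩ := hE
      have hdir := AffineSubspace.direction_le (affineSpan_le.2 hsub)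
      rw [direction_affineSpan, direction_affineSpan] at hdir
      have := Submodule.finrank_mono hdir
      have := hF.2.2
      omega
  refine ⟨m, hmF, ?_⟩
  rintro E ⟨D, hD, hE, hdim⟩ hmE
  exact hm _ (mem_image_of_mem _ (mem_biUnion ⟨hD, m, hE.subset hmE, hF.1.subset hmF⟩ ⟨hE, hdim⟩))
    (mem_affineSpan ℝ hmE)

theorem ne_of_adjacentCells (hT : IsParallelohedralTiling P T) (hC : C ∈ T)
    (h : AdjacentCells C C') : C ≠ C' := by
  rintro rfl
  have hdim := h.1.2.2
  rw [inter_self, finrank_vectorSpan_of_interior_nonempty (hT.isPolytope hC).2,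
    finrank_euclideanSpace_fin] at hdim
  omega

theorem _root_.IsNormalFromTo.isFacetNormal (h : IsNormalFromTo C C' n) :
    IsFacetNormal C (C ∩ C') n :=
  ⟨h.1, h.2.1, fun f hf y hy => h.2.2 y hy f hf.2⟩

theorem _root_.IsNormalFromTo.neg (h : IsNormalFromTo C C' n) : IsNormalFromTo C' C (-n) := by
  refine ⟨(norm_neg n).trans h.1, inter_comm C C' ▸ neg_mem h.2.1, fun x hx y hy => ?_⟩
  rw [inner_neg_left, inner_neg_left]
  exact neg_le_neg (h.2.2 y hy x hx)

theorem exists_isNormalFromTo (hT : IsParallelohedralTiling P T) (hC : C ∈ T) (hC' : C' ∈ T)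
    (hne : C ≠ C') : ∃ n, IsNormalFromTo C C' n := by
  obtain ⟨n, hn, hle⟩ := exists_norm_eq_one_forall_inner_le (hT.isPolytope hC).convex
    (hT.isPolytope hC').convex (hT.isPolytope hC).2 (hT.isPolytope hC').2
    (hT.disjoint C hC C' hC' hne)
  exact ⟨n, hn, mem_orthogonal_vectorSpan.2 fun x hx y hy =>
    (hle x hx.1 y hy.2).antisymm (hle y hy.1 x hx.2), hle⟩

theorem isNormalFromTo_iff (hT : IsParallelohedralTiling P T) (hC : C ∈ T) (hC' : C' ∈ T)
    (hadj : AdjacentCells C C') : IsNormalFromTo C C' n ↔ IsFacetNormal C (C ∩ C') n := by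
  refine ⟨IsNormalFromTo.isFacetNormal, fun h => ?_⟩
  obtain ⟨n', hn'⟩ := hT.exists_isNormalFromTo hC hC' (hT.ne_of_adjacentCells hC hadj)
  rwa [← h.eq (hT.isPolytope hC).2 hadj.1 hn'.isFacetNormal]

theorem isFacetNormal_neg (hT : IsParallelohedralTiling P T) (hC : C ∈ T) (hC' : C' ∈ T)
    (hadj : AdjacentCells C C') (hn : IsFacetNormal C (C ∩ C') n) :
    IsFacetNormal C' (C ∩ C') (-n) :=
  inter_comm C' C ▸ ((hT.isNormalFromTo_iff hC hC' hadj).2 hn).neg.isFacetNormal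

theorem eventually_mem_union (hT : IsParallelohedralTiling P T) (hC : C ∈ T) (hC' : C' ∈ T)
    (hadj : AdjacentCells C C') (hm : m ∈ C ∩ C') (hmg : AvoidsCodim T 2 m) :
    ∀ᶠ y in 𝓝 m, y ∈ C ∪ C' := by
  obtain ⟨n, hn⟩ := hadj.1.exists_isFacetNormal (hT.isPolytope hC).2
  filter_upwards [(hT.isPolytope hC).eventually_mem_of_inner_le hm.1
      (fun F hF hmF => hT.facet_unique_of_avoidsCodim hC hmg hF hadj.1 hmF hm) hadj.1 hn,
    (hT.isPolytope hC').eventually_mem_of_inner_le hm.2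
      (fun F hF hmF => hT.facet_unique_of_avoidsCodim hC' hmg hF hadj.2 hmF hm) hadj.2
      (hT.isFacetNormal_neg hC hC' hadj hn)] with y hyC hyC'
  rw [inner_neg_left, inner_neg_left, neg_le_neg_iff] at hyC'
  exact (le_total ⟪n, y⟫ ⟪n, m⟫).imp hyC hyC'

theorem eq_or_eq_of_eventually_mem_union (hT : IsParallelohedralTiling P T) (hC : C ∈ T)
    (hC' : C' ∈ T) (hD : D ∈ T) (h : ∀ᶠ y in 𝓝 m, y ∈ C ∪ C') (hm : m ∈ D) :
    D = C ∨ D = C' := by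
  rw [← (hT.isPolytope hD).closure_interior] at hm
  obtain ⟨y, hyCC', hyD⟩ := mem_closure_iff_nhds.1 hm _ h
  exact hyCC'.imp (hT.eq_of_mem_interior hD hC hyD) (hT.eq_of_mem_interior hD hC' hyD)

theorem exists_ne_of_notMem_interior (hT : IsParallelohedralTiling P T) (hm : m ∉ interior C) :
    ∃ C' ∈ T, C ≠ C' ∧ m ∈ C' := by
  by_contra! hcon
  refine hm (mem_interior_iff_mem_nhds.2 ?_)
  filter_upwards [hT.eventually_mem_of_mem m] with y hy
  obtain ⟨D, hD, hyD⟩ := hT.cover y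
  by_contra hyC
  refine hcon D hD ?_ (hy D hD hyD)
  rintro rfl
  exact hyC hyD

theorem exists_adjacentCells (hT : IsParallelohedralTiling P T) (hC : C ∈ T)
    (hF : IsFaceOfCodim 1 C F) : ∃ C' ∈ T, AdjacentCells C C' ∧ C ∩ C' = F := by
  obtain ⟨m, hmF, hmg⟩ := hT.exists_avoidsCodim_of_facet hC hF
  have hmC := hF.1.subset hmF
  obtain ⟨n, hn⟩ := hF.exists_isFacetNormal (hT.isPolytope hC).2
  obtain ⟨C', hC', hne, hmC'⟩ := hT.exists_ne_of_notMem_interior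
    fun h => lt_irrefl _ (hn.lt hmF h)
  have hadj := hT.adjacentCells_of_avoidsCodim hC hC' hne hmg hmC hmC'
  exact ⟨C', hC', hadj, hT.facet_unique_of_avoidsCodim hC hmg hadj.1 hF ⟨hmC, hmC'⟩ hmF⟩

/-! ### Galleries of cells -/

theorem reflTransGen_adjacentIn_of_avoidsCodim (hT : IsParallelohedralTiling P T)
    {K : Set (Euc d)} (hK : IsPreconnected K) (hKT : ∀ z ∈ K, AvoidsCodim T 2 z) (hC : C ∈ T)
    (hD : D ∈ T) (hx : x ∈ C ∩ K) (hy : y ∈ D ∩ K) :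
    Relation.ReflTransGen (AdjacentIn T K) C D := by
  have : Std.Symm (AdjacentIn T K) := ⟨fun _ _ => AdjacentIn.symm⟩
  refine hK.induction₂
    (fun p q => ∀ A ∈ T, ∀ A' ∈ T, p ∈ A → q ∈ A' → Relation.ReflTransGen (AdjacentIn T K) A A')
    (fun p hp => ?_) (fun p q u _ _ _ hpq hqu A hA A' hA' hpA huA' => ?_)
    (fun p q _ _ h A hA A' hA' hqA hpA' =>
      Relation.ReflTransGen.stdSymm.symm _ _ (h A' hA' A hA hpA' hqA))
    hx.2 hy.2 C hC D hD hx.1 hy.1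
  · filter_upwards [nhdsWithin_le_nhds (hT.eventually_mem_of_mem p)] with q hq A hA A' hA' hpA hqA'
    have hpA' := hq A' hA' hqA'
    rcases eq_or_ne A A' with rfl | hne
    · exact .refl
    · exact .single ⟨hA, hA', hT.adjacentCells_of_avoidsCodim hA hA' hne (hKT p hp) hpA hpA', p,
        ⟨hpA, hpA'⟩, hp⟩
  · obtain ⟨A'', hA'', hqA''⟩ := hT.cover q
    exact (hpq A hA A'' hA'' hpA hqA'').trans (hqu A'' hA'' A' hA' hqA'' huA')

theorem interior_inter_nonempty (hT : IsParallelohedralTiling P T) {B : Set (Euc d)}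
    (hB : IsOpen B) (hC : C ∈ T) (hCB : (C ∩ B).Nonempty) : (interior C ∩ B).Nonempty := by
  obtain ⟨x, hx, hxB⟩ := hCB
  rw [← (hT.isPolytope hC).closure_interior] at hx
  exact inter_comm _ _ ▸ mem_closure_iff.1 hx B hB hxB

theorem reflTransGen_adjacentIn (hT : IsParallelohedralTiling P T) {B : Set (Euc d)}
    (hB : IsOpen B) (hBc : Convex ℝ B) (hC : C ∈ T) (hD : D ∈ T) (hCB : (C ∩ B).Nonempty)
    (hDB : (D ∩ B).Nonempty) : Relation.ReflTransGen (AdjacentIn T B) C D := by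
  obtain ⟨x, hxC, hxB⟩ := hT.interior_inter_nonempty hB hC hCB
  obtain ⟨y, ⟨hyD, hyB⟩, hy⟩ := exists_mem_forall_notMem_affineSpan_insert
    (isOpen_interior.inter hB) (hT.interior_inter_nonempty hB hD hDB) (hT.countable_codimFaces 2)
    (fun E ⟨_, _, _, hE⟩ => by rw [finrank_euclideanSpace_fin]; omega) x
  have havoid : ∀ z ∈ segment ℝ x y, AvoidsCodim T 2 z := by
    rw [segment_eq_image_lineMap]
    rintro _ ⟨t, -, rfl⟩
    exact (hT.avoidsCodim_of_mem_interior hC hxC one_le_two).lineMap hy t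
  refine Relation.ReflTransGen.mono (fun A A' hA => ⟨hA.1, hA.2.1, hA.2.2.1, ?_⟩) _ _
    (hT.reflTransGen_adjacentIn_of_avoidsCodim (convex_segment x y).isPreconnected havoid hC hD
      ⟨interior_subset hxC, left_mem_segment ℝ x y⟩ ⟨interior_subset hyD, right_mem_segment ℝ x y⟩)
  exact hA.2.2.2.mono (inter_subset_inter_right _ (hBc.segment_subset hxB hyB))

end IsParallelohedralTiling
end LocalStructure

/-! ### Liftings of the cells with prescribed jumps -/

/-- The affine functions `u C` and `u C'` agree on the facet `C ∩ C'`, and the gradient jumps there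
by the normal scaled by `s`. Here and below `(g, a)` stands for the function `y ↦ ⟪g, y⟫ + a`. -/
def HasJump {d : ℕ} (s : Set (Euc d) → ℝ) (u : Set (Euc d) → Euc d × ℝ) (C C' : Set (Euc d)) :
    Prop :=
  ∀ n, IsNormalFromTo C C' n → ∀ f ∈ C ∩ C', u C' - u C = s (C ∩ C') • (n, -⟪n, f⟫)

/-- `u` lifts the cells of `T` with the jumps prescribed by `s` at all facets through `x`. -/
def IsLiftingAt {d : ℕ} (T : Set (Set (Euc d))) (s : Set (Euc d) → ℝ)
    (u : Set (Euc d) → Euc d × ℝ) (x : Euc d) : Prop :=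
  ∀ C ∈ T, ∀ C' ∈ T, x ∈ C → x ∈ C' → AdjacentCells C C' → HasJump s u C C'

section Liftings
variable {d : ℕ} {P : Set (Euc d)} {T : Set (Set (Euc d))} {s : Set (Euc d) → ℝ}
  {u u' : Set (Euc d) → Euc d × ℝ} {C C' D K : Set (Euc d)} {x y z : Euc d}

theorem HasJump.symm (h : HasJump s u C C') : HasJump s u C' C := by
  intro n hn f hf
  rw [← neg_sub, h (-n) hn.neg f hf.symm, inter_comm, ← smul_neg, inner_neg_left, Prod.neg_mk,
    neg_neg, neg_neg]

theorem IsLiftingAt.of_eq_add (h : IsLiftingAt T s u x) {k : Euc d × ℝ}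
    (hu' : ∀ C ∈ T, x ∈ C → u' C = u C + k) : IsLiftingAt T s u' x := by
  intro C hC C' hC' hx hx' hadj n hn f hf
  rw [hu' C hC hx, hu' C' hC' hx', add_sub_add_right_eq_sub]
  exact h C hC C' hC' hx hx' hadj n hn f hf

theorem IsLiftingAt.of_forall_mem (h : IsLiftingAt T s u x) (hyx : ∀ C ∈ T, y ∈ C → x ∈ C) :
    IsLiftingAt T s u y :=
  fun C hC C' hC' hy hy' => h C hC C' hC' (hyx C hC hy) (hyx C' hC' hy')

namespace IsParallelohedralTiling

theorem sub_eq_sub_of_hasJump (hT : IsParallelohedralTiling P T) (hC : C ∈ T) (hC' : C' ∈ T)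
    (hadj : AdjacentCells C C') (h : HasJump s u C C') (h' : HasJump s u' C C') :
    u C - u' C = u C' - u' C' := by
  obtain ⟨n, hn⟩ := hT.exists_isNormalFromTo hC hC' (hT.ne_of_adjacentCells hC hadj)
  obtain ⟨f, hf⟩ := hadj.1.2.1
  rw [sub_eq_sub_iff_sub_eq_sub, ← neg_sub (u C') (u C), ← neg_sub (u' C') (u' C), h n hn f hf,
    h' n hn f hf]

theorem sub_eq_sub_of_isLiftingAt (hT : IsParallelohedralTiling P T) (hu : IsLiftingAt T s u x)
    (hu' : IsLiftingAt T s u' x) (hC : C ∈ T) (hD : D ∈ T) (hxC : x ∈ C) (hxD : x ∈ D) :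
    u C - u' C = u D - u' D := by
  obtain ⟨r, hr, hball⟩ := Metric.eventually_nhds_iff_ball.1 (hT.eventually_mem_of_mem x)
  have hgallery := hT.reflTransGen_adjacentIn Metric.isOpen_ball (convex_ball x r) hC hD
    ⟨x, hxC, Metric.mem_ball_self hr⟩ ⟨x, hxD, Metric.mem_ball_self hr⟩
  induction hgallery with
  | refl => rfl
  | tail _ h ih =>
    obtain ⟨hA, hA', hadj, y, ⟨hyA, hyA'⟩, hyB⟩ := h
    have hxA := hball y hyB _ hA hyA
    have hxA' := hball y hyB _ hA' hyA'
    exact (ih hA hxA).trans (hT.sub_eq_sub_of_hasJump hA hA' hadj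
      (hu _ hA _ hA' hxA hxA' hadj) (hu' _ hA _ hA' hxA hxA' hadj))

theorem sub_eq_sub_of_isPreconnected (hT : IsParallelohedralTiling P T) (hK : IsPreconnected K)
    (hu : ∀ x ∈ K, IsLiftingAt T s u x) (hu' : ∀ x ∈ K, IsLiftingAt T s u' x) (hC : C ∈ T)
    (hD : D ∈ T) (hx : x ∈ K) (hy : y ∈ K) (hxC : x ∈ C) (hyD : y ∈ D) :
    u C - u' C = u D - u' D := by
  refine hK.induction₂
    (fun p q => ∀ A ∈ T, ∀ A' ∈ T, p ∈ A → q ∈ A' → u A - u' A = u A' - u' A') ?_ ?_ ?_ hx hy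
    C hC D hD hxC hyD
  · intro p hp
    filter_upwards [nhdsWithin_le_nhds (hT.eventually_mem_of_mem p)] with q hq A hA A' hA' hpA hqA'
    exact hT.sub_eq_sub_of_isLiftingAt (hu p hp) (hu' p hp) hA hA' hpA (hq A' hA' hqA')
  · intro p q r _ _ _ hpq hqr A hA A' hA' hp hr
    obtain ⟨B, hB, hq⟩ := hT.cover q
    exact (hpq A hA B hB hp hq).trans (hqr B hB A' hA' hq hr)
  · intro p q _ _ h A hA A' hA' hq hp
    exact (h A' hA' A hA hp hq).symm

theorem exists_locally_compatible (hT : IsParallelohedralTiling P T) (hK : Convex ℝ K)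
    {U : K → Set (Euc d) → Euc d × ℝ} (hU : ∀ p, IsLiftingAt T s (U p) p) :
    ∃ h : K → Euc d × ℝ, ∀ p, ∀ᶠ q : K in 𝓝 p, ∀ C ∈ T, (q : Euc d) ∈ C →
      U q C + h q = U p C + h p := by
  rcases K.eq_empty_or_nonempty with rfl | hne
  · exact ⟨0, fun p => p.2.elim⟩
  have := hK.contractibleSpace hne
  have := hK.locallyPathConnectedSpace
  have hnear : ∀ p : K, ∀ᶠ q : K in 𝓝 p, ∀ C ∈ T, (q : Euc d) ∈ C → (p : Euc d) ∈ C := fun p =>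
    continuous_subtype_val.continuousAt.eventually (hT.eventually_mem_of_mem p)
  choose D hD hmemD using fun p : K => hT.cover p
  have hind : ∀ p q : K, (∀ C ∈ T, (q : Euc d) ∈ C → (p : Euc d) ∈ C) → ∀ C ∈ T, (q : Euc d) ∈ C →
      U p C - U q C = U p (D q) - U q (D q) := fun p q hpq C hC hqC =>
    hT.sub_eq_sub_of_isLiftingAt ((hU p).of_forall_mem hpq) (hU q) hC (hD q) hqC (hmemD q)
  have hcocycle : IsLocalCocycle fun p q => U p (D q) - U q (D q) := by
    intro p
    filter_upwards [hnear p] with q hq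
    filter_upwards [hnear q] with r hr
    rw [← hind p q hq (D r) (hD r) (hr _ (hD r) (hmemD r))]
    abel
  obtain ⟨h, hh⟩ := hcocycle.exists_primitive
  refine ⟨h, fun p => ?_⟩
  filter_upwards [hnear p, hh p] with q hq hhq C hC hqC
  rw [hhq, ← hind p q hq C hC hqC]
  abel

theorem exists_isLiftingAt_of_convex (hT : IsParallelohedralTiling P T) (hK : Convex ℝ K)
    (hloc : ∀ x ∈ K, ∃ u, IsLiftingAt T s u x) : ∃ w, ∀ x ∈ K, IsLiftingAt T s w x := by
  classical
  choose U hU using fun p : K => hloc p p.2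
  obtain ⟨h, hh⟩ := hT.exists_locally_compatible hK hU
  have hcell : ∀ C ∈ T, ∀ p q : K, (p : Euc d) ∈ C → (q : Euc d) ∈ C →
      U p C + h p = U q C + h q := by
    intro C hC p q hp hq
    have hconn : IsPreconnected (Subtype.val ⁻¹' C : Set K) := by
      rw [← IsInducing.subtypeVal.isPreconnected_image, Subtype.image_preimage_coe]
      exact (hK.inter (hT.isPolytope hC).convex).isPreconnected
    refine hconn.induction₂ (fun p q => U p C + h p = U q C + h q) (fun p _ => ?_)
      (fun _ _ _ _ _ _ => Eq.trans) (fun _ _ _ _ => Eq.symm) hp hq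
    filter_upwards [nhdsWithin_le_nhds (hh p), self_mem_nhdsWithin] with q hq hqC
    exact (hq C hC hqC).symm
  refine ⟨fun C => if hC : ∃ p : K, (p : Euc d) ∈ C then U hC.choose C + h hC.choose else 0,
    fun x hx => (hU ⟨x, hx⟩).of_eq_add (k := h ⟨x, hx⟩) fun C hC hxC => ?_⟩
  have hmeet : ∃ p : K, (p : Euc d) ∈ C := ⟨⟨x, hx⟩, hxC⟩
  rw [dif_pos hmeet]
  exact hcell C hC _ _ hmeet.choose_spec hxC

theorem exists_isLiftingAt_of_avoidsCodim_two (hT : IsParallelohedralTiling P T)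
    (hx : AvoidsCodim T 2 x) : ∃ u, IsLiftingAt T s u x := by
  classical
  by_cases h : ∃ C₁ ∈ T, ∃ C₂ ∈ T, x ∈ C₁ ∧ x ∈ C₂ ∧ AdjacentCells C₁ C₂
  swap
  · exact ⟨0, fun C hC C' hC' hx hx' hadj => absurd ⟨C, hC, C', hC', hx, hx', hadj⟩ h⟩
  obtain ⟨C₁, h₁, C₂, h₂, hx₁, hx₂, hadj⟩ := h
  have hne := hT.ne_of_adjacentCells h₁ hadj
  have hcells : ∀ D ∈ T, x ∈ D → D = C₁ ∨ D = C₂ := fun D hD =>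
    hT.eq_or_eq_of_eventually_mem_union h₁ h₂ hD
      (hT.eventually_mem_union h₁ h₂ hadj ⟨hx₁, hx₂⟩ hx)
  obtain ⟨n, hn⟩ := hT.exists_isNormalFromTo h₁ h₂ hne
  let u : Set (Euc d) → Euc d × ℝ := fun C => if C = C₂ then s (C₁ ∩ C₂) • (n, -⟪n, x⟫) else 0
  have hjump : HasJump s u C₁ C₂ := by
    intro n' hn' f hf
    obtain rfl := hn.isFacetNormal.eq (hT.isPolytope h₁).2 hadj.1 hn'.isFacetNormal
    simp only [u, if_neg hne, if_true, sub_zero, hn.isFacetNormal.inner_eq hf ⟨hx₁, hx₂⟩]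
  refine ⟨u, fun C hC C' hC' hxC hxC' hadj' => ?_⟩
  have hne' := hT.ne_of_adjacentCells hC hadj'
  rcases hcells C hC hxC with rfl | rfl <;> rcases hcells C' hC' hxC' with rfl | rfl
  exacts [absurd rfl hne', hjump, hjump.symm, absurd rfl hne']

end IsParallelohedralTiling
end Liftings

/-! ### Global liftings from liftings near the ridges -/

/-- `y` is in general position with respect to `S`: it lies on none of the flats spanned by `S` and
a face of codimension at least `3` of `T`. -/
def IsGenericFrom {d : ℕ} (T : Set (Set (Euc d))) (S : Set (Euc d)) (y : Euc d) : Prop :=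
  ∀ E ∈ codimFaces T 3, y ∉ affineSpan ℝ (S ∪ E)

/-- `k` is the value at `C` of a lifting along the segment from `x₀` to `y` that vanishes on `P`. -/
def IsRadialValue {d : ℕ} (P : Set (Euc d)) (T : Set (Set (Euc d))) (s : Set (Euc d) → ℝ)
    (x₀ y : Euc d) (C : Set (Euc d)) (k : Euc d × ℝ) : Prop :=
  ∃ w, w P = 0 ∧ (∀ x ∈ segment ℝ x₀ y, IsLiftingAt T s w x) ∧ w C = k

section GlobalLifting
variable {d : ℕ} {P : Set (Euc d)} {T : Set (Set (Euc d))} {s : Set (Euc d) → ℝ}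
  {C C' S S' : Set (Euc d)} {x₀ y y' z : Euc d} {k k' : Euc d × ℝ}

theorem IsGenericFrom.mono (hz : IsGenericFrom T S z) (h : S' ⊆ S) : IsGenericFrom T S' z :=
  fun E hE hmem => hz E hE (affineSpan_mono ℝ (union_subset_union_left E h) hmem)

theorem AvoidsCodim.of_mem_convexHull (hx : AvoidsCodim T 3 x₀) (hy : IsGenericFrom T {x₀} y)
    (hz : IsGenericFrom T {x₀, y} z) {p : Euc d} (hp : p ∈ convexHull ℝ {x₀, y, z}) :
    AvoidsCodim T 3 p := by
  have hperm : ({x₀, y, z} : Set (Euc d)) = {z, x₀, y} := by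
    rw [insert_comm z, pair_comm y z]
  rw [hperm, convexHull_insert ⟨x₀, mem_insert _ _⟩, convexHull_pair, convexJoin_singleton_left,
    mem_iUnion₂] at hp
  obtain ⟨q, hq, hp⟩ := hp
  rw [segment_eq_image_lineMap] at hq
  obtain ⟨t, -, rfl⟩ := hq
  rw [segment_symm, segment_eq_image_lineMap] at hp
  obtain ⟨t', -, rfl⟩ := hp
  refine (hx.lineMap hy t).lineMap (fun E hE hmem => hz E hE ?_) t'
  refine affineSpan_le.2 (insert_subset ?_ ?_) hmem
  · exact AffineMap.lineMap_mem t (mem_affineSpan ℝ (.inl (mem_insert _ _)))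
      (mem_affineSpan ℝ (.inl (mem_insert_of_mem _ rfl)))
  · exact subset_union_right.trans (subset_affineSpan ℝ _)

namespace IsParallelohedralTiling

theorem exists_mem_isGenericFrom (hT : IsParallelohedralTiling P T) {V : Set (Euc d)}
    (hV : IsOpen V) (hne : V.Nonempty) (x₀ y y' : Euc d) :
    ∃ z ∈ V, IsGenericFrom T {x₀, y} z ∧ IsGenericFrom T {x₀, y'} z := by
  have hdim : ∀ y, ∀ E ∈ codimFaces T 3, Module.finrank ℝ (vectorSpan ℝ ({x₀, y} ∪ E)) <
      Module.finrank ℝ (Euc d) := by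
    rintro y E ⟨-, -, -, hE⟩
    have h₁ := finrank_vectorSpan_insert_le_set ℝ E y
    have h₂ := finrank_vectorSpan_insert_le_set ℝ (insert y E) x₀
    rw [insert_union, singleton_union, finrank_euclideanSpace_fin]
    omega
  obtain ⟨z, hz, h⟩ := exists_mem_forall_notMem_affineSpan hV hne
    (((hT.countable_codimFaces 3).image ({x₀, y} ∪ ·)).union
      ((hT.countable_codimFaces 3).image ({x₀, y'} ∪ ·))) (by
      rintro _ (⟨E, hE, rfl⟩ | ⟨E, hE, rfl⟩)
      exacts [hdim y E hE, hdim y' E hE])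
  exact ⟨z, hz, fun E hE => h _ (.inl ⟨E, hE, rfl⟩), fun E hE => h _ (.inr ⟨E, hE, rfl⟩)⟩

theorem isRadialValue_unique (hT : IsParallelohedralTiling P T) (hx₀ : x₀ ∈ P) (hC : C ∈ T)
    (hy : y ∈ C) (h : IsRadialValue P T s x₀ y C k) (h' : IsRadialValue P T s x₀ y C k') :
    k = k' := by
  obtain ⟨w, hw₀, hw, rfl⟩ := h
  obtain ⟨w', hw₀', hw', rfl⟩ := h'
  have hsub := hT.sub_eq_sub_of_isPreconnected (convex_segment x₀ y).isPreconnected hw hw'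
    hT.self_mem hC (left_mem_segment ℝ x₀ y) (right_mem_segment ℝ x₀ y) hx₀ hy
  rwa [hw₀, hw₀', sub_self, eq_comm, sub_eq_zero] at hsub

theorem exists_isLiftingAt_of_mem_segment (hT : IsParallelohedralTiling P T)
    (hloc : ∀ x, AvoidsCodim T 3 x → ∃ u, IsLiftingAt T s u x) (hx₀ : x₀ ∈ interior P)
    (hy : IsGenericFrom T {x₀} y) (hz : IsGenericFrom T {x₀, y} z) :
    ∃ w, (∀ C, IsRadialValue P T s x₀ y C (w C)) ∧ (∀ C, IsRadialValue P T s x₀ z C (w C)) ∧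
      ∀ x ∈ segment ℝ y z, IsLiftingAt T s w x := by
  have hx₀T := hT.avoidsCodim_of_mem_interior hT.self_mem hx₀ (k := 3) (by norm_num)
  obtain ⟨w, hw⟩ := hT.exists_isLiftingAt_of_convex (convex_convexHull ℝ {x₀, y, z})
    fun x hx => hloc x (hx₀T.of_mem_convexHull hy hz hx)
  replace hw : ∀ x ∈ convexHull ℝ {x₀, y, z}, IsLiftingAt T s (fun C => w C - w P) x :=
    fun x hx => (hw x hx).of_eq_add fun C _ _ => sub_eq_add_neg (w C) (w P)
  have hseg : ∀ a ∈ ({x₀, y, z} : Set (Euc d)), ∀ b ∈ ({x₀, y, z} : Set (Euc d)),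
      ∀ x ∈ segment ℝ a b, IsLiftingAt T s (fun C => w C - w P) x :=
    fun a ha b hb x hx => hw x (segment_subset_convexHull ha hb hx)
  refine ⟨fun C => w C - w P, fun C => ⟨_, sub_self _, hseg _ ?_ _ ?_, rfl⟩,
    fun C => ⟨_, sub_self _, hseg _ ?_ _ ?_, rfl⟩, hseg _ ?_ _ ?_⟩ <;> simp

theorem exists_isRadialValue (hT : IsParallelohedralTiling P T)
    (hloc : ∀ x, AvoidsCodim T 3 x → ∃ u, IsLiftingAt T s u x) (hx₀ : x₀ ∈ interior P)
    (hy : IsGenericFrom T {x₀} y) (C : Set (Euc d)) : ∃ k, IsRadialValue P T s x₀ y C k := by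
  obtain ⟨z, -, hz, -⟩ := hT.exists_mem_isGenericFrom isOpen_univ univ_nonempty x₀ y y
  obtain ⟨w, hw, -⟩ := hT.exists_isLiftingAt_of_mem_segment hloc hx₀ hy hz
  exact ⟨w C, hw C⟩

theorem isRadialValue_of_isRadialValue (hT : IsParallelohedralTiling P T)
    (hloc : ∀ x, AvoidsCodim T 3 x → ∃ u, IsLiftingAt T s u x) (hx₀ : x₀ ∈ interior P)
    (hy : IsGenericFrom T {x₀} y) (hz : IsGenericFrom T {x₀, y} z) (hC : C ∈ T) (hyC : y ∈ C)
    (hk : IsRadialValue P T s x₀ y C k) : IsRadialValue P T s x₀ z C k := by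
  obtain ⟨w, hwy, hwz, -⟩ := hT.exists_isLiftingAt_of_mem_segment hloc hx₀ hy hz
  exact hT.isRadialValue_unique (interior_subset hx₀) hC hyC (hwy C) hk ▸ hwz C

theorem exists_segment_crossing_facet (hT : IsParallelohedralTiling P T) (hC : C ∈ T)
    (hC' : C' ∈ T) (hadj : AdjacentCells C C') (x₀ y y' : Euc d) :
    ∃ z ∈ C, ∃ z' ∈ C', IsGenericFrom T {x₀, y} z ∧ IsGenericFrom T {x₀, y'} z' ∧
      IsGenericFrom T {x₀, z} z' ∧ (segment ℝ z z' ∩ (C ∩ C')).Nonempty := by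
  obtain ⟨m, hm, hmg⟩ := hT.exists_avoidsCodim_of_facet hC hadj.1
  obtain ⟨r, hr, hball⟩ := Metric.eventually_nhds_iff_ball.1
    (hT.eventually_mem_union hC hC' hadj hm hmg)
  have hmeet : ∀ D ∈ T, m ∈ D → (interior D ∩ Metric.ball m r).Nonempty := fun D hD hmD =>
    hT.interior_inter_nonempty Metric.isOpen_ball hD ⟨m, hmD, Metric.mem_ball_self hr⟩
  obtain ⟨z, ⟨hzC, hzB⟩, hz, -⟩ := hT.exists_mem_isGenericFrom
    (isOpen_interior.inter Metric.isOpen_ball) (hmeet C hC hm.1) x₀ y y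
  obtain ⟨z', ⟨hzC', hzB'⟩, hzz', hz'⟩ := hT.exists_mem_isGenericFrom
    (isOpen_interior.inter Metric.isOpen_ball) (hmeet C' hC' hm.2) x₀ z y'
  exact ⟨z, interior_subset hzC, z', interior_subset hzC', hz, hz', hzz',
    isPreconnected_closed_iff.1 (convex_segment z z').isPreconnected
      C C' (hT.isPolytope hC).isClosed (hT.isPolytope hC').isClosed
      (fun x hx => hball x ((convex_ball m r).segment_subset hzB hzB' hx))
      ⟨z, left_mem_segment ℝ z z', interior_subset hzC⟩
      ⟨z', right_mem_segment ℝ z z', interior_subset hzC'⟩⟩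

theorem exists_global_lifting (hT : IsParallelohedralTiling P T)
    (hloc : ∀ x, AvoidsCodim T 3 x → ∃ u, IsLiftingAt T s u x) :
    ∃ u : Set (Euc d) → Euc d × ℝ, u P = 0 ∧
      ∀ C ∈ T, ∀ C' ∈ T, AdjacentCells C C' → HasJump s u C C' := by
  obtain ⟨x₀, hx₀⟩ := hT.polytope.2
  have hx₀P := interior_subset hx₀
  have hgen : ∀ C ∈ T, ∃ y ∈ C, IsGenericFrom T {x₀} y := fun C hC => by
    obtain ⟨y, hyC, hy, -⟩ :=
      hT.exists_mem_isGenericFrom isOpen_interior (hT.isPolytope hC).2 x₀ x₀ x₀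
    exact ⟨y, interior_subset hyC, hy.mono (singleton_subset_iff.2 (mem_insert _ _))⟩
  choose! y hyC hy using hgen
  choose! u hu using fun C hC => hT.exists_isRadialValue hloc hx₀ (hy C hC) C
  obtain ⟨w, hwP, hw, -⟩ := hu P hT.self_mem
  refine ⟨u, hT.isRadialValue_unique hx₀P hT.self_mem (hyC P hT.self_mem) (hu P hT.self_mem)
    ⟨w, hwP, hw, hwP⟩, fun C hC C' hC' hadj n hn f hf => ?_⟩
  obtain ⟨z, hzC, z', hzC', hz, hz', hzz', q, hqs, hqC, hqC'⟩ :=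
    hT.exists_segment_crossing_facet hC hC' hadj x₀ (y C) (y C')
  obtain ⟨w, hwz, hwz', hw⟩ := hT.exists_isLiftingAt_of_mem_segment hloc hx₀
    (hz.mono (singleton_subset_iff.2 (mem_insert _ _))) hzz'
  have huC : u C = w C := hT.isRadialValue_unique hx₀P hC hzC
    (hT.isRadialValue_of_isRadialValue hloc hx₀ (hy C hC) hz hC (hyC C hC) (hu C hC)) (hwz C)
  have huC' : u C' = w C' := hT.isRadialValue_unique hx₀P hC' hzC'
    (hT.isRadialValue_of_isRadialValue hloc hx₀ (hy C' hC') hz' hC' (hyC C' hC') (hu C' hC'))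
    (hwz' C')
  rw [huC, huC']
  exact hw q hqs C hC C' hC' hqC hqC' hadj n hn f hf

end IsParallelohedralTiling
end GlobalLifting

/-! ### A planar function with prescribed jumps across rays -/

section Plane
variable {W V ι : Type*} [NormedAddCommGroup W] [InnerProductSpace ℝ W]
  [Fact (Module.finrank ℝ W = 2)] [NormedAddCommGroup V] [NormedSpace ℝ V]

/-- The function of the points `w` of an oriented plane that jumps by `m i` where `w` crosses the
ray spanned by `e i` counterclockwise. The argument that occurs is the oriented angle from `w` to
`-e i`, so that its branch cut lies along the ray. -/
noncomputable def windingSum (o : Orientation ℝ W (Fin 2)) (S : Finset ι) (e : ι → W) (m : ι → V)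
    (w : W) : V :=
  ∑ i ∈ S, ((-o.kahler w (e i)).arg / (2 * Real.pi)) • m i

variable (o : Orientation ℝ W (Fin 2)) {S : Finset ι} {e : ι → W} {m : ι → V} {v w : W} {t : ℝ}

theorem neg_kahler_mem_slitPlane (h : ¬SameRay ℝ v w) :
    -o.kahler w v ∈ Complex.slitPlane := by
  rw [Complex.mem_slitPlane_iff, Complex.neg_re, Complex.neg_im, o.kahler_apply_apply]
  contrapose! h
  exact ((o.nonneg_inner_and_areaForm_eq_zero_iff_sameRay w v).1 (by simpa using h)).symm

theorem continuous_kahler_left (v : W) : Continuous fun w => o.kahler w v := by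
  have := FiniteDimensional.of_fact_finrank_eq_two (K := ℝ) (V := W)
  exact (o.kahler.flip v).continuous_of_finiteDimensional

theorem eventually_arg_neg_kahler (h : ¬SameRay ℝ v w) :
    ∀ᶠ w' in 𝓝 w, (-o.kahler w' v).arg = (o.kahler w' w).arg + (-o.kahler w v).arg := by
  have hslit := neg_kahler_mem_slitPlane o h
  have hw : 0 < ‖w‖ ^ 2 := by
    refine pow_pos (norm_pos_iff.2 ?_) 2
    rintro rfl
    exact h (SameRay.zero_right v)
  have hpos : ((‖w‖ ^ 2 : ℝ) : ℂ) ∈ Complex.slitPlane := Complex.ofReal_mem_slitPlane.2 hw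
  have hself : o.kahler w w = (‖w‖ ^ 2 : ℝ) := by rw [o.kahler_apply_self, Complex.ofReal_pow]
  have hcont : ContinuousAt (fun w' => (o.kahler w' w).arg) w := by
    refine ContinuousAt.comp (Complex.continuousAt_arg ?_) (continuous_kahler_left o w).continuousAt
    exact hself ▸ hpos
  have hlim : Tendsto (fun w' => (o.kahler w' w).arg + (-o.kahler w v).arg) (𝓝 w)
      (𝓝 (-o.kahler w v).arg) := by
    simpa only [hself, Complex.arg_ofReal_of_nonneg hw.le, zero_add] using
      hcont.tendsto.add_const (-o.kahler w v).arg
  have hmem : (-o.kahler w v).arg ∈ Ioo (-Real.pi) Real.pi :=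
    ⟨Complex.neg_pi_lt_arg _,
      (Complex.arg_le_pi _).lt_of_ne (Complex.mem_slitPlane_iff_arg.1 hslit).1⟩
  filter_upwards [hlim (isOpen_Ioo.mem_nhds hmem),
    (continuous_kahler_left o w).continuousAt.eventually_ne
      (hself ▸ Complex.slitPlane_ne_zero hpos)] with w' hsum hne
  rw [← (Complex.arg_mul_eq_add_arg_iff hne (Complex.slitPlane_ne_zero hslit)).2
    (Ioo_subset_Ioc_self hsum), mul_neg, o.kahler_mul, ← mul_neg, ← Complex.ofReal_pow,
    Complex.arg_real_mul _ hw]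

theorem windingSum_eventually_eq (hm : ∑ i ∈ S, m i = 0) (hw : ∀ i ∈ S, ¬SameRay ℝ (e i) w) :
    ∀ᶠ w' in 𝓝 w, windingSum o S e m w' = windingSum o S e m w := by
  filter_upwards [(S.eventually_all).2 fun i hi => eventually_arg_neg_kahler o (hw i hi)] with w' h
  calc windingSum o S e m w'
      = ∑ i ∈ S, (((o.kahler w' w).arg / (2 * Real.pi)) • m i +
          ((-o.kahler w (e i)).arg / (2 * Real.pi)) • m i) :=
        Finset.sum_congr rfl fun i hi => by rw [h i hi, add_div, add_smul]
    _ = windingSum o S e m w := by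
        rw [Finset.sum_add_distrib, ← Finset.smul_sum, hm, smul_zero, zero_add, windingSum]

theorem tendsto_crossing_ray (v : W) (t : ℝ) :
    Tendsto (fun ε : ℝ => t • v + ε • o.rightAngleRotation v) (𝓝 0) (𝓝 (t • v)) :=
  Continuous.tendsto' (by fun_prop) _ _ (by rw [zero_smul, add_zero])

theorem tendsto_arg_neg_kahler_of_not_sameRay (h : ¬SameRay ℝ v (t • w)) :
    Tendsto (fun ε : ℝ => (-o.kahler (t • w + ε • o.rightAngleRotation w) v).arg) (𝓝 0)
      (𝓝 (-o.kahler (t • w) v).arg) :=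
  ((Complex.continuousAt_arg (neg_kahler_mem_slitPlane o h)).tendsto.comp
    (continuous_kahler_left o v).neg.continuousAt.tendsto).comp (tendsto_crossing_ray o w t)

theorem neg_kahler_crossing_ray (hv : ‖v‖ = 1) (t ε : ℝ) :
    -o.kahler (t • v + ε • o.rightAngleRotation v) v = ⟨-t, ε⟩ := by
  simp only [map_add, map_smul, LinearMap.add_apply, LinearMap.smul_apply,
    o.kahler_rightAngleRotation_left, o.kahler_apply_self, hv]
  apply Complex.ext <;> simp

theorem tendsto_mk_neg (t : ℝ) : Tendsto (fun ε : ℝ => (⟨-t, ε⟩ : ℂ)) (𝓝 0) (𝓝 ⟨-t, 0⟩) := by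
  have : Continuous fun ε : ℝ => (⟨-t, ε⟩ : ℂ) :=
    Complex.equivRealProdCLM.symm.continuous.comp (Continuous.prodMk_right (-t))
  exact this.tendsto 0

theorem tendsto_arg_neg_kahler_right (hv : ‖v‖ = 1) (ht : 0 < t) :
    Tendsto (fun ε : ℝ => (-o.kahler (t • v + ε • o.rightAngleRotation v) v).arg) (𝓝[>] 0)
      (𝓝 Real.pi) := by
  simp only [neg_kahler_crossing_ray o hv]
  refine (Complex.tendsto_arg_nhdsWithin_im_nonneg_of_re_neg_of_im_zero (z := ⟨-t, 0⟩)
    (neg_lt_zero.2 ht) rfl).comp (tendsto_nhdsWithin_iff.2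
      ⟨(tendsto_mk_neg t).mono_left nhdsWithin_le_nhds, ?_⟩)
  filter_upwards [self_mem_nhdsWithin] with ε hε using le_of_lt hε

theorem tendsto_arg_neg_kahler_left (hv : ‖v‖ = 1) (ht : 0 < t) :
    Tendsto (fun ε : ℝ => (-o.kahler (t • v + ε • o.rightAngleRotation v) v).arg) (𝓝[<] 0)
      (𝓝 (-Real.pi)) := by
  simp only [neg_kahler_crossing_ray o hv]
  refine (Complex.tendsto_arg_nhdsWithin_im_neg_of_re_neg_of_im_zero (z := ⟨-t, 0⟩)
    (neg_lt_zero.2 ht) rfl).comp (tendsto_nhdsWithin_iff.2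
      ⟨(tendsto_mk_neg t).mono_left nhdsWithin_le_nhds, ?_⟩)
  filter_upwards [self_mem_nhdsWithin] with ε hε using hε

theorem windingSum_sub_windingSum {j : ι} (hj : j ∈ S) (he : ‖e j‖ = 1) (ht : 0 < t)
    (hS : ∀ i ∈ S, i ≠ j → ¬SameRay ℝ (e i) (t • e j)) {g₁ g₂ : V}
    (h₁ : ∀ᶠ ε : ℝ in 𝓝[<] 0,
      windingSum o S e m (t • e j + ε • o.rightAngleRotation (e j)) = g₁)
    (h₂ : ∀ᶠ ε : ℝ in 𝓝[>] 0,
      windingSum o S e m (t • e j + ε • o.rightAngleRotation (e j)) = g₂) :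
    g₂ - g₁ = m j := by
  classical
  let R : V := ∑ i ∈ S.erase j, ((-o.kahler (t • e j) (e i)).arg / (2 * Real.pi)) • m i
  have hlim : ∀ {l : Filter ℝ} {a : ℝ}, l ≤ 𝓝 0 → Tendsto (fun ε : ℝ =>
      (-o.kahler (t • e j + ε • o.rightAngleRotation (e j)) (e j)).arg) l (𝓝 a) →
      Tendsto (fun ε : ℝ => windingSum o S e m (t • e j + ε • o.rightAngleRotation (e j))) l
        (𝓝 ((a / (2 * Real.pi)) • m j + R)) := by
    intro l a hl ha
    simp only [windingSum, ← Finset.add_sum_erase S _ hj]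
    refine ((ha.div_const _).smul_const _).add (tendsto_finsetSum _ fun i hi => ?_)
    exact (((tendsto_arg_neg_kahler_of_not_sameRay o
      (hS i (Finset.mem_of_mem_erase hi) (Finset.ne_of_mem_erase hi))).mono_left hl).div_const
        _).smul_const _
  have hg₁ := tendsto_nhds_unique (tendsto_const_nhds.congr' (h₁.mono fun _ => Eq.symm))
    (hlim nhdsWithin_le_nhds (tendsto_arg_neg_kahler_left o he ht))
  have hg₂ := tendsto_nhds_unique (tendsto_const_nhds.congr' (h₂.mono fun _ => Eq.symm))
    (hlim nhdsWithin_le_nhds (tendsto_arg_neg_kahler_right o he ht))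
  have hhalf : Real.pi / (2 * Real.pi) = 1 / 2 := by
    field_simp
  rw [hg₁, hg₂, add_sub_add_right_eq_sub, ← sub_smul, neg_div, hhalf]
  norm_num

end Plane

/-! ### The cells around a ridge -/

/-- The `(d-2)`-face `G` lies in all cells of `T` through its point `x`, which is the case for
the relatively interior points `x` of `G`. -/
structure IsRidgeThrough {d : ℕ} (T : Set (Set (Euc d))) (G : Set (Euc d)) (x : Euc d) : Prop where
  mem_tilingFaces : G ∈ tilingFaces 2 T
  mem : x ∈ G
  subset : ∀ C ∈ T, x ∈ C → G ⊆ C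

/-- The projection along the ridge `G` to the plane orthogonal to it. -/
noncomputable def ridgeProj {d : ℕ} (G : Set (Euc d)) : Euc d →L[ℝ] (vectorSpan ℝ G)ᗮ :=
  (vectorSpan ℝ G)ᗮ.orthogonalProjectionOnto

section Ridge
variable {d : ℕ} {P : Set (Euc d)} {T : Set (Set (Euc d))} {A C C' D F F₁ G : Set (Euc d)}
  {e n p q v x y : Euc d} {c : ℝ}

theorem ridgeProj_eq_zero_iff : ridgeProj G v = 0 ↔ v ∈ vectorSpan ℝ G := by
  rw [ridgeProj, Submodule.orthogonalProjectionOnto_eq_zero_iff, Submodule.orthogonal_orthogonal]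

theorem ridgeProj_coe (w : (vectorSpan ℝ G)ᗮ) : ridgeProj G w = w :=
  Submodule.orthogonalProjectionOnto_mem_subspace_eq_self w

theorem coe_ridgeProj (hv : v ∈ (vectorSpan ℝ G)ᗮ) : (ridgeProj G v : Euc d) = v :=
  congrArg Subtype.val (ridgeProj_coe ⟨v, hv⟩)

theorem finrank_orthogonal_vectorSpan_ridge (hG : G ∈ tilingFaces 2 T) :
    Module.finrank ℝ (vectorSpan ℝ G)ᗮ = 2 := by
  obtain ⟨C, -, -, -, hdim⟩ := hG
  have := Submodule.finrank_add_finrank_orthogonal (vectorSpan ℝ G)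
  rw [finrank_euclideanSpace_fin] at this
  omega

theorem IsInwardDirection.ne_zero (he : IsInwardDirection G F e) : e ≠ 0 :=
  norm_ne_zero_iff.1 (he.1.symm ▸ one_ne_zero)

theorem IsInwardDirection.sub_smul_mem (he : IsInwardDirection G F e) (hGF : G ⊆ F)
    (hG : IsFaceOfCodim 2 C G) (hF : IsFaceOfCodim 1 D F) (hv : v ∈ vectorSpan ℝ F) :
    v - ⟪e, v⟫ • e ∈ vectorSpan ℝ G := by
  have hle : vectorSpan ℝ G ≤ vectorSpan ℝ F := vectorSpan_mono ℝ hGF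
  have hline : (vectorSpan ℝ G)ᗮ ⊓ vectorSpan ℝ F = Submodule.span ℝ {e} := by
    refine (Submodule.eq_of_le_of_finrank_eq ((Submodule.span_singleton_le_iff_mem e _).2
      (Submodule.mem_inf.2 ⟨he.2.1, he.2.2.1⟩)) ?_).symm
    rw [finrank_span_singleton he.ne_zero]
    have := Submodule.finrank_add_inf_finrank_orthogonal hle
    have := hG.2.2
    have := hF.2.2
    omega
  obtain ⟨g, hg, w, hw, rfl⟩ := (vectorSpan ℝ G).exists_add_mem_mem_orthogonal v
  have hwF : w ∈ (vectorSpan ℝ G)ᗮ ⊓ vectorSpan ℝ F :=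
    ⟨hw, ((vectorSpan ℝ F).add_mem_iff_right (hle hg)).1 hv⟩
  obtain ⟨a, rfl⟩ := Submodule.mem_span_singleton.1 (hline ▸ hwF)
  rw [inner_add_right, Submodule.inner_left_of_mem_orthogonal hg he.2.1, inner_smul_right,
    real_inner_self_eq_norm_sq, he.1, one_pow, mul_one, zero_add, add_sub_cancel_right]
  exact hg

theorem IsInwardDirection.exists_inner_pos (he : IsInwardDirection G F e) (hx : x ∈ G) :
    ∃ q ∈ F, 0 < ⟪e, q - x⟫ := by
  by_contra! hle
  have heq : ∀ q ∈ F, ⟪e, q⟫ = ⟪e, x⟫ := fun q hq => by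
    rw [← sub_eq_zero, ← inner_sub_right]
    exact (hle q hq).antisymm (he.2.2.2 x hx q hq)
  have horth : e ∈ (vectorSpan ℝ F)ᗮ := mem_orthogonal_vectorSpan.2 fun q hq q' hq' =>
    (heq q hq).trans (heq q' hq').symm
  exact he.ne_zero ((Submodule.disjoint_def.1 (Submodule.orthogonal_disjoint _)) e he.2.2.1 horth)

theorem IsInwardDirection.ridgeProj_sub (he : IsInwardDirection G F e) (hGF : G ⊆ F)
    (hG : IsFaceOfCodim 2 C G) (hF : IsFaceOfCodim 1 D F) (hx : x ∈ G) (hq : q ∈ F) :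
    ridgeProj G (q - x) = ⟪e, q - x⟫ • ridgeProj G e := by
  rw [← sub_eq_zero, ← map_smul, ← map_sub, ridgeProj_eq_zero_iff]
  exact he.sub_smul_mem hGF hG hF (vsub_mem_vectorSpan ℝ hq (hGF hx))

theorem IsInwardDirection.exists_sub_smul_mem_of_sameRay (he : IsInwardDirection G F e)
    (hGF : G ⊆ F) (hG : IsFaceOfCodim 2 C G) (hF : IsFaceOfCodim 1 D F) (hx : x ∈ G)
    (hv : SameRay ℝ (ridgeProj G e) (ridgeProj G v)) :
    ∃ q ∈ F, ∃ c : ℝ, 0 ≤ c ∧ v - c • (q - x) ∈ vectorSpan ℝ G := by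
  obtain ⟨q, hq, hpos⟩ := he.exists_inner_pos hx
  have hne : ridgeProj G e ≠ 0 := fun h => he.ne_zero (by rw [← coe_ridgeProj he.2.1, h]; rfl)
  obtain ⟨r, hr, hrv⟩ := hv.exists_nonneg_left hne
  refine ⟨q, hq, r / ⟪e, q - x⟫, by positivity, ?_⟩
  rw [← ridgeProj_eq_zero_iff, map_sub, map_smul, he.ridgeProj_sub hGF hG hF hx hq, smul_smul,
    div_mul_cancel₀ _ hpos.ne', hrv, sub_self]

namespace IsParallelohedralTiling

theorem exists_isRidgeThrough (hT : IsParallelohedralTiling P T) (hx₃ : AvoidsCodim T 3 x)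
    (hx₂ : ¬AvoidsCodim T 2 x) : ∃ G, IsRidgeThrough T G x := by
  unfold AvoidsCodim at hx₂
  push Not at hx₂
  obtain ⟨E, ⟨C, hC, hE, hdim⟩, hxE⟩ := hx₂
  obtain ⟨G, hG, hxG, hmin⟩ := (hT.isPolytope hC).exists_minimal_isExposed (hE.subset hxE)
  have hcod : ¬Module.finrank ℝ (vectorSpan ℝ G) + 3 ≤ d := fun h => hx₃ G ⟨C, hC, hG, h⟩ hxG
  have := Submodule.finrank_mono (vectorSpan_mono ℝ (hmin E hE hxE))
  exact ⟨G, ⟨C, hC, hG, ⟨x, hxG⟩, by omega⟩, hxG, fun D hD hxD =>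
    (hmin _ (hT.face_to_face C hC D hD).1 ⟨hE.subset hxE, hxD⟩).trans inter_subset_right⟩

theorem eventually_mem_of_sub_mem_vectorSpan (hT : IsParallelohedralTiling P T)
    (hG : IsRidgeThrough T G x) (hC : C ∈ T) (hxC : x ∈ C) :
    ∀ᶠ y in 𝓝 x, ∀ z ∈ C, y - z ∈ vectorSpan ℝ G → y ∈ C := by
  filter_upwards [(hT.isPolytope hC).eventually_mem_of_forall_facet hxC] with y hy z hz hyz
  refine hy fun F n hF hn hxF => ?_
  obtain ⟨C', hC', -, rfl⟩ := hT.exists_adjacentCells hC hF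
  have hGF : G ⊆ C ∩ C' := subset_inter (hG.subset C hC hxC) (hG.subset C' hC' hxF.2)
  have hort := Submodule.inner_left_of_mem_orthogonal (vectorSpan_mono ℝ hGF hyz) hn.orth
  rw [inner_sub_right, sub_eq_zero] at hort
  exact hort.le.trans (hn.le x hxF z hz)

theorem eventually_add_smul_mem (hT : IsParallelohedralTiling P T) (hG : IsRidgeThrough T G x)
    (hC : C ∈ T) (hxC : x ∈ C) (hq : q ∈ C) (hc : 0 ≤ c)
    (hv : v - c • (q - x) ∈ vectorSpan ℝ G) : ∀ᶠ δ : ℝ in 𝓝[>] 0, x + δ • v ∈ C := by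
  have hlim : Tendsto (fun δ : ℝ => x + δ • v) (𝓝[>] 0) (𝓝 x) :=
    (Continuous.tendsto' (by fun_prop) _ _ (by rw [zero_smul, add_zero])).mono_left
      nhdsWithin_le_nhds
  have hsmall : ∀ᶠ δ : ℝ in 𝓝[>] 0, δ * c ≤ 1 :=
    (Continuous.tendsto' (by fun_prop) 0 0 (zero_mul c)).mono_left nhdsWithin_le_nhds |>.eventually
      (ge_mem_nhds one_pos)
  filter_upwards [hlim.eventually (hT.eventually_mem_of_sub_mem_vectorSpan hG hC hxC), hsmall,
    self_mem_nhdsWithin] with δ hδ hδc hpos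
  refine hδ (x + (δ * c) • (q - x)) ((hT.isPolytope hC).convex.add_smul_sub_mem hxC hq
    ⟨mul_nonneg (le_of_lt hpos) hc, hδc⟩) ?_
  rw [add_sub_add_left_eq_sub, mul_smul, ← smul_sub]
  exact Submodule.smul_mem _ δ hv

theorem eventually_mem_facet_of_sameRay (hT : IsParallelohedralTiling P T)
    (hG : IsRidgeThrough T G x) (hF : F ∈ tilingFaces 1 T) (hGF : G ⊆ F)
    (he : IsInwardDirection G F e) (hv : SameRay ℝ (ridgeProj G e) (ridgeProj G v)) :
    ∀ᶠ δ : ℝ in 𝓝[>] 0, x + δ • v ∈ F := by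
  obtain ⟨C, hC, hF⟩ := hF
  obtain ⟨_, -, hGB⟩ := hG.mem_tilingFaces
  obtain ⟨q, hq, c, hc, hmem⟩ := he.exists_sub_smul_mem_of_sameRay hGF hGB hF hG.mem hv
  obtain ⟨C', hC', -, rfl⟩ := hT.exists_adjacentCells hC hF
  have hx := hGF hG.mem
  exact (hT.eventually_add_smul_mem hG hC hx.1 hq.1 hc hmem).and
    (hT.eventually_add_smul_mem hG hC' hx.2 hq.2 hc hmem)

theorem not_sameRay_of_mem_interior (hT : IsParallelohedralTiling P T)
    (hG : IsRidgeThrough T G x) (hF : F ∈ tilingFaces 1 T) (hGF : G ⊆ F)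
    (he : IsInwardDirection G F e) (hC : C ∈ T) (hxC : x ∈ C) (hy : y ∈ interior C) :
    ¬SameRay ℝ (ridgeProj G e) (ridgeProj G (y - x)) := by
  intro hray
  obtain ⟨δ, hδF, hδ⟩ := ((hT.eventually_mem_facet_of_sameRay hG hF hGF he hray).and
    (Ioc_mem_nhdsGT one_pos)).exists
  have hδC := (hT.isPolytope hC).convex.add_smul_sub_mem_interior hxC hy hδ
  obtain ⟨A, hA, hF⟩ := hF
  obtain ⟨A', hA', hadj, rfl⟩ := hT.exists_adjacentCells hA hF
  exact hT.ne_of_adjacentCells hA hadj ((hT.eq_of_mem_interior hC hA hδC hδF.1).symm.trans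
    (hT.eq_of_mem_interior hC hA' hδC hδF.2))

theorem eventually_mem_union_of_homothety (hT : IsParallelohedralTiling P T) (hC : C ∈ T)
    (hC' : C' ∈ T) (hxC : x ∈ C) (hxC' : x ∈ C') (hp : ∀ᶠ y in 𝓝 p, y ∈ C ∪ C') {δ : ℝ}
    (hδ : δ ∈ Ioc (0 : ℝ) 1) : ∀ᶠ y in 𝓝 (x + δ • (p - x)), y ∈ C ∪ C' := by
  have hinv : Tendsto (fun y => x + δ⁻¹ • (y - x)) (𝓝 (x + δ • (p - x))) (𝓝 p) :=
    Continuous.tendsto' (by fun_prop) _ _ (by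
      rw [add_sub_cancel_left, inv_smul_smul₀ hδ.1.ne', add_sub_cancel])
  filter_upwards [hinv.eventually hp] with y hy
  have heq : x + δ • (x + δ⁻¹ • (y - x) - x) = y := by
    rw [add_sub_cancel_left, smul_inv_smul₀ hδ.1.ne', add_sub_cancel]
  rw [← heq]
  exact hy.imp
    (fun h => (hT.isPolytope hC).convex.add_smul_sub_mem hxC h (Ioc_subset_Icc_self hδ))
    (fun h => (hT.isPolytope hC').convex.add_smul_sub_mem hxC' h (Ioc_subset_Icc_self hδ))

theorem not_sameRay_of_ne (hT : IsParallelohedralTiling P T) (hG : IsRidgeThrough T G x)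
    (hF : F ∈ tilingFaces 1 T) (hGF : G ⊆ F) (hF₁ : F₁ ∈ tilingFaces 1 T) (hGF₁ : G ⊆ F₁)
    (he : IsInwardDirection G F₁ e) (hp : p ∈ F) (hpg : AvoidsCodim T 2 p) (hne : F₁ ≠ F) :
    ¬SameRay ℝ (ridgeProj G e) (ridgeProj G (p - x)) := by
  intro hray
  obtain ⟨δ, hδF, hδ⟩ := ((hT.eventually_mem_facet_of_sameRay hG hF₁ hGF₁ he hray).and
    (Ioc_mem_nhdsGT one_pos)).exists
  obtain ⟨D, hD, hF⟩ := hF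
  obtain ⟨D', hD', hadj, rfl⟩ := hT.exists_adjacentCells hD hF
  obtain ⟨A, hA, hF₁⟩ := hF₁
  obtain ⟨A', hA', hadj₁, rfl⟩ := hT.exists_adjacentCells hA hF₁
  have hx := hGF hG.mem
  have hnear := hT.eventually_mem_union_of_homothety hD hD' hx.1 hx.2
    (hT.eventually_mem_union hD hD' hadj hp hpg) hδ
  have hneA := hT.ne_of_adjacentCells hA hadj₁
  rcases hT.eq_or_eq_of_eventually_mem_union hD hD' hA hnear hδF.1 with rfl | rfl <;>
    rcases hT.eq_or_eq_of_eventually_mem_union hD hD' hA' hnear hδF.2 with rfl | rfl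
  exacts [hneA rfl, hne rfl, hne (inter_comm _ _), hneA rfl]

theorem eventually_mem_facet (hT : IsParallelohedralTiling P T) (hC : C ∈ T)
    (hF : IsFaceOfCodim 1 C F) (hp : p ∈ F) (hpg : AvoidsCodim T 2 p) :
    ∀ᶠ y in 𝓝 p, y - p ∈ vectorSpan ℝ F → y ∈ F := by
  have hPC := hT.isPolytope hC
  obtain ⟨n, hn⟩ := hF.exists_isFacetNormal hPC.2
  filter_upwards [hPC.eventually_mem_of_inner_le (hF.1.subset hp)
    (fun F' hF' hpF' => hT.facet_unique_of_avoidsCodim hC hpg hF' hF hpF' hp) hF hn] with y hy hyp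
  have heq := Submodule.inner_left_of_mem_orthogonal hyp hn.orth
  rw [inner_sub_right, sub_eq_zero] at heq
  exact (hn.mem_iff hPC.2 hF hp (hy heq.le)).2 heq

theorem inner_pos_of_avoidsCodim (hT : IsParallelohedralTiling P T) (hC : C ∈ T)
    (hF : IsFaceOfCodim 1 C F) (hx : x ∈ G) (he : IsInwardDirection G F e)
    (hp : p ∈ F) (hpg : AvoidsCodim T 2 p) : 0 < ⟪e, p - x⟫ := by
  obtain ⟨ε, hε, hmem⟩ := exists_pos_add_smul (hT.eventually_mem_facet hC hF hp hpg) (-e)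
  have hle := he.2.2.2 x hx _ (hmem (by
    rw [add_sub_cancel_left]
    exact Submodule.smul_mem _ _ (neg_mem he.2.2.1)))
  rw [add_sub_right_comm, inner_add_right, inner_smul_right, inner_neg_right,
    real_inner_self_eq_norm_sq, he.1] at hle
  linarith

theorem eventually_mem_interior (hT : IsParallelohedralTiling P T) (hC : C ∈ T)
    (hF : IsFaceOfCodim 1 C F) (hn : IsFacetNormal C F n) (hp : p ∈ F)
    (hpg : AvoidsCodim T 2 p) : ∀ᶠ y in 𝓝 p, ⟪n, y⟫ < ⟪n, p⟫ → y ∈ interior C := by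
  filter_upwards [((hT.isPolytope hC).eventually_mem_of_inner_le (hF.1.subset hp)
    (fun F' hF' hpF' => hT.facet_unique_of_avoidsCodim hC hpg hF' hF hpF' hp)
    hF hn).eventually_nhds] with y hy hlt
  have hcont : Continuous fun z : Euc d => ⟪n, z⟫ := by fun_prop
  rw [mem_interior_iff_mem_nhds]
  filter_upwards [hy, hcont.continuousAt.eventually (gt_mem_nhds hlt)] with z hz hzlt
  exact hz hzlt.le

theorem eventually_add_smul_mem_interior (hT : IsParallelohedralTiling P T) (hC : C ∈ T)
    (hC' : C' ∈ T) (hadj : AdjacentCells C C') (hn : IsNormalFromTo C C' n) (hp : p ∈ C ∩ C')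
    (hpg : AvoidsCodim T 2 p) :
    (∀ᶠ ε : ℝ in 𝓝[<] 0, p + ε • n ∈ interior C) ∧
      ∀ᶠ ε : ℝ in 𝓝[>] 0, p + ε • n ∈ interior C' := by
  have hlim : Tendsto (fun ε : ℝ => p + ε • n) (𝓝 0) (𝓝 p) :=
    Continuous.tendsto' (by fun_prop) _ _ (by rw [zero_smul, add_zero])
  have hinner : ∀ ε : ℝ, ⟪n, p + ε • n⟫ = ⟪n, p⟫ + ε := fun ε => by
    rw [inner_add_right, inner_smul_right, real_inner_self_eq_norm_sq, hn.1, one_pow, mul_one]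
  constructor
  · filter_upwards [nhdsWithin_le_nhds (hlim.eventually
      (hT.eventually_mem_interior hC hadj.1 hn.isFacetNormal hp hpg)), self_mem_nhdsWithin]
      with ε hε hneg
    exact hε (by rw [hinner]; exact add_lt_of_neg_right _ hneg)
  · filter_upwards [nhdsWithin_le_nhds (hlim.eventually (hT.eventually_mem_interior hC' hadj.2
      (hT.isFacetNormal_neg hC hC' hadj hn.isFacetNormal) hp hpg)), self_mem_nhdsWithin]
      with ε hε hpos
    refine hε ?_
    rw [inner_neg_left, inner_neg_left, neg_lt_neg_iff, hinner]
    exact lt_add_of_pos_right _ hpos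

end IsParallelohedralTiling
end Ridge

/-! ### Liftings near a ridge -/

section RidgeLifting
variable {d : ℕ} {P : Set (Euc d)} {T : Set (Set (Euc d))} {s : Set (Euc d) → ℝ}
  {C C' D F G : Set (Euc d)} {v x y : Euc d} {S : Finset (Set (Euc d))}
  {e m : Set (Euc d) → Euc d} [Fact (Module.finrank ℝ (vectorSpan ℝ G)ᗮ = 2)]
  (o : Orientation ℝ (vectorSpan ℝ G)ᗮ (Fin 2))

/-- The rotation by a right angle of the plane orthogonal to the ridge `G`, extended by zero to the
directions along `G`. -/
noncomputable def ridgeTurn : Euc d →ₗ[ℝ] Euc d :=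
  (vectorSpan ℝ G)ᗮ.subtype ∘ₗ o.rightAngleRotation.toLinearMap ∘ₗ (ridgeProj G).toLinearMap

theorem ridgeTurn_apply (v : Euc d) : ridgeTurn o v = o.rightAngleRotation (ridgeProj G v) := rfl

theorem ridgeProj_ridgeTurn (v : Euc d) :
    ridgeProj G (ridgeTurn o v) = o.rightAngleRotation (ridgeProj G v) :=
  ridgeProj_coe _

theorem isQuarterTurn_ridgeTurn : IsQuarterTurn (vectorSpan ℝ G)ᗮ (ridgeTurn o) where
  map_mem x _ := SetLike.coe_mem _
  norm_map x hx := by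
    rw [ridgeTurn_apply, Submodule.norm_coe, LinearIsometryEquiv.norm_map, ← Submodule.norm_coe,
      coe_ridgeProj hx]
  inner_map x hx := by
    have h := o.inner_rightAngleRotation_self (ridgeProj G x)
    rwa [Submodule.coe_inner, coe_ridgeProj hx] at h

theorem IsInwardDirection.ridgeTurn_mem_orthogonal {e : Euc d} (he : IsInwardDirection G F e)
    (hGF : G ⊆ F) (hG : IsFaceOfCodim 2 C G) (hF : IsFaceOfCodim 1 D F) :
    ridgeTurn o e ∈ (vectorSpan ℝ F)ᗮ := by
  rw [Submodule.mem_orthogonal']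
  intro v hv
  have hturn := isQuarterTurn_ridgeTurn o
  have hort := Submodule.inner_left_of_mem_orthogonal (he.sub_smul_mem hGF hG hF hv)
    (hturn.map_mem e he.2.1)
  rwa [inner_sub_right, inner_smul_right, hturn.inner_map e he.2.1, mul_zero, sub_zero] at hort

/-- The gradients of the lifting around the ridge `G` through `x` that jumps by `m F` across each
facet `F` of `S`, at the points `y` off these facets; `e F` is the direction of `F`. -/
noncomputable def ridgeGradient (S : Finset (Set (Euc d))) (e m : Set (Euc d) → Euc d)
    (x y : Euc d) : Euc d :=
  windingSum o S (fun F => ridgeProj G (e F)) m (ridgeProj G (y - x))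

namespace IsParallelohedralTiling

theorem ridgeGradient_eq_of_mem_interior (hT : IsParallelohedralTiling P T)
    (hG : IsRidgeThrough T G x) (hS : ∀ F ∈ S, F ∈ tilingFaces 1 T ∧ G ⊆ F)
    (he : ∀ F ∈ S, IsInwardDirection G F (e F)) (hm : ∑ F ∈ S, m F = 0) (hC : C ∈ T)
    (hxC : x ∈ C) {y y' : Euc d} (hy : y ∈ interior C) (hy' : y' ∈ interior C) :
    ridgeGradient o S e m x y = ridgeGradient o S e m x y' := by
  refine (hT.isPolytope hC).convex.interior.isPreconnected.induction₂
    (fun p q => ridgeGradient o S e m x p = ridgeGradient o S e m x q) (fun p hp => ?_)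
    (fun _ _ _ _ _ _ => Eq.trans) (fun _ _ _ _ => Eq.symm) hy hy'
  have hcont : Continuous fun q => ridgeProj G (q - x) := by fun_prop
  have hoff : ∀ F ∈ S, ¬SameRay ℝ (ridgeProj G (e F)) (ridgeProj G (p - x)) := fun F hF =>
    hT.not_sameRay_of_mem_interior hG (hS F hF).1 (hS F hF).2 (he F hF) hC hxC hp
  filter_upwards [nhdsWithin_le_nhds
    (hcont.continuousAt.eventually (windingSum_eventually_eq o hm hoff))] with q hq
  exact hq.symm

theorem ridgeGradient_sub (hT : IsParallelohedralTiling P T) (hG : IsRidgeThrough T G x)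
    (hS : ∀ F, F ∈ S ↔ F ∈ tilingFaces 1 T ∧ G ⊆ F)
    (he : ∀ F ∈ S, IsInwardDirection G F (e F)) (hm : ∑ F ∈ S, m F = 0) (hC : C ∈ T)
    (hC' : C' ∈ T) (hxC : x ∈ C) (hxC' : x ∈ C') (hadj : AdjacentCells C C')
    (hn : IsNormalFromTo C C' (ridgeTurn o (e (C ∩ C')))) {y y' : Euc d} (hy : y ∈ interior C)
    (hy' : y' ∈ interior C') :
    ridgeGradient o S e m x y' - ridgeGradient o S e m x y = m (C ∩ C') := by
  have hGF : G ⊆ C ∩ C' := subset_inter (hG.subset C hC hxC) (hG.subset C' hC' hxC')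
  have hFS : C ∩ C' ∈ S := (hS _).2 ⟨⟨C, hC, hadj.1⟩, hGF⟩
  obtain ⟨p, hp, hpg⟩ := hT.exists_avoidsCodim_of_facet hC hadj.1
  obtain ⟨_, -, hGB⟩ := hG.mem_tilingFaces
  have heF := he _ hFS
  have hproj := heF.ridgeProj_sub hGF hGB hadj.1 hG.mem hp
  have hcross : ∀ ε : ℝ, ridgeProj G (p + ε • ridgeTurn o (e (C ∩ C')) - x) =
      ⟪e (C ∩ C'), p - x⟫ • ridgeProj G (e (C ∩ C')) +
        ε • o.rightAngleRotation (ridgeProj G (e (C ∩ C'))) := fun ε => by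
    rw [add_sub_right_comm, map_add, map_smul, hproj, ridgeProj_ridgeTurn]
  obtain ⟨hleft, hright⟩ := hT.eventually_add_smul_mem_interior hC hC' hadj hn hp hpg
  refine windingSum_sub_windingSum o (e := fun F => ridgeProj G (e F)) hFS ?_
    (hT.inner_pos_of_avoidsCodim hC hadj.1 hG.mem heF hp hpg) (fun F hF hne => ?_) ?_ ?_
  · rw [← Submodule.norm_coe, coe_ridgeProj heF.2.1, heF.1]
  · rw [← hproj]
    exact hT.not_sameRay_of_ne hG ⟨C, hC, hadj.1⟩ hGF ((hS F).1 hF).1 ((hS F).1 hF).2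
      (he F hF) hp hpg hne
  · filter_upwards [hleft] with ε hε
    rw [← hcross]
    exact hT.ridgeGradient_eq_of_mem_interior o hG (fun F => (hS F).1) he hm hC hxC hε hy
  · filter_upwards [hright] with ε hε
    rw [← hcross]
    exact hT.ridgeGradient_eq_of_mem_interior o hG (fun F => (hS F).1) he hm hC' hxC' hε hy'

theorem exists_isLiftingAt_of_torsion (hT : IsParallelohedralTiling P T)
    (hG : IsRidgeThrough T G x) (htor : HasTorsion T s G (ridgeTurn o) 0) :
    ∃ u, IsLiftingAt T s u x := by
  obtain ⟨S, n, hS, hn, hsum⟩ := htor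
  choose! e he hne using hn
  choose! z hz using fun C (hC : C ∈ T) => (hT.isPolytope hC).2
  let g : Set (Euc d) → Euc d := fun C => ridgeGradient o S e (fun F => s F • n F) x (z C)
  let u : Set (Euc d) → Euc d × ℝ := fun C => (g C, -⟪g C, x⟫)
  have hjump : ∀ C ∈ T, ∀ C' ∈ T, x ∈ C → x ∈ C' → AdjacentCells C C' → C ∩ C' ∈ S →
      IsNormalFromTo C C' (n (C ∩ C')) → HasJump s u C C' := by
    intro C hC C' hC' hxC hxC' hadj hFS hnF n' hn' f hf
    obtain rfl := hnF.isFacetNormal.eq (hT.isPolytope hC).2 hadj.1 hn'.isFacetNormal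
    have hg : g C' - g C = s (C ∩ C') • n (C ∩ C') :=
      hT.ridgeGradient_sub o hG hS he hsum.symm hC hC' hxC hxC' hadj (hne _ hFS ▸ hnF) (hz C hC)
        (hz C' hC')
    simp only [u, Prod.mk_sub_mk, neg_sub_neg, ← inner_sub_left, Prod.smul_mk, smul_eq_mul]
    rw [← neg_sub (g C'), hg, inner_neg_left, inner_smul_left, mul_neg,
      hnF.isFacetNormal.inner_eq hf ⟨hxC, hxC'⟩, RCLike.conj_to_real]
  refine ⟨u, fun C hC C' hC' hxC hxC' hadj => ?_⟩
  have hGF : G ⊆ C ∩ C' := subset_inter (hG.subset C hC hxC) (hG.subset C' hC' hxC')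
  have hFS : C ∩ C' ∈ S := (hS _).2 ⟨⟨C, hC, hadj.1⟩, hGF⟩
  obtain ⟨_, -, hGB⟩ := hG.mem_tilingFaces
  obtain ⟨n', hn'⟩ := hT.exists_isNormalFromTo hC hC' (hT.ne_of_adjacentCells hC hadj)
  have hnorm : ‖n (C ∩ C')‖ = 1 := by
    rw [hne _ hFS, (isQuarterTurn_ridgeTurn o).norm_map _ (he _ hFS).2.1, (he _ hFS).1]
  have hort : n (C ∩ C') ∈ (vectorSpan ℝ (C ∩ C'))ᗮ :=
    hne _ hFS ▸ (he _ hFS).ridgeTurn_mem_orthogonal o hGF hGB hadj.1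
  -- The turn is directed from `C` to `C'` or from `C'` to `C`.
  rcases eq_or_eq_neg_of_mem_orthogonal (by rw [hadj.1.2.2, finrank_euclideanSpace_fin]) hnorm
    hn'.1 hort hn'.2.1 with rfl | rfl
  · exact hjump C hC C' hC' hxC hxC' hadj hFS hn'
  · rw [inter_comm] at hFS hn'
    have hback := hn'.neg
    rw [neg_neg] at hback
    exact (hjump C' hC' C hC hxC' hxC hadj.symm hFS hback).symm

end IsParallelohedralTiling
end RidgeLifting

namespace IsCanonicalScaling
variable {d : ℕ} {P : Set (Euc d)} {T : Set (Set (Euc d))} {s : Set (Euc d) → ℝ} {x : Euc d}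

theorem exists_isLiftingAt (hT : IsParallelohedralTiling P T) (hs : IsCanonicalScaling T s)
    (hx : AvoidsCodim T 3 x) : ∃ u, IsLiftingAt T s u x := by
  by_cases hx₂ : AvoidsCodim T 2 x
  · exact hT.exists_isLiftingAt_of_avoidsCodim_two hx₂
  obtain ⟨G, hG⟩ := hT.exists_isRidgeThrough hx hx₂
  have hplane := finrank_orthogonal_vectorSpan_ridge hG.mem_tilingFaces
  have : Fact (Module.finrank ℝ (vectorSpan ℝ G)ᗮ = 2) := ⟨hplane⟩
  let o := (Module.finBasisOfFinrankEq ℝ (vectorSpan ℝ G)ᗮ hplane).orientation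
  exact hT.exists_isLiftingAt_of_torsion o hG
    (hs.2 G hG.mem_tilingFaces _ (isQuarterTurn_ridgeTurn o))

theorem exists_lifting (hT : IsParallelohedralTiling P T) (hs : IsCanonicalScaling T s) :
    ∃ u : Set (Euc d) → Euc d × ℝ, u P = 0 ∧
      ∀ C ∈ T, ∀ C' ∈ T, AdjacentCells C C' → HasJump s u C C' :=
  hT.exists_global_lifting fun _ hx => hs.exists_isLiftingAt hT hx

end IsCanonicalScaling

/-! ### Translations of the tiling -/

section Translations

theorem isExposed_vadd_set {E : Type*} [AddCommGroup E] [TopologicalSpace E] [Module ℝ E]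
    {C F : Set E} (h : IsExposed ℝ C F) (t : E) : IsExposed ℝ (t +ᵥ C) (t +ᵥ F) := by
  rintro ⟨_, y, hy, rfl⟩
  obtain ⟨l, rfl⟩ := h ⟨y, hy⟩
  refine ⟨l, Subset.antisymm ?_ ?_⟩
  · rintro _ ⟨y, ⟨hy, hmax⟩, rfl⟩
    refine ⟨⟨y, hy, rfl⟩, ?_⟩
    rintro _ ⟨z, hz, rfl⟩
    simpa using hmax z hz
  · rintro _ ⟨⟨y, hy, rfl⟩, hmax⟩
    exact ⟨y, ⟨hy, fun z hz => by simpa using hmax _ ⟨z, hz, rfl⟩⟩, rfl⟩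

theorem eq_zero_of_vadd_subset {E : Type*} [NormedAddCommGroup E] [NormedSpace ℝ E] {K : Set E}
    (hK : Bornology.IsBounded K) (hne : K.Nonempty) {v : E} (h : v +ᵥ K ⊆ K) : v = 0 := by
  by_contra hv
  obtain ⟨x, hx⟩ := hne
  have hmem : ∀ m : ℕ, m • v + x ∈ K := by
    intro m
    induction m with
    | zero => simpa using hx
    | succ m ih => exact h ⟨_, ih, by simp only [vadd_eq_add, succ_nsmul]; abel⟩
  obtain ⟨R, hR⟩ := hK.exists_norm_le
  obtain ⟨m, hm⟩ := exists_lt_nsmul (norm_pos_iff.2 hv) (R + ‖x‖)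
  have hle := norm_sub_le (m • v + x) x
  rw [add_sub_cancel_right, RCLike.norm_nsmul ℝ] at hle
  linarith [hR _ (hmem m)]

theorem eq_of_vadd_eq {E : Type*} [NormedAddCommGroup E] [NormedSpace ℝ E] {K : Set E}
    (hK : Bornology.IsBounded K) (hne : K.Nonempty) {v w : E} (h : v +ᵥ K = w +ᵥ K) : v = w := by
  refine sub_eq_zero.1 (eq_zero_of_vadd_subset hK hne ?_)
  rw [sub_eq_neg_add, ← vadd_vadd, h, neg_vadd_vadd]

variable {d k : ℕ} {C C' F F' : Set (Euc d)} {n : Euc d}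

theorem IsFaceOfCodim.vadd (h : IsFaceOfCodim k C F) (t : Euc d) :
    IsFaceOfCodim k (t +ᵥ C) (t +ᵥ F) :=
  ⟨isExposed_vadd_set h.1 t, h.2.1.vadd_set, by rw [vectorSpan_vadd]; exact h.2.2⟩

theorem IsFacetNormal.vadd (h : IsFacetNormal C F n) (t : Euc d) :
    IsFacetNormal (t +ᵥ C) (t +ᵥ F) n := by
  refine ⟨h.norm_eq, by rw [vectorSpan_vadd]; exact h.orth, ?_⟩
  rintro _ ⟨f, hf, rfl⟩ _ ⟨y, hy, rfl⟩
  simpa [inner_add_right] using h.le f hf y hy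

theorem IsNormalFromTo.vadd (h : IsNormalFromTo C C' n) (t : Euc d) :
    IsNormalFromTo (t +ᵥ C) (t +ᵥ C') n := by
  refine ⟨h.1, by rw [← vadd_set_inter, vectorSpan_vadd]; exact h.2.1, ?_⟩
  rintro _ ⟨x, hx, rfl⟩ _ ⟨y, hy, rfl⟩
  simpa [inner_add_right] using h.2.2 x hx y hy

theorem IsFacetNormal.facet_eq (hi : (interior C).Nonempty) (hF : IsFaceOfCodim 1 C F)
    (hF' : IsFaceOfCodim 1 C F') (h : IsFacetNormal C F n) (h' : IsFacetNormal C F' n) :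
    F = F' := by
  obtain ⟨f, hf⟩ := hF.2.1
  obtain ⟨f', hf'⟩ := hF'.2.1
  have heq : ⟪n, f⟫ = ⟪n, f'⟫ :=
    (h'.le f' hf' f (hF.1.subset hf)).antisymm (h.le f hf f' (hF'.1.subset hf'))
  ext y
  constructor
  · intro hy
    rw [h'.mem_iff hi hF' hf' (hF.1.subset hy), ← heq]
    exact h.inner_eq hy hf
  · intro hy
    rw [h.mem_iff hi hF hf (hF'.1.subset hy), heq]
    exact h'.inner_eq hy hf'

end Translations

/-- The facet vectors of `P`: the translation vectors to the cells adjacent to `P`. -/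
def facetVectors {d : ℕ} (P : Set (Euc d)) (T : Set (Set (Euc d))) : Set (Euc d) :=
  {p | p +ᵥ P ∈ T ∧ AdjacentCells P (p +ᵥ P)}

/-- The lattice of the tiling `T` by translates of `P`, encoded as the group generated by the
facet vectors. -/
def cellLattice {d : ℕ} (P : Set (Euc d)) (T : Set (Set (Euc d))) : AddSubgroup (Euc d) :=
  AddSubgroup.closure (facetVectors P T)

namespace IsParallelohedralTiling
variable {d : ℕ} {P : Set (Euc d)} {T : Set (Set (Euc d))} {C C' D D' F : Set (Euc d)}
  {p t v w : Euc d}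

theorem nonempty (hT : IsParallelohedralTiling P T) : P.Nonempty :=
  hT.polytope.2.mono interior_subset

theorem vadd_injective (hT : IsParallelohedralTiling P T) (h : v +ᵥ P = w +ᵥ P) : v = w :=
  eq_of_vadd_eq hT.polytope.isCompact.isBounded hT.nonempty h

theorem eq_vadd_of_inter_eq_vadd (hT : IsParallelohedralTiling P T) (hC : C ∈ T) (hC' : C' ∈ T)
    (hD : v +ᵥ C ∈ T) (hD' : D' ∈ T) (hadj : AdjacentCells C C')
    (hadj' : AdjacentCells (v +ᵥ C) D') (hF : (v +ᵥ C) ∩ D' = v +ᵥ (C ∩ C')) :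
    D' = v +ᵥ C' := by
  obtain ⟨n, hn⟩ := hT.exists_isNormalFromTo hC hC' (hT.ne_of_adjacentCells hC hadj)
  obtain ⟨w, rfl⟩ : ∃ w, D' = w +ᵥ C' := by
    obtain ⟨t, ht⟩ := hT.translate C' hC'
    obtain ⟨t', ht'⟩ := hT.translate D' hD'
    exact ⟨t' - t, by rw [ht, ht', vadd_vadd, sub_add_cancel]⟩
  have hnC' := hT.isFacetNormal_neg hC hC' hadj hn.isFacetNormal
  have hnD' := hT.isFacetNormal_neg hD hD' hadj' (hF ▸ hn.isFacetNormal.vadd v)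
  have hFw : w +ᵥ (C ∩ C') = v +ᵥ (C ∩ C') := (hnC'.vadd w).facet_eq (hT.isPolytope hD').2
    (hadj.2.vadd w) (hF ▸ hadj'.2) (hF ▸ hnD')
  rw [eq_of_vadd_eq ((hT.isPolytope hC).isCompact.isBounded.subset inter_subset_left)
    hadj.1.2.1 hFw]

theorem vadd_mem_of_adjacentCells (hT : IsParallelohedralTiling P T) (hC : C ∈ T) (hC' : C' ∈ T)
    (hadj : AdjacentCells C C') (hD : v +ᵥ C ∈ T) :
    v +ᵥ C' ∈ T ∧ AdjacentCells (v +ᵥ C) (v +ᵥ C') := by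
  obtain ⟨D', hD', hadj', hF⟩ := hT.exists_adjacentCells hD (hadj.1.vadd v)
  rw [← hT.eq_vadd_of_inter_eq_vadd hC hC' hD hD' hadj hadj' hF]
  exact ⟨hD', hadj'⟩

theorem add_vadd_mem (hT : IsParallelohedralTiling P T) (hp : p ∈ facetVectors P T)
    (ht : t +ᵥ P ∈ T) : (t + p) +ᵥ P ∈ T ∧ AdjacentCells (t +ᵥ P) ((t + p) +ᵥ P) := by
  rw [← vadd_vadd]
  exact hT.vadd_mem_of_adjacentCells hT.self_mem hp.1 hp.2 ht

theorem neg_mem_facetVectors (hT : IsParallelohedralTiling P T) (hp : p ∈ facetVectors P T) :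
    -p ∈ facetVectors P T := by
  have h := hT.vadd_mem_of_adjacentCells (v := -p) hp.1 hT.self_mem hp.2.symm
    (by rw [neg_vadd_vadd]; exact hT.self_mem)
  rwa [neg_vadd_vadd] at h

theorem exists_mem_facetVectors_of_adjacentCells (hT : IsParallelohedralTiling P T)
    (ht : t +ᵥ P ∈ T) (hC' : C' ∈ T) (hadj : AdjacentCells (t +ᵥ P) C') :
    ∃ p ∈ facetVectors P T, C' = (t + p) +ᵥ P := by
  have h := hT.vadd_mem_of_adjacentCells (v := -t) ht hC' hadj
    (by rw [neg_vadd_vadd]; exact hT.self_mem)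
  obtain ⟨p, hp⟩ := hT.translate _ h.1
  rw [neg_vadd_vadd, hp] at h
  exact ⟨p, h, by rw [← vadd_vadd, ← hp, vadd_neg_vadd]⟩

theorem exists_mem_facetVectors_of_facet (hT : IsParallelohedralTiling P T)
    (hF : IsFaceOfCodim 1 P F) : ∃ p ∈ facetVectors P T, P ∩ (p +ᵥ P) = F := by
  obtain ⟨C', hC', hadj, rfl⟩ := hT.exists_adjacentCells hT.self_mem hF
  obtain ⟨p, rfl⟩ := hT.translate C' hC'
  exact ⟨p, ⟨hC', hadj⟩, rfl⟩

theorem reflTransGen_adjacentIn_univ (hT : IsParallelohedralTiling P T) (hC : C ∈ T)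
    (hD : D ∈ T) : Relation.ReflTransGen (AdjacentIn T univ) C D :=
  hT.reflTransGen_adjacentIn isOpen_univ convex_univ hC hD
    (by simpa using (hT.isPolytope hC).2.mono interior_subset)
    (by simpa using (hT.isPolytope hD).2.mono interior_subset)

theorem cellLattice_le_stabilizer (hT : IsParallelohedralTiling P T) :
    cellLattice P T ≤ AddAction.stabilizer (Euc d) T := by
  have hsub : ∀ p ∈ facetVectors P T, p +ᵥ T ⊆ T := by
    rintro p hp _ ⟨C, hC, rfl⟩
    obtain ⟨t, rfl⟩ := hT.translate C hC
    simpa only [vadd_vadd, add_comm p t] using (hT.add_vadd_mem hp hC).1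
  refine (AddSubgroup.closure_le _).2 fun p hp => (hsub p hp).antisymm ?_
  rw [Set.subset_vadd_set_iff]
  exact hsub _ (hT.neg_mem_facetVectors hp)

theorem vadd_mem_iff (hT : IsParallelohedralTiling P T) (hv : v ∈ cellLattice P T)
    (C : Set (Euc d)) : v +ᵥ C ∈ T ↔ C ∈ T := by
  conv_lhs => rw [← AddAction.mem_stabilizer_iff.1 (hT.cellLattice_le_stabilizer hv)]
  exact vadd_mem_vadd_set_iff

theorem mem_cellLattice_iff (hT : IsParallelohedralTiling P T) :
    t ∈ cellLattice P T ↔ t +ᵥ P ∈ T := by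
  refine ⟨fun ht => (hT.vadd_mem_iff ht P).2 hT.self_mem, fun ht => ?_⟩
  have hgallery : ∀ D, Relation.ReflTransGen (AdjacentIn T univ) P D →
      ∃ v ∈ cellLattice P T, D = v +ᵥ P := by
    intro D hD
    induction hD with
    | refl => exact ⟨0, zero_mem _, (zero_vadd _ _).symm⟩
    | tail _ h ih =>
      obtain ⟨v, hv, rfl⟩ := ih
      obtain ⟨p, hp, rfl⟩ := hT.exists_mem_facetVectors_of_adjacentCells h.1 h.2.1 h.2.2.1
      exact ⟨v + p, add_mem hv (AddSubgroup.subset_closure hp), rfl⟩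
  obtain ⟨v, hv, h⟩ := hgallery _ (hT.reflTransGen_adjacentIn_univ hT.self_mem ht)
  rwa [hT.vadd_injective h]

theorem exists_cellLattice_of_mem (hT : IsParallelohedralTiling P T) (hC : C ∈ T) :
    ∃ v ∈ cellLattice P T, C = v +ᵥ P := by
  obtain ⟨v, rfl⟩ := hT.translate C hC
  exact ⟨v, hT.mem_cellLattice_iff.2 hC, rfl⟩

theorem exists_cellLattice_mem_vadd (hT : IsParallelohedralTiling P T) (x : Euc d) :
    ∃ v ∈ cellLattice P T, x ∈ v +ᵥ P := by
  obtain ⟨C, hC, hx⟩ := hT.cover x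
  obtain ⟨v, hv, rfl⟩ := hT.exists_cellLattice_of_mem hC
  exact ⟨v, hv, hx⟩

theorem exists_cellLattice_tendsto (hT : IsParallelohedralTiling P T) (x : Euc d) :
    ∃ v : ℕ → Euc d, (∀ m, v m ∈ cellLattice P T) ∧
      Tendsto (fun m : ℕ => (m : ℝ)⁻¹ • v m) atTop (𝓝 x) := by
  choose v hv r hr hvr using fun m : ℕ => hT.exists_cellLattice_mem_vadd ((m : ℝ) • x)
  obtain ⟨R, hR⟩ := hT.polytope.isCompact.isBounded.exists_norm_le
  refine ⟨v, hv, tendsto_iff_norm_sub_tendsto_zero.2 ?_⟩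
  refine squeeze_zero' (.of_forall fun _ => norm_nonneg _) (g := fun m : ℕ => (m : ℝ)⁻¹ * R) ?_
    (by simpa using (tendsto_inv_atTop_nhds_zero_nat (𝕜 := ℝ)).mul_const R)
  filter_upwards [eventually_ne_atTop 0] with m hm
  have hsub : (m : ℝ)⁻¹ • v m - x = -((m : ℝ)⁻¹ • r m) := by
    rw [sub_eq_iff_eq_add, neg_add_eq_sub, eq_sub_iff_add_eq, ← smul_add,
      show v m + r m = (m : ℝ) • x from hvr m, inv_smul_smul₀ (Nat.cast_ne_zero.2 hm)]
  rw [hsub, norm_neg, norm_smul, norm_inv, Real.norm_natCast]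
  exact mul_le_mul_of_nonneg_left (hR _ (hr m)) (by positivity)

theorem span_facetVectors (hT : IsParallelohedralTiling P T) :
    Submodule.span ℝ (facetVectors P T) = ⊤ := by
  have hle : ∀ v ∈ cellLattice P T, v ∈ Submodule.span ℝ (facetVectors P T) :=
    (AddSubgroup.closure_le (Submodule.span ℝ (facetVectors P T)).toAddSubgroup).2
      Submodule.subset_span
  refine eq_top_iff.2 fun x _ => ?_
  obtain ⟨v, hv, hlim⟩ := hT.exists_cellLattice_tendsto x
  exact (Submodule.closed_of_finiteDimensional _).mem_of_tendsto hlim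
    (.of_forall fun m => Submodule.smul_mem _ _ (hle _ (hv m)))

theorem ext_facetVectors (hT : IsParallelohedralTiling P T) {F : Type*} [AddCommGroup F]
    [Module ℝ F] {f g : Euc d →ₗ[ℝ] F} (h : ∀ p ∈ facetVectors P T, f p = g p) : f = g :=
  LinearMap.ext_on hT.span_facetVectors h

theorem discreteTopology_cellLattice (hT : IsParallelohedralTiling P T) :
    DiscreteTopology (cellLattice P T) := by
  obtain ⟨x, hx⟩ := hT.polytope.2
  obtain ⟨r, hr, hball⟩ := Metric.isOpen_iff.1 isOpen_interior x hx
  rw [discreteTopology_iff_isOpen_singleton_zero, Metric.isOpen_iff]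
  rintro _ rfl
  refine ⟨r, hr, fun v hv => Subtype.ext (hT.vadd_injective ?_)⟩
  have hvx : (v : Euc d) + x ∈ interior P :=
    hball (by simpa [dist_eq_norm] using mem_ball_zero_iff.1 hv)
  rw [ZeroMemClass.coe_zero, zero_vadd]
  exact (hT.eq_of_mem_interior hT.self_mem (hT.mem_cellLattice_iff.1 v.2) hvx
    ⟨x, interior_subset hx, rfl⟩).symm

theorem exists_basis_span_eq_cellLattice (hT : IsParallelohedralTiling P T) :
    ∃ b : Module.Basis (Fin d) ℝ (Euc d),
      Submodule.span ℤ (Set.range b) = (cellLattice P T).toIntSubmodule := by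
  have : DiscreteTopology (cellLattice P T).toIntSubmodule := hT.discreteTopology_cellLattice
  have : IsZLattice ℝ (cellLattice P T).toIntSubmodule :=
    ⟨eq_top_iff.2 (hT.span_facetVectors.ge.trans (Submodule.span_mono AddSubgroup.subset_closure))⟩
  have := ZLattice.module_free ℝ (cellLattice P T).toIntSubmodule
  have := ZLattice.module_finite ℝ (cellLattice P T).toIntSubmodule
  let b := Module.finBasisOfFinrankEq ℤ (cellLattice P T).toIntSubmodule
    ((ZLattice.rank ℝ _).trans finrank_euclideanSpace_fin)
  exact ⟨b.ofZLatticeBasis ℝ _, b.ofZLatticeBasis_span ℝ⟩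

end IsParallelohedralTiling

/-! ### The generatrix -/

/-- `u` lifts all cells of `T`, `P` by the zero function, with the jumps prescribed by `s`. -/
structure IsLifting {d : ℕ} (P : Set (Euc d)) (T : Set (Set (Euc d))) (s : Set (Euc d) → ℝ)
    (u : Set (Euc d) → Euc d × ℝ) : Prop where
  map_self : u P = 0
  hasJump : ∀ C ∈ T, ∀ C' ∈ T, AdjacentCells C C' → HasJump s u C C'

/-- The affine function `y ↦ ⟪g, y⟫ + a` encoded by the pair `(g, a)`. -/
noncomputable def pairFunction {d : ℕ} (w : Euc d × ℝ) : Euc d →ᵃ[ℝ] ℝ :=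
  (innerₛₗ ℝ w.1).toAffineMap + AffineMap.const ℝ _ w.2

theorem pairFunction_apply {d : ℕ} (w : Euc d × ℝ) (x : Euc d) :
    pairFunction w x = ⟪w.1, x⟫ + w.2 :=
  rfl

theorem continuous_pairFunction {d : ℕ} (w : Euc d × ℝ) : Continuous (pairFunction w) :=
  (pairFunction w).continuous_of_finiteDimensional

theorem HasJump.pairFunction_sub {d : ℕ} {s : Set (Euc d) → ℝ} {u : Set (Euc d) → Euc d × ℝ}
    {C C' : Set (Euc d)} {n f : Euc d} (h : HasJump s u C C') (hn : IsNormalFromTo C C' n)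
    (hf : f ∈ C ∩ C') (x : Euc d) :
    pairFunction (u C') x - pairFunction (u C) x = s (C ∩ C') * (⟪n, x⟫ - ⟪n, f⟫) := by
  have hsub := h n hn f hf
  have hfst := congrArg (fun w => ⟪w.1, x⟫) hsub
  have hsnd := congrArg Prod.snd hsub
  simp only [Prod.fst_sub, Prod.snd_sub, Prod.smul_mk, inner_sub_left, real_inner_smul_left,
    smul_eq_mul] at hfst hsnd
  rw [pairFunction_apply, pairFunction_apply]
  linear_combination hfst + hsnd

namespace IsLifting
variable {d : ℕ} {P : Set (Euc d)} {T : Set (Set (Euc d))} {s : Set (Euc d) → ℝ}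
  {u : Set (Euc d) → Euc d × ℝ} {C D : Set (Euc d)} {x y g : Euc d} {a : ℝ}

theorem exists_pairFunction_lt (hu : IsLifting P T s u) (hT : IsParallelohedralTiling P T)
    (hs : IsCanonicalScaling T s) (hC : C ∈ T) (hy : y ∈ C) (hx : x ∉ C) :
    ∃ C' ∈ T, (C' ∩ segment ℝ y x).Nonempty ∧
      pairFunction (u C) x < pairFunction (u C') x := by
  obtain ⟨z, hz, F, n, hzF, hF, hn, hlt⟩ := (hT.isPolytope hC).exists_facet_on_segment hy hx
  obtain ⟨C', hC', hadj, rfl⟩ := hT.exists_adjacentCells hC hF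
  refine ⟨C', hC', ⟨z, hzF.2, hz⟩, sub_pos.1 ?_⟩
  rw [(hu.hasJump C hC C' hC' hadj).pairFunction_sub
    ((hT.isNormalFromTo_iff hC hC' hadj).2 hn) hzF x]
  exact mul_pos (hs.1 _ ⟨C, hC, hF⟩) (sub_pos.2 hlt)

theorem pairFunction_le_of_mem_interior (hu : IsLifting P T s u)
    (hT : IsParallelohedralTiling P T) (hs : IsCanonicalScaling T s) (hC : C ∈ T) (hD : D ∈ T)
    (hx : x ∈ interior D) : pairFunction (u C) x ≤ pairFunction (u D) x := by
  obtain ⟨y, hy⟩ := (hT.isPolytope hC).2.mono interior_subset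
  have hbdd : Bornology.IsBounded (segment ℝ y x) := by
    rw [← convexHull_pair]
    exact ((toFinite {y, x}).isCompact_convexHull ℝ).isBounded
  have hyx := left_mem_segment ℝ y x
  -- Among the finitely many cells that meet the segment, one has the greatest value at `x`.
  obtain ⟨E, ⟨hE, z, hzE, hz⟩, hmax⟩ := exists_max_image _ (fun E => pairFunction (u E) x)
    (hT.finite_meeting hbdd) ⟨C, hC, y, hy, hyx⟩
  have hxE : x ∈ E := by
    by_contra hxE
    obtain ⟨E', hE', ⟨w, hwE', hw⟩, hlt⟩ := hu.exists_pairFunction_lt hT hs hE hzE hxE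
    have hw' := (convex_segment y x).segment_subset hz (right_mem_segment ℝ y x) hw
    exact hlt.not_ge (hmax E' ⟨hE', w, hwE', hw'⟩)
  rw [hT.eq_of_mem_interior hD hE hx hxE]
  exact hmax C ⟨hC, y, hy, hyx⟩

theorem pairFunction_le (hu : IsLifting P T s u) (hT : IsParallelohedralTiling P T)
    (hs : IsCanonicalScaling T s) (hC : C ∈ T) (hD : D ∈ T) (hx : x ∈ D) :
    pairFunction (u C) x ≤ pairFunction (u D) x := by
  rw [← (hT.isPolytope hD).closure_interior] at hx
  exact closure_minimal
    (s := interior D) (t := {x | pairFunction (u C) x ≤ pairFunction (u D) x})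
    (fun _ => hu.pairFunction_le_of_mem_interior hT hs hC hD)
    (isClosed_le (continuous_pairFunction _) (continuous_pairFunction _)) hx

theorem mem_iff_pairFunction_le (hu : IsLifting P T s u) (hT : IsParallelohedralTiling P T)
    (hs : IsCanonicalScaling T s) (hD : D ∈ T) :
    x ∈ D ↔ ∀ C ∈ T, pairFunction (u C) x ≤ pairFunction (u D) x := by
  refine ⟨fun hx C hC => hu.pairFunction_le hT hs hC hD hx, fun h => ?_⟩
  by_contra hx
  obtain ⟨y, hy⟩ := (hT.isPolytope hD).2.mono interior_subset
  obtain ⟨C, hC, -, hlt⟩ := hu.exists_pairFunction_lt hT hs hD hy hx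
  exact (h C hC).not_gt hlt

theorem eq_of_pairFunction_eq (hu : IsLifting P T s u) (hT : IsParallelohedralTiling P T)
    (hs : IsCanonicalScaling T s) (hC : C ∈ T) (hD : D ∈ T)
    (h : pairFunction (u C) = pairFunction (u D)) : C = D := by
  ext x
  rw [hu.mem_iff_pairFunction_le hT hs hC, hu.mem_iff_pairFunction_le hT hs hD, h]

theorem pairFunction_eq (hu : IsLifting P T s u) (hT : IsParallelohedralTiling P T)
    (hs : IsCanonicalScaling T s) (hC : C ∈ T) (hD : D ∈ T) (hxC : x ∈ C) (hxD : x ∈ D) :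
    pairFunction (u C) x = pairFunction (u D) x :=
  (hu.pairFunction_le hT hs hC hD hxD).antisymm (hu.pairFunction_le hT hs hD hC hxC)

theorem eq_of_isChainLift (hu : IsLifting P T s u) (hT : IsParallelohedralTiling P T)
    (h : IsChainLift T s P C g a) : C ∈ T ∧ u C = (g, a) := by
  induction h with
  | start => exact ⟨hT.self_mem, hu.map_self⟩
  | step C C' g n a a' _ hC' hadj hn himg ih =>
    obtain ⟨hC, huC⟩ := ih
    refine ⟨hC', ?_⟩
    obtain ⟨x, hx⟩ := hadj.1.2.1
    obtain ⟨⟨x, y⟩, ⟨⟨-, hy⟩, -, hy'⟩, rfl⟩ := himg.ge hx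
    have hjump := hu.hasJump C hC C' hC' hadj n hn x hx
    rw [sub_eq_iff_eq_add', huC] at hjump
    rw [hjump, Prod.smul_mk, Prod.mk_add_mk, Prod.mk.injEq]
    simp only [inner_add_left, real_inner_smul_left] at hy hy'
    refine ⟨rfl, ?_⟩
    rw [smul_eq_mul]
    linarith

theorem isChainLift (hu : IsLifting P T s u) (hT : IsParallelohedralTiling P T)
    (hs : IsCanonicalScaling T s) (hC : C ∈ T) : IsChainLift T s P C (u C).1 (u C).2 := by
  have hgallery := hT.reflTransGen_adjacentIn_univ hT.self_mem hC
  clear hC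
  induction hgallery with
  | refl =>
    rw [hu.map_self]
    exact IsChainLift.start
  | @tail C C' _ h ih =>
    obtain ⟨hC, hC', hadj, -⟩ := h
    obtain ⟨n, hn⟩ := hT.exists_isNormalFromTo hC hC' (hT.ne_of_adjacentCells hC hadj)
    obtain ⟨f, hf⟩ := hadj.1.2.1
    have hfst : (u C').1 = (u C).1 + s (C ∩ C') • n :=
      sub_eq_iff_eq_add'.1 (congrArg Prod.fst (hu.hasJump C hC C' hC' hadj n hn f hf))
    rw [hfst]
    refine ih.step C C' _ n _ _ hC' hadj hn (Subset.antisymm ?_ fun x hx => ?_)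
    · rintro _ ⟨z, ⟨⟨hz, -⟩, hz', -⟩, rfl⟩
      exact ⟨hz, hz'⟩
    · refine ⟨(x, pairFunction (u C) x), ⟨⟨hx.1, rfl⟩, hx.2, ?_⟩, rfl⟩
      rw [hu.pairFunction_eq hT hs hC hC' hx.1 hx.2, ← hfst, pairFunction_apply]

theorem mem_generatrixSurface_iff (hu : IsLifting P T s u) (hT : IsParallelohedralTiling P T)
    (hs : IsCanonicalScaling T s) {z : Euc d × ℝ} (hC : C ∈ T) (hz : z.1 ∈ C) :
    z ∈ generatrixSurface T s P ↔ z.2 = pairFunction (u C) z.1 := by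
  refine ⟨?_, fun h => ⟨C, _, _, hu.isChainLift hT hs hC, hz, h⟩⟩
  rintro ⟨D, g, a, hD, hzD⟩
  obtain ⟨hDT, huD⟩ := hu.eq_of_isChainLift hT hD
  rw [← hu.pairFunction_eq hT hs hDT hC hzD.1 hz, pairFunction_apply, huD]
  exact hzD.2

theorem exists_continuous (hu : IsLifting P T s u) (hT : IsParallelohedralTiling P T)
    (hs : IsCanonicalScaling T s) :
    ∃ f : Euc d → ℝ, Continuous f ∧ ∀ C ∈ T, EqOn f (pairFunction (u C)) C := by
  choose K hK hmem using hT.cover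
  have heq : ∀ C ∈ T, EqOn (fun x => pairFunction (u (K x)) x) (pairFunction (u C)) C :=
    fun C hC x hx => hu.pairFunction_eq hT hs (hK x) hC (hmem x) hx
  refine ⟨_, ?_, heq⟩
  have hlf : LocallyFinite fun C : T => (C : Set (Euc d)) := fun x =>
    ⟨Metric.ball x 1, Metric.ball_mem_nhds x one_pos,
      ((hT.finite_meeting Metric.isBounded_ball).preimage
        Subtype.val_injective.injOn).subset fun C hC => ⟨C.2, hC⟩⟩
  exact hlf.continuous (eq_univ_of_forall fun x => mem_iUnion.2 ⟨⟨K x, hK x⟩, hmem x⟩)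
    (fun C => (hT.isPolytope C.2).isClosed)
    fun C => (continuous_pairFunction (u C)).continuousOn.congr (heq C C.2)

theorem isGeneratrix (hu : IsLifting P T s u) (hT : IsParallelohedralTiling P T)
    (hs : IsCanonicalScaling T s) : IsGeneratrix T (generatrixSurface T s P) := by
  obtain ⟨f, hf, hfC⟩ := hu.exists_continuous hT hs
  refine ⟨f, hf, ?_, fun C hC => ⟨_, hfC C hC⟩, ?_⟩
  · ext z
    obtain ⟨C, hC, hz⟩ := hT.cover z.1
    rw [hu.mem_generatrixSurface_iff hT hs hC hz, ← hfC C hC hz]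
    rfl
  · rintro C hC C' hC' hne ⟨l, hl⟩
    have hunique : ∀ D ∈ T, D ⊆ C ∪ C' → pairFunction (u D) = l := fun D hD hsub =>
      AffineMap.ext_on (affineSpan_eq_top_of_interior_nonempty (hT.isPolytope hD).2) fun x hx =>
        (hfC D hD hx).symm.trans (hl (hsub hx))
    exact hne (hu.eq_of_pairFunction_eq hT hs hC hC'
      ((hunique C hC subset_union_left).trans (hunique C' hC' subset_union_right).symm))

end IsLifting

section Image
variable {d : ℕ} {T : Set (Set (Euc d))} {S : Set (Euc d × ℝ)}

theorem mem_image_sub_iff (A : Euc d ≃ₗ[ℝ] Euc d) (c y : Euc d) (C : Set (Euc d)) :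
    y ∈ (fun x => A (x - c)) '' C ↔ A.symm y + c ∈ C :=
  ⟨by rintro ⟨x, hx, rfl⟩; simpa using hx, fun hy => ⟨_, hy, by simp⟩⟩

theorem mem_imageSurface_iff (A : Euc d ≃ₗ[ℝ] Euc d) (c : Euc d) (z : Euc d × ℝ) :
    z ∈ imageSurface A c S ↔ (A.symm z.1 + c, z.2) ∈ S :=
  ⟨by rintro ⟨x, hx, rfl⟩; simpa using hx, fun hz => ⟨_, hz, by simp⟩⟩

theorem IsGeneratrix.image (h : IsGeneratrix T S) (A : Euc d ≃ₗ[ℝ] Euc d) (c : Euc d) :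
    IsGeneratrix (imageTiling A c T) (imageSurface A c S) := by
  obtain ⟨f, hf, rfl, haff, hne⟩ := h
  have hA : Continuous A.symm := A.symm.toLinearMap.continuous_of_finiteDimensional
  refine ⟨fun y => f (A.symm y + c), by fun_prop, ?_, ?_, ?_⟩
  · ext z
    exact mem_imageSurface_iff A c z
  · rintro _ ⟨C, hC, rfl⟩
    obtain ⟨l, hl⟩ := haff C hC
    refine ⟨l.comp (A.symm.toLinearMap.toAffineMap + AffineMap.const ℝ (Euc d) c),
      fun y hy => ?_⟩
    exact hl ((mem_image_sub_iff A c y C).1 hy)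
  · rintro _ ⟨C, hC, rfl⟩ _ ⟨C', hC', rfl⟩ hCC' ⟨l, hl⟩
    refine hne C hC C' hC' (by rintro rfl; exact hCC' rfl)
      ⟨l.comp (A.toLinearMap.toAffineMap.comp (AffineMap.id ℝ _ - AffineMap.const ℝ _ c)),
        fun x hx => ?_⟩
    rw [← image_union] at hl
    simpa using hl ⟨x, hx, rfl⟩

end Image

/-! ### The quadratic form -/

section LinearExtension

theorem map_add_of_mem_closure {E F : Type*} [AddCommGroup E] [AddCommGroup F] {D : Set E}
    {f : E → F} (h0 : f 0 = 0) (h : ∀ x ∈ AddSubgroup.closure D, ∀ p ∈ D, f (x + p) = f x + f p)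
    {x y : E} (hx : x ∈ AddSubgroup.closure D) (hy : y ∈ AddSubgroup.closure D) :
    f (x + y) = f x + f y := by
  induction hy using AddSubgroup.closure_induction generalizing x with
  | mem p hp => exact h x hx p hp
  | zero => rw [add_zero, h0, add_zero]
  | add a b ha _ iha ihb =>
    rw [← add_assoc, ihb (add_mem hx ha), iha hx, ihb ha, add_assoc]
  | neg a ha iha =>
    have hxa := iha (add_mem hx (neg_mem ha))
    have hneg := iha (neg_mem ha)
    rw [neg_add_cancel_right] at hxa
    rw [neg_add_cancel, h0] at hneg
    rw [hxa, add_assoc, add_comm (f a), ← hneg, add_zero]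

theorem exists_linearMap_eq_on_closure {ι E F : Type*} [AddCommGroup E] [Module ℝ E]
    [AddCommGroup F] [Module ℝ F] (b : Module.Basis ι ℝ E) {D : Set E}
    (hb : Submodule.span ℤ (range b) = (AddSubgroup.closure D).toIntSubmodule) {f : E → F}
    (h0 : f 0 = 0) (h : ∀ x ∈ AddSubgroup.closure D, ∀ p ∈ D, f (x + p) = f x + f p) :
    ∃ L : E →ₗ[ℝ] F, ∀ x ∈ AddSubgroup.closure D, L x = f x := by
  have hmem : ∀ x, x ∈ Submodule.span ℤ (range b) ↔ x ∈ AddSubgroup.closure D := fun x => by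
    rw [hb]
    rfl
  let g : Submodule.span ℤ (range b) →+ F :=
    { toFun := fun x => f x
      map_zero' := h0
      map_add' := fun x y =>
        map_add_of_mem_closure h0 h ((hmem x).1 x.2) ((hmem y).1 y.2) }
  let L := b.constr ℝ fun i => f (b i)
  have hL : L.restrictScalars ℤ ∘ₗ (Submodule.span ℤ (range b)).subtype = g.toIntLinearMap := by
    refine (b.restrictScalars ℤ).ext fun i => ?_
    change L (b.restrictScalars ℤ i : E) = f (b.restrictScalars ℤ i)
    rw [b.restrictScalars_apply ℤ]
    exact b.constr_basis ℝ _ i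
  exact ⟨L, fun x hx => LinearMap.congr_fun hL ⟨x, (hmem x).2 hx⟩⟩

theorem isSymmetric_of_span_eq_top {E : Type*} [NormedAddCommGroup E] [InnerProductSpace ℝ E]
    {D : Set E} (hD : Submodule.span ℝ D = ⊤) {L : E →ₗ[ℝ] E}
    (h : ∀ p ∈ D, ∀ q ∈ D, ⟪L p, q⟫ = ⟪p, L q⟫) : L.IsSymmetric := by
  have heq : (innerₗ E).comp L = (innerₗ E).compl₂ L :=
    LinearMap.ext_on hD fun p hp => LinearMap.ext_on hD fun q hq => h p hp q hq
  exact fun x y => LinearMap.congr_fun (LinearMap.congr_fun heq x) y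

end LinearExtension

theorem IsParallelohedralTiling.eq_zero_of_inner_normal_eq_zero {d : ℕ} {P : Set (Euc d)}
    {T : Set (Set (Euc d))} (hT : IsParallelohedralTiling P T) {v : Euc d}
    (h : ∀ p ∈ facetVectors P T, ∀ n, IsNormalFromTo P (p +ᵥ P) n → ⟪n, v⟫ = 0) : v = 0 := by
  refine eq_zero_of_vadd_subset hT.polytope.isCompact.isBounded hT.nonempty ?_
  rintro _ ⟨y, hy, rfl⟩
  by_contra hvy
  obtain ⟨F, n, hF, hn, hlt⟩ := hT.polytope.exists_facet_of_notMem hvy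
  obtain ⟨p, hp, rfl⟩ := hT.exists_mem_facetVectors_of_facet hF
  obtain ⟨f, hf⟩ := hF.2.1
  have horth := h p hp n ((hT.isNormalFromTo_iff hT.self_mem hp.1 hp.2).2 hn)
  have hfy := hlt f hf
  simp only [vadd_eq_add, inner_add_right, horth, zero_add] at hfy
  exact hfy.not_ge (hn.le f hf y hy)

namespace IsLifting
variable {d : ℕ} {P : Set (Euc d)} {T : Set (Set (Euc d))} {s : Set (Euc d) → ℝ}
  {u : Set (Euc d) → Euc d × ℝ} {L : Euc d →ₗ[ℝ] Euc d} {v p n f : Euc d}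

theorem apply_facetVector (hu : IsLifting P T s u) (hT : IsParallelohedralTiling P T)
    (hp : p ∈ facetVectors P T) (hn : IsNormalFromTo P (p +ᵥ P) n) (hf : f ∈ P ∩ (p +ᵥ P)) :
    u (p +ᵥ P) = s (P ∩ (p +ᵥ P)) • (n, -⟪n, f⟫) := by
  rw [← hu.hasJump P hT.self_mem _ hp.1 hp.2 n hn f hf, hu.map_self, sub_zero]

theorem apply_add_vadd (hu : IsLifting P T s u) (hT : IsParallelohedralTiling P T)
    (hinv : IsTranslationInvariant T s) (hv : v ∈ cellLattice P T) (hp : p ∈ facetVectors P T) :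
    u ((v + p) +ᵥ P) =
      u (v +ᵥ P) + ((u (p +ᵥ P)).1, (u (p +ᵥ P)).2 - ⟪(u (p +ᵥ P)).1, v⟫) := by
  have hvT := hT.mem_cellLattice_iff.1 hv
  obtain ⟨hvpT, hadj⟩ := hT.add_vadd_mem hp hvT
  obtain ⟨n, hn⟩ :=
    hT.exists_isNormalFromTo hT.self_mem hp.1 (hT.ne_of_adjacentCells hT.self_mem hp.2)
  obtain ⟨f, hf⟩ := hp.2.1.2.1
  have hinter : (v +ᵥ P) ∩ ((v + p) +ᵥ P) = v +ᵥ (P ∩ (p +ᵥ P)) := by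
    rw [vadd_set_inter, vadd_vadd]
  have hjump := hu.hasJump _ hvT _ hvpT hadj n (by simpa only [vadd_vadd] using hn.vadd v)
    (v +ᵥ f) (hinter ▸ vadd_mem_vadd_set hf)
  rw [hinter, hinv v (hT.vadd_mem_iff hv) _ ⟨P, hT.self_mem, hp.2.1⟩, sub_eq_iff_eq_add'] at hjump
  rw [hjump, hu.apply_facetVector hT hp hn hf]
  simp only [Prod.smul_mk, vadd_eq_add, inner_add_right, real_inner_smul_left, smul_eq_mul]
  congr 2
  ring

theorem exists_linearMap_fst_eq (hu : IsLifting P T s u) (hT : IsParallelohedralTiling P T)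
    (hinv : IsTranslationInvariant T s) :
    ∃ L : Euc d →ₗ[ℝ] Euc d, ∀ v ∈ cellLattice P T, L v = (u (v +ᵥ P)).1 := by
  obtain ⟨b, hb⟩ := hT.exists_basis_span_eq_cellLattice
  exact exists_linearMap_eq_on_closure b hb (by simp [hu.map_self])
    fun v hv p hp => by rw [hu.apply_add_vadd hT hinv hv hp]; rfl

theorem snd_add_vadd (hu : IsLifting P T s u) (hT : IsParallelohedralTiling P T)
    (hinv : IsTranslationInvariant T s) (hL : ∀ v ∈ cellLattice P T, L v = (u (v +ᵥ P)).1)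
    (hv : v ∈ cellLattice P T) (hp : p ∈ facetVectors P T) :
    (u ((v + p) +ᵥ P)).2 = (u (v +ᵥ P)).2 + ((u (p +ᵥ P)).2 - ⟪L p, v⟫) := by
  rw [hu.apply_add_vadd hT hinv hv hp, hL p (AddSubgroup.subset_closure hp)]
  rfl

theorem isSymmetric (hu : IsLifting P T s u) (hT : IsParallelohedralTiling P T)
    (hinv : IsTranslationInvariant T s) (hL : ∀ v ∈ cellLattice P T, L v = (u (v +ᵥ P)).1) :
    L.IsSymmetric := by
  refine isSymmetric_of_span_eq_top hT.span_facetVectors fun p hp q hq => ?_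
  -- The heights of the lift of `p + q + P` computed through `p + P` and through `q + P` agree.
  have hpq := hu.snd_add_vadd hT hinv hL (AddSubgroup.subset_closure hp) hq
  have hqp := hu.snd_add_vadd hT hinv hL (AddSubgroup.subset_closure hq) hp
  rw [add_comm q p] at hqp
  rw [real_inner_comm (L q)]
  linarith

theorem injective (hu : IsLifting P T s u) (hT : IsParallelohedralTiling P T)
    (hs : IsCanonicalScaling T s) (hsymm : L.IsSymmetric)
    (hL : ∀ v ∈ cellLattice P T, L v = (u (v +ᵥ P)).1) : Function.Injective L := by
  refine (injective_iff_map_eq_zero L).2 fun v hv => ?_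
  refine hT.eq_zero_of_inner_normal_eq_zero fun p hp n hn => ?_
  obtain ⟨f, hf⟩ := hp.2.1.2.1
  have hinner := hsymm p v
  rw [hv, inner_zero_right, hL p (AddSubgroup.subset_closure hp),
    hu.apply_facetVector hT hp hn hf, Prod.smul_mk, real_inner_smul_left] at hinner
  exact (mul_eq_zero.1 hinner).resolve_left (hs.1 _ ⟨P, hT.self_mem, hp.2.1⟩).ne'

theorem exists_linearMap_snd_eq (hu : IsLifting P T s u) (hT : IsParallelohedralTiling P T)
    (hinv : IsTranslationInvariant T s) (hsymm : L.IsSymmetric)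
    (hL : ∀ v ∈ cellLattice P T, L v = (u (v +ᵥ P)).1) :
    ∃ B : Euc d →ₗ[ℝ] ℝ, ∀ v ∈ cellLattice P T, B v = (u (v +ᵥ P)).2 + ⟪L v, v⟫ / 2 := by
  obtain ⟨b, hb⟩ := hT.exists_basis_span_eq_cellLattice
  refine exists_linearMap_eq_on_closure b hb (by simp [hu.map_self]) fun v hv p hp => ?_
  rw [hu.snd_add_vadd hT hinv hL hv hp, map_add, inner_add_left, inner_add_right,
    inner_add_right, hsymm v p, real_inner_comm (L p)]
  ring

end IsLifting

/-- The affine functions of the lifting `u` are given on the translates of `P` by a nondegenerate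
symmetric operator `L` and a point `c`, which is going to be the centre of `P`. -/
structure IsQuadraticLift {d : ℕ} (P : Set (Euc d)) (T : Set (Set (Euc d)))
    (s : Set (Euc d) → ℝ) (u : Set (Euc d) → Euc d × ℝ) (L : Euc d →ₗ[ℝ] Euc d) (c : Euc d) :
    Prop where
  tiling : IsParallelohedralTiling P T
  scaling : IsCanonicalScaling T s
  lifting : IsLifting P T s u
  symm : L.IsSymmetric
  injective : Function.Injective L
  map_vadd : ∀ v ∈ cellLattice P T, u (v +ᵥ P) = (L v, -⟪L v, c⟫ - ⟪L v, v⟫ / 2)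

theorem IsCanonicalScaling.exists_isQuadraticLift {d : ℕ} {P : Set (Euc d)}
    {T : Set (Set (Euc d))} {s : Set (Euc d) → ℝ} (hs : IsCanonicalScaling T s)
    (hT : IsParallelohedralTiling P T) (hinv : IsTranslationInvariant T s) :
    ∃ u L c, IsQuadraticLift P T s u L c := by
  obtain ⟨u, hself, hjump⟩ := hs.exists_lifting hT
  have hu : IsLifting P T s u := ⟨hself, hjump⟩
  obtain ⟨L, hL⟩ := hu.exists_linearMap_fst_eq hT hinv
  have hsymm := hu.isSymmetric hT hinv hL
  have hinj := hu.injective hT hs hsymm hL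
  obtain ⟨B, hB⟩ := hu.exists_linearMap_snd_eq hT hinv hsymm hL
  obtain ⟨c, hc⟩ := (LinearMap.injective_iff_surjective.1 hinj)
    ((InnerProductSpace.toDual ℝ (Euc d)).symm B.toContinuousLinearMap)
  refine ⟨u, L, -c, hT, hs, hu, hsymm, hinj, fun v hv => Prod.ext (hL v hv).symm ?_⟩
  have hBv : B v = ⟪L v, c⟫ := by
    rw [hsymm, hc, real_inner_comm, InnerProductSpace.toDual_symm_apply]
    rfl
  rw [inner_neg_right, neg_neg, ← hBv, hB v hv, add_sub_cancel_right]

namespace IsQuadraticLift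
variable {d : ℕ} {P : Set (Euc d)} {T : Set (Set (Euc d))} {s : Set (Euc d) → ℝ}
  {u : Set (Euc d) → Euc d × ℝ} {L : Euc d →ₗ[ℝ] Euc d} {c v p n : Euc d}

theorem map_facetVector (h : IsQuadraticLift P T s u L c) (hp : p ∈ facetVectors P T)
    (hn : IsNormalFromTo P (p +ᵥ P) n) : L p = s (P ∩ (p +ᵥ P)) • n := by
  obtain ⟨f, hf⟩ := hp.2.1.2.1
  exact congrArg Prod.fst ((h.map_vadd p (AddSubgroup.subset_closure hp)).symm.trans
    (h.lifting.apply_facetVector h.tiling hp hn hf))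

theorem pairFunction_vadd (h : IsQuadraticLift P T s u L c) (hv : v ∈ cellLattice P T)
    (x : Euc d) : pairFunction (u (v +ᵥ P)) x = ⟪L v, x - c⟫ - ⟪L v, v⟫ / 2 := by
  rw [h.map_vadd v hv, pairFunction_apply, inner_sub_right]
  ring

theorem mem_vadd_iff (h : IsQuadraticLift P T s u L c) (hv : v ∈ cellLattice P T) (x : Euc d) :
    x ∈ v +ᵥ P ↔ ∀ w ∈ cellLattice P T,
      ⟪L w, x - c⟫ - ⟪L w, w⟫ / 2 ≤ ⟪L v, x - c⟫ - ⟪L v, v⟫ / 2 := by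
  rw [h.lifting.mem_iff_pairFunction_le h.tiling h.scaling (h.tiling.mem_cellLattice_iff.1 hv),
    ← h.pairFunction_vadd hv]
  constructor
  · intro hle w hw
    rw [← h.pairFunction_vadd hw]
    exact hle _ (h.tiling.mem_cellLattice_iff.1 hw)
  · intro hle C hC
    obtain ⟨w, hw, rfl⟩ := h.tiling.exists_cellLattice_of_mem hC
    rw [h.pairFunction_vadd hw]
    exact hle w hw

theorem mem_self_iff (h : IsQuadraticLift P T s u L c) (x : Euc d) :
    x ∈ P ↔ ∀ w ∈ cellLattice P T, ⟪L w, x - c⟫ ≤ ⟪L w, w⟫ / 2 := by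
  simpa using h.mem_vadd_iff (zero_mem _) x

theorem isCentre (h : IsQuadraticLift P T s u L c) : IsCentre c P := by
  intro x hx
  rw [h.mem_self_iff] at hx ⊢
  intro w hw
  have hneg : (2 : ℝ) • c - x - c = -(x - c) := by module
  simpa only [hneg, map_neg, inner_neg_left, inner_neg_right, neg_neg] using hx (-w) (neg_mem hw)

theorem centre_mem (h : IsQuadraticLift P T s u L c) : c ∈ P := by
  obtain ⟨x, hx⟩ := h.tiling.nonempty
  convert h.tiling.polytope.convex.midpoint_mem hx (h.isCentre x hx)
  rw [midpoint_eq_smul_add, add_sub_cancel, invOf_smul_smul]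

theorem inner_nonneg (h : IsQuadraticLift P T s u L c) (x : Euc d) : 0 ≤ ⟪L x, x⟫ := by
  have hlattice : ∀ v ∈ cellLattice P T, 0 ≤ ⟪L v, v⟫ := by
    intro v hv
    have hc := (h.mem_self_iff c).1 h.centre_mem v hv
    rw [sub_self, inner_zero_right] at hc
    linarith
  obtain ⟨v, hv, hlim⟩ := h.tiling.exists_cellLattice_tendsto x
  have hcont : Continuous fun x => ⟪L x, x⟫ :=
    L.continuous_of_finiteDimensional.inner continuous_id
  refine ge_of_tendsto' ((hcont.tendsto x).comp hlim) fun m => ?_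
  rw [Function.comp_apply, map_smul, real_inner_smul_left, real_inner_smul_right]
  have := hlattice _ (hv m)
  positivity

end IsQuadraticLift

/-! ### Voronoi cells and the paraboloid -/

theorem IsCentre.eq {d : ℕ} {p q : Euc d} {K : Set (Euc d)} (hK : Bornology.IsBounded K)
    (hne : K.Nonempty) (hp : IsCentre p K) (hq : IsCentre q K) : p = q := by
  have hzero : (2 : ℝ) • (p - q) = 0 := by
    refine eq_zero_of_vadd_subset hK hne ?_
    rintro _ ⟨x, hx, rfl⟩
    have hpq := hp _ (hq x hx)
    rwa [sub_sub_eq_add_sub, add_sub_right_comm, ← smul_sub] at hpq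
  exact sub_eq_zero.1 ((smul_eq_zero.1 hzero).resolve_left two_ne_zero)

theorem norm_map_sub_map_sq {E F : Type*} [NormedAddCommGroup E] [InnerProductSpace ℝ E]
    [NormedAddCommGroup F] [InnerProductSpace ℝ F] {L : E →ₗ[ℝ] E} (hL : L.IsSymmetric)
    {A : E →ₗ[ℝ] F} (hA : ∀ x, ‖A x‖ ^ 2 = ⟪L x, x⟫ / 2) (x v : E) :
    ‖A x - A v‖ ^ 2 = ‖A x‖ ^ 2 - (⟪L v, x⟫ - ⟪L v, v⟫ / 2) := by
  rw [← map_sub, hA, hA, map_sub, inner_sub_left, inner_sub_right, inner_sub_right, hL x v,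
    real_inner_comm (L v)]
  ring

theorem norm_sq_add_sum_two_mul_sub {d : ℕ} (p y : Euc d) :
    ‖p‖ ^ 2 + ∑ i, 2 * p i * (y i - p i) = ‖y‖ ^ 2 - ‖y - p‖ ^ 2 := by
  simp only [EuclideanSpace.real_norm_sq_eq, ← Finset.sum_add_distrib, ← Finset.sum_sub_distrib,
    PiLp.sub_apply]
  exact Finset.sum_congr rfl fun i _ => by ring

namespace IsQuadraticLift
variable {d : ℕ} {P : Set (Euc d)} {T : Set (Set (Euc d))} {s : Set (Euc d) → ℝ}
  {u : Set (Euc d) → Euc d × ℝ} {L : Euc d →ₗ[ℝ] Euc d} {c v : Euc d}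
  {A : Euc d ≃ₗ[ℝ] Euc d}

theorem isCentre_image_iff (h : IsQuadraticLift P T s u L c) (A : Euc d ≃ₗ[ℝ] Euc d)
    (v p : Euc d) : IsCentre p ((fun x => A (x - c)) '' (v +ᵥ P)) ↔ p = A v := by
  have hcentre : IsCentre (A v) ((fun x => A (x - c)) '' (v +ᵥ P)) := by
    rintro _ ⟨_, ⟨y, hy, rfl⟩, rfl⟩
    refine ⟨_, ⟨_, h.isCentre y hy, rfl⟩, ?_⟩
    simp only [vadd_eq_add, ← map_smul, ← map_sub]
    congr 1
    module
  refine ⟨fun hp => ?_, fun hp => hp ▸ hcentre⟩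
  have hA : Continuous A := A.toLinearMap.continuous_of_finiteDimensional
  have hbdd : Bornology.IsBounded ((fun x => A (x - c)) '' (v +ᵥ P)) :=
    ((h.tiling.polytope.vadd v).isCompact.image (by fun_prop)).isBounded
  exact hp.eq hbdd (h.tiling.nonempty.vadd_set.image _) hcentre

theorem mem_cellCentres_iff (h : IsQuadraticLift P T s u L c) (A : Euc d ≃ₗ[ℝ] Euc d)
    (p : Euc d) : p ∈ cellCentres (imageTiling A c T) ↔ ∃ v ∈ cellLattice P T, A v = p := by
  constructor
  · rintro ⟨_, ⟨C, hC, rfl⟩, hp⟩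
    obtain ⟨v, hv, rfl⟩ := h.tiling.exists_cellLattice_of_mem hC
    exact ⟨v, hv, ((h.isCentre_image_iff A v p).1 hp).symm⟩
  · rintro ⟨v, hv, rfl⟩
    exact ⟨_, ⟨_, h.tiling.mem_cellLattice_iff.1 hv, rfl⟩, (h.isCentre_image_iff A v _).2 rfl⟩

theorem exists_basis_cellCentres_eq (h : IsQuadraticLift P T s u L c)
    (A : Euc d ≃ₗ[ℝ] Euc d) : ∃ b : Module.Basis (Fin d) ℝ (Euc d),
      cellCentres (imageTiling A c T) = (Submodule.span ℤ (range b) : Set (Euc d)) := by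
  obtain ⟨b, hb⟩ := h.tiling.exists_basis_span_eq_cellLattice
  refine ⟨b.map A, ?_⟩
  have hrange : range (b.map A) = A.toLinearMap.restrictScalars ℤ '' range b := by
    rw [← range_comp]
    rfl
  ext p
  rw [h.mem_cellCentres_iff, hrange, Submodule.span_image, hb]
  rfl

theorem image_vadd_eq_dirichletCell (h : IsQuadraticLift P T s u L c)
    (hA : ∀ x, ‖A x‖ ^ 2 = ⟪L x, x⟫ / 2) (hv : v ∈ cellLattice P T) :
    (fun x => A (x - c)) '' (v +ᵥ P) = dirichletCell (cellCentres (imageTiling A c T)) (A v) := by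
  ext y
  obtain ⟨x, rfl⟩ := A.surjective y
  have hle : ∀ w, ‖A x - A v‖ ≤ ‖A x - A w‖ ↔
      ⟪L w, x⟫ - ⟪L w, w⟫ / 2 ≤ ⟪L v, x⟫ - ⟪L v, v⟫ / 2 := by
    intro w
    have hsq := norm_map_sub_map_sq (A := A.toLinearMap) h.symm hA x
    rw [← pow_le_pow_iff_left₀ (norm_nonneg _) (norm_nonneg _) two_ne_zero]
    exact (hsq v).symm ▸ (hsq w).symm ▸ sub_le_sub_iff_left _
  rw [mem_image_sub_iff, A.symm_apply_apply, h.mem_vadd_iff hv, add_sub_cancel_right]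
  constructor
  · intro hx q hq
    obtain ⟨w, hw, rfl⟩ := (h.mem_cellCentres_iff A q).1 hq
    exact (hle w).2 (hx w hw)
  · exact fun hx w hw => (hle w).1 (hx _ ((h.mem_cellCentres_iff A _).2 ⟨w, hw, rfl⟩))

theorem isVoronoiTiling (h : IsQuadraticLift P T s u L c)
    (hA : ∀ x, ‖A x‖ ^ 2 = ⟪L x, x⟫ / 2) : IsVoronoiTiling (imageTiling A c T) := by
  refine ⟨h.exists_basis_cellCentres_eq A, ?_⟩
  rintro _ ⟨C, hC, rfl⟩
  obtain ⟨v, hv, rfl⟩ := h.tiling.exists_cellLattice_of_mem hC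
  refine ⟨⟨_, (h.isCentre_image_iff A v _).2 rfl⟩, fun p hp => ?_⟩
  rw [(h.isCentre_image_iff A v p).1 hp]
  exact h.image_vadd_eq_dirichletCell hA hv

theorem mem_imageSurface_iff (h : IsQuadraticLift P T s u L c)
    (hA : ∀ x, ‖A x‖ ^ 2 = ⟪L x, x⟫ / 2) (hv : v ∈ cellLattice P T) {z : Euc d × ℝ}
    (hz : A.symm z.1 + c ∈ v +ᵥ P) :
    z ∈ imageSurface A c (generatrixSurface T s P) ↔ z.2 = ‖z.1‖ ^ 2 - ‖z.1 - A v‖ ^ 2 := by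
  have hsq := norm_map_sub_map_sq (A := A.toLinearMap) h.symm hA (A.symm z.1) v
  simp only [LinearEquiv.coe_coe, A.apply_symm_apply] at hsq
  rw [_root_.mem_imageSurface_iff, h.lifting.mem_generatrixSurface_iff h.tiling h.scaling
    (h.tiling.mem_cellLattice_iff.1 hv) hz, h.pairFunction_vadd hv, add_sub_cancel_right, hsq,
    sub_sub_cancel]

theorem circumscribesStdParaboloid (h : IsQuadraticLift P T s u L c)
    (hA : ∀ x, ‖A x‖ ^ 2 = ⟪L x, x⟫ / 2) :
    CircumscribesStdParaboloid (imageTiling A c T)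
      (imageSurface A c (generatrixSurface T s P)) := by
  simp only [CircumscribesStdParaboloid, ← EuclideanSpace.real_norm_sq_eq]
  refine ⟨fun z hz => ?_, fun z hz => ⟨fun heq => ?_, fun hcentre => ?_⟩, ?_⟩
  · obtain ⟨v, hv, hx⟩ := h.tiling.exists_cellLattice_mem_vadd (A.symm z.1 + c)
    rw [(h.mem_imageSurface_iff hA hv hx).1 hz]
    exact sub_le_self _ (sq_nonneg _)
  · obtain ⟨v, hv, hx⟩ := h.tiling.exists_cellLattice_mem_vadd (A.symm z.1 + c)
    rw [(h.mem_imageSurface_iff hA hv hx).1 hz, sub_eq_self, pow_eq_zero_iff two_ne_zero,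
      norm_eq_zero, sub_eq_zero] at heq
    exact (h.mem_cellCentres_iff A _).2 ⟨v, hv, heq.symm⟩
  · obtain ⟨v, hv, hvz⟩ := (h.mem_cellCentres_iff A _).1 hcentre
    have hx : A.symm z.1 + c ∈ v +ᵥ P := by
      rw [← hvz, A.symm_apply_apply]
      exact vadd_mem_vadd_set h.centre_mem
    rw [(h.mem_imageSurface_iff hA hv hx).1 hz, hvz, sub_self, norm_zero, zero_pow two_ne_zero,
      sub_zero]
  · rintro _ ⟨C, hC, rfl⟩ p hp y hy
    obtain ⟨v, hv, rfl⟩ := h.tiling.exists_cellLattice_of_mem hC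
    obtain rfl := (h.isCentre_image_iff A v p).1 hp
    rw [h.mem_imageSurface_iff hA hv ((mem_image_sub_iff A c y _).1 hy)]
    exact norm_sq_add_sum_two_mul_sub (A v) y

end IsQuadraticLift

/-! ### The matrix of the form -/

section FormMatrix
variable {d : ℕ} {Q : Matrix (Fin d) (Fin d) ℝ}

theorem isSymm_of_isSymmetric_toEuclideanLin (h : (Matrix.toEuclideanLin Q).IsSymmetric) :
    Q.IsSymm := by
  rw [Matrix.isSymmetric_toEuclideanLin_iff, Matrix.IsHermitian,
    Matrix.conjTranspose_eq_transpose_of_trivial] at h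
  exact h

theorem isUnit_of_injective_toEuclideanLin
    (h : Function.Injective (Matrix.toEuclideanLin Q)) : IsUnit Q := by
  rw [← Matrix.mulVec_injective_iff_isUnit]
  exact fun x y hxy =>
    WithLp.toLp_injective 2 (h (congrArg (WithLp.toLp 2) hxy))

theorem halfForm_eq (Q : Matrix (Fin d) (Fin d) ℝ) (x : Euc d) :
    halfForm Q x = ⟪Matrix.toEuclideanLin Q x, x⟫ / 2 := by
  rw [halfForm, real_inner_comm, one_div_mul_eq_div]
  rfl

open scoped MatrixOrder in
theorem exists_linearEquiv_norm_sq_eq (hQ : Q.PosDef) :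
    ∃ A : Euc d ≃ₗ[ℝ] Euc d, ∀ x, ‖A x‖ ^ 2 = ⟪Matrix.toEuclideanLin Q x, x⟫ := by
  obtain ⟨B, hunit, hself, rfl⟩ :=
    CStarAlgebra.isStrictlyPositive_iff_exists_isUnit_and_isSelfAdjoint_and_eq_mul_self.1
      hQ.isStrictlyPositive
  have hbij : Function.Bijective (Matrix.toEuclideanLin B) :=
    (Module.End.isUnit_iff _).1 (hunit.map (Matrix.toLpLinAlgEquiv 2))
  have hsymm : (Matrix.toEuclideanLin B).IsSymmetric :=
    Matrix.isSymmetric_toEuclideanLin_iff.2 hself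
  refine ⟨LinearEquiv.ofBijective _ hbij, fun x => ?_⟩
  rw [← real_inner_self_eq_norm_sq, LinearEquiv.ofBijective_apply, ← hsymm,
    Matrix.toLpLin_mul_same, LinearMap.comp_apply]

theorem exists_sum_sq_eq_halfForm (hQ : Q.PosDef) :
    ∃ A : Euc d ≃ₗ[ℝ] Euc d, ∀ x, ∑ i, (A x i) ^ 2 = halfForm Q x := by
  obtain ⟨A, hA⟩ := exists_linearEquiv_norm_sq_eq hQ
  refine ⟨A.trans (LinearEquiv.smulOfNeZero ℝ (Euc d) (√2)⁻¹ (by positivity)), fun x => ?_⟩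
  rw [halfForm_eq, ← hA, ← EuclideanSpace.real_norm_sq_eq, LinearEquiv.trans_apply,
    LinearEquiv.smulOfNeZero_apply, norm_smul, mul_pow, norm_inv, inv_pow, Real.norm_eq_abs,
    sq_abs, Real.sq_sqrt zero_le_two, inv_mul_eq_div]

end FormMatrix

namespace IsQuadraticLift
variable {d : ℕ} {P : Set (Euc d)} {T : Set (Set (Euc d))} {s : Set (Euc d) → ℝ}
  {u : Set (Euc d) → Euc d × ℝ} {L : Euc d →ₗ[ℝ] Euc d} {c : Euc d}

theorem isFormMatrix_iff (h : IsQuadraticLift P T s u L c) (Q : Matrix (Fin d) (Fin d) ℝ) :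
    IsFormMatrix P T s Q ↔ Q = Matrix.toEuclideanLin.symm L := by
  rw [LinearEquiv.eq_symm_apply]
  constructor
  · rintro ⟨-, -, hQ⟩
    refine h.tiling.ext_facetVectors fun p hp => ?_
    obtain ⟨n, hn⟩ := h.tiling.exists_isNormalFromTo h.tiling.self_mem hp.1
      (h.tiling.ne_of_adjacentCells h.tiling.self_mem hp.2)
    rw [h.map_facetVector hp hn, ← hQ p n hp.1 hp.2 hn]
    rfl
  · rintro rfl
    exact ⟨isSymm_of_isSymmetric_toEuclideanLin h.symm,
      (Matrix.isUnit_iff_isUnit_det Q).1 (isUnit_of_injective_toEuclideanLin h.injective),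
      fun p n hp hadj hn => h.map_facetVector ⟨hp, hadj⟩ hn⟩

theorem posDef (h : IsQuadraticLift P T s u L c) :
    (Matrix.toEuclideanLin.symm L : Matrix (Fin d) (Fin d) ℝ).PosDef := by
  obtain ⟨Q, rfl⟩ := Matrix.toEuclideanLin.surjective L
  rw [LinearEquiv.symm_apply_apply]
  have hpos : Q.PosSemidef :=
    Matrix.isPositive_toEuclideanLin_iff.1 ⟨h.symm, fun x => by simpa using h.inner_nonneg x⟩
  exact hpos.posDef_iff_isUnit.2 (isUnit_of_injective_toEuclideanLin h.injective)

end IsQuadraticLift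

end

theorem mainTheorem9 (d : ℕ) (P : Set (Euc d)) (T : Set (Set (Euc d)))
    (hT : IsParallelohedralTiling P T) (s : Set (Euc d) → ℝ)
    (hs : IsCanonicalScaling T s) (hinv : IsTranslationInvariant T s) :
    ∃ c : Euc d, IsCentre c P ∧
      ∃ Q : Matrix (Fin d) (Fin d) ℝ,
        (∀ Q' : Matrix (Fin d) (Fin d) ℝ, IsFormMatrix P T s Q' ↔ Q' = Q) ∧
        Q.PosDef ∧
        (∃ A : Euc d ≃ₗ[ℝ] Euc d, ∀ x, ∑ i, (A x i) ^ 2 = halfForm Q x) ∧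
        ∀ A : Euc d ≃ₗ[ℝ] Euc d, (∀ x, ∑ i, (A x i) ^ 2 = halfForm Q x) →
          IsVoronoiTiling (imageTiling A c T) ∧
          IsGeneratrix (imageTiling A c T) (imageSurface A c (generatrixSurface T s P)) ∧
          CircumscribesStdParaboloid (imageTiling A c T)
            (imageSurface A c (generatrixSurface T s P)) := by
  obtain ⟨u, L, c, h⟩ := hs.exists_isQuadraticLift hT hinv
  refine ⟨c, h.isCentre, Matrix.toEuclideanLin.symm L, h.isFormMatrix_iff, h.posDef,
    exists_sum_sq_eq_halfForm h.posDef, fun A hA => ?_⟩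
  have hA' : ∀ x, ‖A x‖ ^ 2 = ⟪L x, x⟫ / 2 := by
    intro x
    rw [EuclideanSpace.real_norm_sq_eq, hA, halfForm_eq, LinearEquiv.apply_symm_apply]
  exact ⟨h.isVoronoiTiling hA', (h.lifting.isGeneratrix hT hs).image A c,
    h.circumscribesStdParaboloid hA'⟩
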